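/- For $k\ge 1$, a $k$-modem placed at a point $q$ of the plane, in the presence of a family $\mathcal L$ of line segments, illuminates a point $p$ if the interior of the line segment joining $q$ and $p$ intersects at most $k$ elements of $\mathcal L$. Theorem. Let $k\ge 1$ and $n\ge 0$ be integers and let $\mathcal L$ be a set of $n$ pairwise disjoint closed line segments in the plane, each of which is nondegenerate and horizontal or vertical. Then there is a set of at most $6\frac nk+1$ points of the plane such that every point of the plane is illuminated by a $k$-modem at one of these points. Moreover, the locations of at most $6\frac nk+1$ $k$-modems that together illuminate the plane can be computed in $O(n\log n)$ time on a real RAM: there are a single program and a constant $C$ such that for all such $n$, $k$ and $\mathcal L$, on input $n$, $k$ and the coordinates of the endpoints of the segments, the program halts within $C\,(n\log n+1)$ steps and outputs such locations. (The real RAM stores integers and real numbers in arrays with indirect addressing; storage accesses, addition, subtraction, halving with rounding down and comparison of nonnegative integers, the four field operations and comparison of real numbers, and assignments take one step each. Reals cannot be rounded or converted to integers.) -/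

import Mathlib

/-- The plane, with points given by their Cartesian coordinates. -/
abbrev Plane : Type := ℝ × ℝ

/-- A (nondegenerate, closed) horizontal or vertical line segment, given by its two endpoints
in either order. -/
structure AxisSegment where
  fst : Plane
  snd : Plane
  ne : fst ≠ snd
  axisParallel : fst.1 = snd.1 ∨ fst.2 = snd.2

namespace AxisSegment

/-- The points of the segment, endpoints included. -/
def points (s : AxisSegment) : Set Plane := segment ℝ s.fst s.snd

end AxisSegment

/-- A `k`-modem at `q` illuminates the point `p` in the presence of the segments `L i`: the
interior of the line segment joining `q` and `p` meets at most `k` of the segments. -/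
def Illuminates {n : ℕ} (k : ℕ) (L : Fin n → AxisSegment) (q p : Plane) : Prop :=
  {i : Fin n | (openSegment ℝ q p ∩ (L i).points).Nonempty}.ncard ≤ k

/-- The `k`-modems at the points of `M` together illuminate the whole plane. -/
def IlluminatePlane {n : ℕ} (k : ℕ) (L : Fin n → AxisSegment) (M : Set Plane) : Prop :=
  ∀ p : Plane, ∃ q ∈ M, Illuminates k L q p

/-! ### The real RAM

The machine has integer storage and real storage. Both are organised in arrays indexed from `0`
(a program mentions only finitely many arrays; cell `0` of an array can serve as a register).
Every access to storage, arithmetic operation, comparison and assignment takes one unit of time.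
Integers serve for counting and addressing. Real numbers can be combined by the four field
operations and compared exactly, but they cannot be rounded or converted to integers. -/

namespace RealRAM

/-- The content of the storage: `σ.int a i` and `σ.real a i` are the cells with index `i` of the
integer array `a` and of the real array `a`. -/
structure State where
  int : ℕ → ℕ → ℕ
  real : ℕ → ℕ → ℝ

namespace State

/-- Overwrite cell `i` of the integer array `a`. -/
def setInt (σ : State) (a i v : ℕ) : State :=
  { σ with int := Function.update σ.int a (Function.update (σ.int a) i v) }

/-- Overwrite cell `i` of the real array `a`. -/
noncomputable def setReal (σ : State) (a i : ℕ) (v : ℝ) : State :=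
  { σ with real := Function.update σ.real a (Function.update (σ.real a) i v) }

end State

/-- Integer expressions. The index of `read` may itself be read from storage (indirect
addressing). -/
inductive IntExpr where
  | const (c : ℕ)
  | read (a : ℕ) (i : IntExpr)
  | add (e f : IntExpr)
  | sub (e f : IntExpr)
  | half (e : IntExpr)

namespace IntExpr

/-- The value of an integer expression; subtraction is truncated at `0`, halving rounds down. -/
def eval (σ : State) : IntExpr → ℕ
  | const c => c
  | read a i => σ.int a (i.eval σ)
  | add e f => e.eval σ + f.eval σ
  | sub e f => e.eval σ - f.eval σ
  | half e => e.eval σ / 2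

/-- The time needed to evaluate an integer expression: one unit for each operation in it. -/
def cost : IntExpr → ℕ
  | const _ => 1
  | read _ i => i.cost + 1
  | add e f => e.cost + f.cost + 1
  | sub e f => e.cost + f.cost + 1
  | half e => e.cost + 1

end IntExpr

/-- Real expressions. Only rational constants may occur in a program. -/
inductive RealExpr where
  | const (c : ℚ)
  | read (a : ℕ) (i : IntExpr)
  | add (e f : RealExpr)
  | sub (e f : RealExpr)
  | mul (e f : RealExpr)
  | div (e f : RealExpr)

namespace RealExpr

/-- The value of a real expression; a division by `0` returns `0`. -/
noncomputable def eval (σ : State) : RealExpr → ℝ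
  | const c => (c : ℝ)
  | read a i => σ.real a (i.eval σ)
  | add e f => e.eval σ + f.eval σ
  | sub e f => e.eval σ - f.eval σ
  | mul e f => e.eval σ * f.eval σ
  | div e f => e.eval σ / f.eval σ

/-- The time needed to evaluate a real expression: one unit for each operation in it. -/
def cost : RealExpr → ℕ
  | const _ => 1
  | read _ i => i.cost + 1
  | add e f => e.cost + f.cost + 1
  | sub e f => e.cost + f.cost + 1
  | mul e f => e.cost + f.cost + 1
  | div e f => e.cost + f.cost + 1

end RealExpr

/-- Tests: comparisons of integers, comparisons of reals, and Boolean combinations of these. -/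
inductive Test where
  | intLt (e f : IntExpr)
  | realLt (e f : RealExpr)
  | not (b : Test)
  | and (b c : Test)

namespace Test

/-- The test succeeds. -/
def Holds (σ : State) : Test → Prop
  | intLt e f => e.eval σ < f.eval σ
  | realLt e f => e.eval σ < f.eval σ
  | not b => ¬ b.Holds σ
  | and b c => b.Holds σ ∧ c.Holds σ

/-- The time needed to evaluate a test: one unit for each operation in it. -/
def cost : Test → ℕ
  | intLt e f => e.cost + f.cost + 1
  | realLt e f => e.cost + f.cost + 1
  | not b => b.cost + 1
  | and b c => b.cost + c.cost + 1

end Test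

/-- Programs. A program is a finite text that does not depend on the input. -/
inductive Program where
  | skip
  | setInt (a : ℕ) (i e : IntExpr)
  | setReal (a : ℕ) (i : IntExpr) (e : RealExpr)
  | seq (P Q : Program)
  | branch (b : Test) (P Q : Program)
  | loop (b : Test) (P : Program)

/-- `Runs P σ τ t`: started in the state `σ`, the program `P` halts in the state `τ` after exactly
`t` units of time. -/
inductive Runs : Program → State → State → ℕ → Prop
  | skip (σ : State) : Runs .skip σ σ 1
  | setInt (σ : State) (a : ℕ) (i e : IntExpr) :
      Runs (.setInt a i e) σ (σ.setInt a (i.eval σ) (e.eval σ)) (i.cost + e.cost + 1)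
  | setReal (σ : State) (a : ℕ) (i : IntExpr) (e : RealExpr) :
      Runs (.setReal a i e) σ (σ.setReal a (i.eval σ) (e.eval σ)) (i.cost + e.cost + 1)
  | seq {P Q : Program} {σ τ υ : State} {s t : ℕ} :
      Runs P σ τ s → Runs Q τ υ t → Runs (.seq P Q) σ υ (s + t)
  | branch_true {b : Test} {P Q : Program} {σ τ : State} {t : ℕ} :
      b.Holds σ → Runs P σ τ t → Runs (.branch b P Q) σ τ (b.cost + t + 1)
  | branch_false {b : Test} {P Q : Program} {σ τ : State} {t : ℕ} :
      ¬ b.Holds σ → Runs Q σ τ t → Runs (.branch b P Q) σ τ (b.cost + t + 1)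
  | loop_true {b : Test} {P : Program} {σ τ υ : State} {s t : ℕ} :
      b.Holds σ → Runs P σ τ s → Runs (.loop b P) τ υ t →
        Runs (.loop b P) σ υ (b.cost + s + t + 1)
  | loop_false {b : Test} {P : Program} {σ : State} :
      ¬ b.Holds σ → Runs (.loop b P) σ σ (b.cost + 1)

end RealRAM

/-- The initial storage for the modem problem: the integer array `0` begins with `n, k`, the real
arrays `0`, `1`, `2`, `3` hold in their cells `i < n` the coordinates `x₁`, `y₁`, `x₂`, `y₂` of the
endpoints `(x₁, y₁)` and `(x₂, y₂)` of the `i`-th segment, and all other cells are `0`. -/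
noncomputable def modemInput {n : ℕ} (k : ℕ) (L : Fin n → AxisSegment) : RealRAM.State where
  int
    | 0, 0 => n
    | 0, 1 => k
    | _, _ => 0
  real a i :=
    if h : i < n then
      match a with
      | 0 => (L ⟨i, h⟩).fst.1
      | 1 => (L ⟨i, h⟩).fst.2
      | 2 => (L ⟨i, h⟩).snd.1
      | 3 => (L ⟨i, h⟩).snd.2
      | _ => 0
    else 0

/-- The number of modems returned in a final storage: cell `0` of the integer array `0`. -/
def modemCount (σ : RealRAM.State) : ℕ := σ.int 0 0

/-- The location of the `j`-th returned modem: cell `j` of the real array `0` and cell `j` of the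
real array `1`. -/
def modemLocation (σ : RealRAM.State) (j : ℕ) : Plane := (σ.real 0 j, σ.real 1 j)

/-- The set of all returned locations. -/
def modemLocations (σ : RealRAM.State) : Set Plane :=
  {q | ∃ j < modemCount σ, modemLocation σ j = q}

/-! ### Program logic: total correctness together with running time -/

namespace RealRAM

/-! A vertical line sweeps the plane from left to right. What is not yet known to be illuminated is
covered by cells: horizontal strips between consecutive boundaries of a finite set `B`, each
extending to the right from its own abscissa `u`. Consider a sightline inside a cell that starts at
a point whose abscissa is not that of a vertical segment. Of the vertical segments on a common line
it meets at most one, since they are disjoint. Hence obstacles are counted by keys: every horizontal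
segment has a key of its own, and vertical segments on one line share theirs. If at most `k` keys
meet a cell, a modem inside it sees all of it (`Scene.sees_of_keys`).

A cell is kept until its counter reaches `k + 1`. A modem placed at an abscissa `m` shortly before
the current line then sees the whole part of the cell left of the line. This modem can be used
twice: it also lies in a new cell started at `Xp < m`, where no endpoint has its abscissa strictly
between `Xp` and the line. Such a cell is in phase 1, its modem being already located; a cell in
phase 0 still owes a modem. At the line the new cell inherits the `l` current horizontal segments,
so the second use needs `l + 1 ≤ k`. Otherwise, or at the end of phase 1, a new cell in phase 0
starts on the line. If `l` is more than about `k / 2`, the cell is split at its median current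
horizontal segment, which becomes a boundary and obstructs neither half (`Scene.Inv.settle`).

A vertical segment may cross many cells completely. Disjointness makes these cells free of current
horizontal segments at the line, so they can first be merged into one (`Scene.Inv.merge`). A
vertical segment is thus counted in at most three cells: those of its two ends and one that it
crosses.

The bound is an amortisation. A modem costs `6k`, each segment brings `36`, and the first cell
starts with `8k`. A horizontal segment gives its `36` to one cell; a vertical one gives `14` to each
end cell and `8` to the crossed cell. `CreditOK` says how much a cell must hold, depending on its
phase, on the number `r = k + 1 - cnt` of hits it can still take, and on `l`. The lemmas in the
namespace `CreditOK` show that every event preserves this and that the credit covers the modem and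
the successors of an overfull cell. Finally every phase 0 cell can pay `6k` for its modem and the
lowest cell still keeps `2k`, so `6k` times the number of modems is at most `6k + 36n`
(`RealRAM.count_final`).

For the running time, the distinct heights are numbered, and the boundaries and the heights of
current horizontal segments are kept as sets of numbers in complete binary trees of sums. Rank and
selection in such trees give neighbouring boundaries, the number of horizontal segments in a cell
and the median in logarithmic time. A merge deletes a boundary, while a segment creates at most
three, so the number of merges is linear; the potential in `Wp.loop_potential` does this accounting.
Sorting is done with tournament trees. The invariant `Scene.Inv` concerns abstract states of the
sweep only. `RealRAM.Rep` ties these to the storage, so geometry and machine code are verified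
separately and meet in `locateModems_spec`. -/

@[simp] theorem State.setInt_int (σ : State) (a i v b : ℕ) :
    (σ.setInt a i v).int b = if b = a then Function.update (σ.int a) i v else σ.int b := by
  simp only [State.setInt, Function.update_apply]

@[simp] theorem State.setInt_real (σ : State) (a i v : ℕ) : (σ.setInt a i v).real = σ.real := rfl

@[simp] theorem State.setReal_real (σ : State) (a i : ℕ) (v : ℝ) (b : ℕ) :
    (σ.setReal a i v).real b = if b = a then Function.update (σ.real a) i v else σ.real b := by
  simp only [State.setReal, Function.update_apply]

@[simp] theorem State.setReal_int (σ : State) (a i : ℕ) (v : ℝ) : (σ.setReal a i v).int = σ.int :=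
  rfl

/-- Started in `σ`, the program `P` halts in a state and after a time that satisfy `Q`. -/
def Wp (P : Program) (σ : State) (Q : State → ℕ → Prop) : Prop :=
  ∃ τ t, Runs P σ τ t ∧ Q τ t

theorem Wp.mono {P : Program} {σ : State} {Q R : State → ℕ → Prop} (h : Wp P σ Q)
    (hQR : ∀ τ t, Q τ t → R τ t) : Wp P σ R := by
  obtain ⟨τ, t, hr, hq⟩ := h
  exact ⟨τ, t, hr, hQR _ _ hq⟩

theorem Wp.skip {σ : State} {Q : State → ℕ → Prop} (h : Q σ 1) : Wp .skip σ Q :=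
  ⟨_, _, .skip σ, h⟩

theorem Wp.setInt {σ : State} {a : ℕ} {i e : IntExpr} {Q : State → ℕ → Prop}
    (h : Q (σ.setInt a (i.eval σ) (e.eval σ)) (i.cost + e.cost + 1)) : Wp (.setInt a i e) σ Q :=
  ⟨_, _, .setInt σ a i e, h⟩

theorem Wp.setReal {σ : State} {a : ℕ} {i : IntExpr} {e : RealExpr} {Q : State → ℕ → Prop}
    (h : Q (σ.setReal a (i.eval σ) (e.eval σ)) (i.cost + e.cost + 1)) : Wp (.setReal a i e) σ Q :=
  ⟨_, _, .setReal σ a i e, h⟩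

/-- The postcondition takes the time as an argument, so the times of the parts add up inside it
while a program is unfolded from the left; no separate cost calculus is needed. -/
theorem Wp.seq {P Q : Program} {σ : State} {R : State → ℕ → Prop}
    (h : Wp P σ fun τ s => Wp Q τ fun υ t => R υ (s + t)) : Wp (.seq P Q) σ R := by
  obtain ⟨τ, s, h1, υ, t, h2, h3⟩ := h
  exact ⟨_, _, .seq h1 h2, h3⟩

theorem Wp.branch {b : Test} {P Q : Program} {σ : State} {R : State → ℕ → Prop}
    (h1 : b.Holds σ → Wp P σ fun τ t => R τ (b.cost + t + 1))
    (h2 : ¬ b.Holds σ → Wp Q σ fun τ t => R τ (b.cost + t + 1)) : Wp (.branch b P Q) σ R := by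
  by_cases hb : b.Holds σ
  · obtain ⟨τ, t, h, hr⟩ := h1 hb
    exact ⟨_, _, .branch_true hb h, hr⟩
  · obtain ⟨τ, t, h, hr⟩ := h2 hb
    exact ⟨_, _, .branch_false hb h, hr⟩

/-- Amortised rule for loops: `I` is an invariant and every round is paid for by the potential. -/
theorem Wp.loop {b : Test} {P : Program} (I : State → Prop) (pot : State → ℕ)
    (hbody : ∀ σ, I σ → b.Holds σ →
      Wp P σ fun τ t => I τ ∧ pot τ + t + (b.cost + 1) ≤ pot σ)
    {σ : State} (hσ : I σ) {Q : State → ℕ → Prop}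
    (hQ : ∀ τ t, I τ → ¬ b.Holds τ → pot τ + t ≤ pot σ + (b.cost + 1) → Q τ t) :
    Wp (.loop b P) σ Q := by
  suffices H : ∀ m σ, I σ → pot σ ≤ m →
      Wp (.loop b P) σ fun τ t => I τ ∧ ¬ b.Holds τ ∧ pot τ + t ≤ pot σ + (b.cost + 1) from
    (H _ σ hσ le_rfl).mono fun τ t h => hQ τ t h.1 h.2.1 h.2.2
  intro m
  induction m using Nat.strong_induction_on with
  | _ m ih =>
    intro σ hσ hm
    by_cases hb : b.Holds σ
    · obtain ⟨τ, s, h1, h2, h3⟩ := hbody σ hσ hb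
      obtain ⟨υ, t, h4, h5, h6, h7⟩ := ih (pot τ) (by omega) τ h2 le_rfl
      exact ⟨υ, _, .loop_true hb h1 h4, h5, h6, by omega⟩
    · exact ⟨σ, _, .loop_false hb, hσ, hb, le_rfl⟩

/-- The register held in cell `0` of the integer array `a`. -/
abbrev reg (a : ℕ) : IntExpr := .read a (.const 0)

/-- The register held in cell `0` of the real array `a`. -/
abbrev rreg (a : ℕ) : RealExpr := .read a (.const 0)

/-- Assignment to a register. -/
abbrev Program.set (a : ℕ) (e : IntExpr) : Program := .setInt a (.const 0) e

/-- Assignment to a real register. -/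
abbrev Program.rset (a : ℕ) (e : RealExpr) : Program := .setReal a (.const 0) e

/-- The test `e ≤ f`. -/
abbrev Test.intLe (e f : IntExpr) : Test := .not (.intLt f e)

end RealRAM

/-! ### Complete binary trees stored in arrays -/

namespace RealRAM

/-- In the array `f`, which holds a complete binary tree with leaves `N, …, 2 N - 1`, the value of
every inner node is obtained by `op` from the values of its children. -/
def IsTree (op : ℕ → ℕ → ℕ) (N : ℕ) (f : ℕ → ℕ) : Prop :=
  ∀ j, 1 ≤ j → j < N → f j = op (f (2 * j)) (f (2 * j + 1))

/-- Recompute the ancestors of the node held in register `30`; `node` recomputes the node held in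
register `30`. -/
def climb (node : Program) : Program :=
  .loop (.intLt (.const 1) (reg 30)) (.seq (.set 30 (.half (reg 30))) node)

/-- Changing a leaf can spoil the tree equation only at its ancestors, and these are recomputed from
below. The real storage is fixed as `ρ` because the operation of a tournament depends on the real
keys. -/
theorem climb_spec {op : ℕ → ℕ → ℕ} {a c L p v : ℕ} {node : Program} {f : ℕ → ℕ} {ρ : ℕ → ℕ → ℝ}
    (ha : a ≠ 30)
    (hnode : ∀ σ : State, σ.real = ρ → Wp node σ fun τ t => t ≤ c ∧ τ.real = σ.real ∧
      (∀ x, x ≠ a → τ.int x = σ.int x) ∧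
      τ.int a = Function.update (σ.int a) (σ.int 30 0)
        (op (σ.int a (2 * σ.int 30 0)) (σ.int a (2 * σ.int 30 0 + 1))))
    (hf : IsTree op (2 ^ L) f) (hp : p < 2 ^ L) {σ : State} (hρ : σ.real = ρ)
    (hi : σ.int 30 0 = 2 ^ L + p) (hσ : σ.int a = Function.update f (2 ^ L + p) v) :
    Wp (climb node) σ fun τ t => t ≤ (c + 10) * (L + 1) ∧ τ.real = σ.real ∧
      (∀ x, x ≠ 30 → x ≠ a → τ.int x = σ.int x) ∧ IsTree op (2 ^ L) (τ.int a) ∧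
      ∀ q, 2 ^ L ≤ q → τ.int a q = Function.update f (2 ^ L + p) v q := by
  refine Wp.loop (fun τ => τ.real = ρ ∧ (∀ x, x ≠ 30 → x ≠ a → τ.int x = σ.int x) ∧
    1 ≤ τ.int 30 0 ∧ τ.int 30 0 < 2 ^ (L + 1) ∧
    (∀ q, 2 ^ L ≤ q → τ.int a q = Function.update f (2 ^ L + p) v q) ∧
    -- Only the proper ancestors of the current node, obtained from it by repeated halving, may
    -- still violate the tree equation.
    ∀ j, 1 ≤ j → j < 2 ^ L → (∀ e, j ≠ τ.int 30 0 / 2 ^ (e + 1)) →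
      τ.int a j = op (τ.int a (2 * j)) (τ.int a (2 * j + 1)))
    (fun τ => (c + 10) * Nat.log 2 (τ.int 30 0)) ?_ ?_ ?_
  · rintro τ ⟨h1, h2, h3, h4, h5, h6⟩ hb
    simp only [Test.Holds, IntExpr.eval] at hb
    apply Wp.seq; apply Wp.setInt
    refine (hnode _ (by simpa using h1)).mono ?_
    rintro υ t ⟨ht, g1, g2, g3⟩
    simp only [IntExpr.eval, State.setInt_int, ha, if_false, if_true, Function.update_self,
      State.setInt_real] at g1 g2 g3
    have e30 : υ.int 30 0 = τ.int 30 0 / 2 := by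
      rw [g2 30 (Ne.symm ha)]; simp
    set i := τ.int 30 0 with hi'
    have hlt : i / 2 < 2 ^ L := by rw [pow_succ] at h4; omega
    have hlog : Nat.log 2 i = Nat.log 2 (i / 2) + 1 := by
      rw [Nat.log_div_base]
      have := Nat.log_pos (b := 2) (n := i) (by norm_num) (by omega)
      omega
    refine ⟨⟨g1.trans h1, ?_, ?_, ?_, ?_, ?_⟩, ?_⟩
    · intro x hx hxa
      rw [g2 x hxa, if_neg hx, h2 x hx hxa]
    · rw [e30]; omega
    · rw [e30]; omega
    · intro q hq
      rw [g3, Function.update_of_ne (by omega), h5 q hq]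
    · intro j hj hjN hje
      rw [e30] at hje
      rw [g3]
      by_cases hji : j = i / 2
      · subst hji
        rw [Function.update_self, Function.update_of_ne (by omega),
          Function.update_of_ne (by omega)]
      · have hp0 := hje 0
        rw [zero_add, pow_one] at hp0
        rw [Function.update_of_ne hji, Function.update_of_ne (by omega),
          Function.update_of_ne (by omega)]
        refine h6 j hj hjN fun e => ?_
        rcases e with _ | e
        · simpa using hji
        · have := hje e
          rwa [Nat.div_div_eq_div_mul, ← pow_succ'] at this
    · simp only [e30, hlog, IntExpr.cost, Test.cost]
      ring_nf
      omega
  · refine ⟨hρ, fun _ _ _ => rfl, by rw [hi]; have := Nat.two_pow_pos L; omega,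
      by rw [hi, pow_succ]; omega, fun q _ => by rw [hσ], ?_⟩
    intro j hj hjN hje
    have := hje 0
    rw [hi, zero_add, pow_one] at this
    rw [hσ, Function.update_of_ne (by omega), Function.update_of_ne (by omega),
      Function.update_of_ne (by omega)]
    exact hf j hj hjN
  · rintro τ t ⟨h1, h2, h3, h4, h5, h6⟩ hb hpot
    simp only [Test.Holds, IntExpr.eval, not_lt] at hb
    have h30 : τ.int 30 0 = 1 := by omega
    refine ⟨?_, h1.trans hρ.symm, h2, ?_, h5⟩
    · have : Nat.log 2 (σ.int 30 0) ≤ L := by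
        rw [hi]
        refine Nat.lt_succ_iff.mp (Nat.log_lt_of_lt_pow ?_ ?_)
        · have := Nat.two_pow_pos L; omega
        · rw [pow_succ]; omega
      have h7 := Nat.mul_le_mul_left (c + 10) this
      simp only [Test.cost, IntExpr.cost] at hpot
      rw [Nat.mul_succ]
      omega
    · intro j hj hjN
      refine h6 j hj hjN fun e => ?_
      rw [h30, Nat.div_eq_of_lt (Nat.one_lt_two_pow (by omega))]
      omega

/-! ### Trees of sums -/

/-- The sum of the leaves `0, …, p - 1`. -/
def prefixSum (N : ℕ) (f : ℕ → ℕ) (p : ℕ) : ℕ := ∑ q ∈ Finset.range p, f (N + q)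

theorem prefixSum_succ (N : ℕ) (f : ℕ → ℕ) (p : ℕ) :
    prefixSum N f (p + 1) = prefixSum N f p + f (N + p) := Finset.sum_range_succ _ _

theorem prefixSum_add (N : ℕ) (f : ℕ → ℕ) (p m : ℕ) :
    prefixSum N f (p + m) = prefixSum N f p + ∑ q ∈ Finset.range m, f (N + p + q) := by
  simp only [prefixSum, Finset.sum_range_add, add_assoc]

/-- A node `j` at height `s` has the leaves `j * 2 ^ s, …, (j + 1) * 2 ^ s - 1`. This follows by
induction on the height, the two children contributing adjacent blocks. -/
theorem IsTree.eq_sum {L : ℕ} {f : ℕ → ℕ} (hf : IsTree (· + ·) (2 ^ L) f) :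
    ∀ s ≤ L, ∀ j, 2 ^ (L - s) ≤ j → j < 2 ^ (L - s + 1) →
      f j = ∑ q ∈ Finset.range (2 ^ s), f (j * 2 ^ s + q) := by
  intro s
  induction s with
  | zero => intro _ j _ _; simp
  | succ s ih =>
    intro hs j h1 h2
    have e : L - s = L - (s + 1) + 1 := by omega
    have h3 : 2 ^ (L - (s + 1) + 1) ≤ 2 ^ L := Nat.pow_le_pow_right (by norm_num) (by omega)
    have h4 := Nat.two_pow_pos (L - (s + 1))
    rw [hf j (by omega) (by omega), ih (by omega) (2 * j) (by rw [e, pow_succ]; omega)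
        (by rw [e, pow_succ]; omega),
      ih (by omega) (2 * j + 1) (by rw [e, pow_succ]; omega) (by rw [e, pow_succ]; omega)]
    rw [show 2 ^ (s + 1) = 2 ^ s + 2 ^ s by ring, Finset.sum_range_add]
    congr 1 <;> refine Finset.sum_congr rfl fun q _ => ?_ <;> congr 1 <;> ring

/-- The program that recomputes a node of a tree of sums. -/
def sumNode (a : ℕ) : Program :=
  .setInt a (reg 30) (.add (.read a (.add (reg 30) (reg 30)))
    (.read a (.add (.add (reg 30) (reg 30)) (.const 1))))

theorem sumNode_spec {a : ℕ} {σ : State} :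
    Wp (sumNode a) σ fun τ t => t ≤ 20 ∧ τ.real = σ.real ∧
      (∀ x, x ≠ a → τ.int x = σ.int x) ∧
      τ.int a = Function.update (σ.int a) (σ.int 30 0)
        (σ.int a (2 * σ.int 30 0) + σ.int a (2 * σ.int 30 0 + 1)) := by
  apply Wp.setInt
  simp only [IntExpr.cost, IntExpr.eval, State.setInt_int, State.setInt_real, two_mul, if_true]
  refine ⟨by norm_num, trivial, fun x hx => by rw [if_neg hx], trivial⟩

/-- Assign the value `e` to the leaf held in register `30`. -/
def setLeaf (node : Program) (a : ℕ) (e : IntExpr) : Program :=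
  .seq (.set 30 (.add (reg 1) (reg 30))) <| .seq (.setInt a (reg 30) e) <| climb node

/-- The value of `e` is taken after register `30` has been shifted from the leaf index to the node
number, hence the modified state in `he`. -/
theorem setLeaf_spec {op : ℕ → ℕ → ℕ} {a c L : ℕ} {node : Program} {e : IntExpr}
    {ρ : ℕ → ℕ → ℝ} (ha : a ≠ 30)
    (hnode : ∀ σ : State, σ.real = ρ → Wp node σ fun τ t => t ≤ c ∧ τ.real = σ.real ∧
      (∀ x, x ≠ a → τ.int x = σ.int x) ∧
      τ.int a = Function.update (σ.int a) (σ.int 30 0)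
        (op (σ.int a (2 * σ.int 30 0)) (σ.int a (2 * σ.int 30 0 + 1))))
    {σ : State} (hρ : σ.real = ρ) (hN : σ.int 1 0 = 2 ^ L) (hf : IsTree op (2 ^ L) (σ.int a))
    (hp : σ.int 30 0 < 2 ^ L) (v : ℕ)
    (he : e.eval (σ.setInt 30 0 (2 ^ L + σ.int 30 0)) = v) :
    Wp (setLeaf node a e) σ fun τ t => t ≤ (c + 10) * (L + 1) + e.cost + 20 ∧ τ.real = σ.real ∧
      (∀ x, x ≠ 30 → x ≠ a → τ.int x = σ.int x) ∧ IsTree op (2 ^ L) (τ.int a) ∧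
      ∀ q, 2 ^ L ≤ q → τ.int a q = Function.update (σ.int a) (2 ^ L + σ.int 30 0) v q := by
  apply Wp.seq; apply Wp.setInt
  apply Wp.seq; apply Wp.setInt
  simp only [IntExpr.eval, hN, he]
  refine (climb_spec ha hnode hf hp (v := v) ?_ ?_ ?_).mono ?_
  · simpa using hρ
  · simp [ha.symm]
  · simp [ha]
  · rintro τ t ⟨h1, h2, h3, h4, h5⟩
    refine ⟨?_, by simpa using h2, ?_, h4, h5⟩
    · simp only [IntExpr.cost]; omega
    · intro x hx hxa
      rw [h3 x hx hxa]
      simp [hx, hxa]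

/-- Register `31` receives the sum of the leaves before the leaf held in register `30`. -/
def rank (a : ℕ) : Program :=
  .seq (.set 30 (.add (reg 1) (reg 30))) <| .seq (.set 31 (.const 0)) <|
  .loop (.intLt (.const 1) (reg 30)) <|
    .seq (.set 32 (.half (reg 30))) <|
    .seq (.branch (.intLt (.add (reg 32) (reg 32)) (reg 30))
      (.set 31 (.add (reg 31) (.read a (.sub (reg 30) (.const 1))))) .skip) <|
    .set 30 (reg 32)

/-- On the way up from the leaf, each step from a right child collects the sum of its left sibling.
What has been collected, plus the sum of all leaves left of the current subtree, stays equal to the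
prefix sum wanted; at the root nothing remains to the left. -/
theorem rank_spec {a L : ℕ} (ha : a < 30) {σ : State} (hN : σ.int 1 0 = 2 ^ L)
    (hf : IsTree (· + ·) (2 ^ L) (σ.int a)) (hp : σ.int 30 0 < 2 ^ L) :
    Wp (rank a) σ fun τ t => t ≤ 40 * (L + 1) ∧ τ.real = σ.real ∧
      (∀ x, x ≠ 30 → x ≠ 31 → x ≠ 32 → τ.int x = σ.int x) ∧
      τ.int 31 0 = prefixSum (2 ^ L) (σ.int a) (σ.int 30 0) := by
  have ha0 : a ≠ 30 := by omega
  have ha1 : a ≠ 31 := by omega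
  have ha2 : a ≠ 32 := by omega
  apply Wp.seq; apply Wp.setInt
  apply Wp.seq; apply Wp.setInt
  set p := σ.int 30 0 with hpdef
  refine Wp.loop (fun τ => τ.real = σ.real ∧
    (∀ x, x ≠ 30 → x ≠ 31 → x ≠ 32 → τ.int x = σ.int x) ∧
    ∃ s ≤ L, 2 ^ (L - s) ≤ τ.int 30 0 ∧ τ.int 30 0 < 2 ^ (L - s + 1) ∧
      τ.int 31 0 + prefixSum (2 ^ L) (σ.int a) (τ.int 30 0 * 2 ^ s - 2 ^ L) =
        prefixSum (2 ^ L) (σ.int a) p)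
    (fun τ => 36 * Nat.log 2 (τ.int 30 0)) ?_ ?_ ?_
  · rintro τ ⟨h1, h2, s, hs, h3, h4, h5⟩ hb
    simp only [Test.Holds, IntExpr.eval] at hb
    set i := τ.int 30 0 with hi
    have hlog : Nat.log 2 i = Nat.log 2 (i / 2) + 1 := by
      rw [Nat.log_div_base]
      have := Nat.log_pos (b := 2) (n := i) (by norm_num) (by omega)
      omega
    have hsL : s < L := by
      rcases hs.lt_or_eq with h | h
      · exact h
      · subst h; simp at h4; omega
    have e1 : L - s = L - (s + 1) + 1 := by omega
    rw [e1, pow_succ] at h3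
    rw [e1, pow_succ] at h4
    have e2 : 2 ^ L = 2 ^ (L - (s + 1)) * 2 ^ (s + 1) := by rw [← pow_add]; congr 1; omega
    have e3 : 2 ^ L ≤ i / 2 * 2 ^ (s + 1) := by
      rw [e2]; exact Nat.mul_le_mul_right _ (by omega)
    apply Wp.seq; apply Wp.setInt
    apply Wp.seq
    apply Wp.branch
    · intro hp1
      apply Wp.setInt
      apply Wp.setInt
      simp [IntExpr.eval, Test.Holds, ← hi, ha2] at hp1 ⊢
      refine ⟨⟨h1, fun x hx0 hx1 hx2 => by simp [hx0, hx1, hx2, h2 x hx0 hx1 hx2],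
        s + 1, hsL, by omega, by omega, ?_⟩, ?_⟩
      -- Here `i` is odd, so `i - 1` is its left sibling; its `2 ^ s` leaves are those between the
      -- first leaf below the parent and the first leaf below `i`.
      · rw [h2 a ha0 ha1 ha2, ← h5, hf.eq_sum s hs (i - 1) (by rw [e1, pow_succ]; omega)
          (by rw [e1, pow_succ, pow_succ]; omega), add_assoc]
        congr 1
        have e4 : i = i / 2 + i / 2 + 1 := by omega
        have e5 : i - 1 = i / 2 + i / 2 := by omega
        have e6 : i * 2 ^ s - 2 ^ L = (i / 2 * 2 ^ (s + 1) - 2 ^ L) + 2 ^ s := by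
          have : i * 2 ^ s = i / 2 * 2 ^ (s + 1) + 2 ^ s := by
            conv_lhs => rw [e4]
            ring
          rw [this, Nat.sub_add_comm e3]
        have e7 : (i - 1) * 2 ^ s = 2 ^ L + (i / 2 * 2 ^ (s + 1) - 2 ^ L) := by
          have : (i - 1) * 2 ^ s = i / 2 * 2 ^ (s + 1) := by rw [e5]; ring
          omega
        rw [e6, prefixSum_add, e7, add_comm]
      · rw [hlog]; simp only [IntExpr.cost, Test.cost]; omega
    · intro hev
      apply Wp.skip
      apply Wp.setInt
      simp [IntExpr.eval, Test.Holds, ← hi] at hev ⊢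
      refine ⟨⟨h1, fun x hx0 hx1 hx2 => by simp [hx0, hx2, h2 x hx0 hx1 hx2],
        s + 1, hsL, by omega, by omega, ?_⟩, ?_⟩
      · rw [← h5]
        have : i * 2 ^ s = i / 2 * 2 ^ (s + 1) := by
          have : i = i / 2 + i / 2 := by omega
          conv_lhs => rw [this]
          ring
        rw [this]
      · rw [hlog]; simp only [IntExpr.cost, Test.cost]; omega
  · refine ⟨by simp, fun x hx0 hx1 hx2 => by simp [hx0, hx1], 0, by omega, ?_, ?_, ?_⟩
    · simp [IntExpr.eval, hN]
    · simp [IntExpr.eval, hN, ← hpdef, pow_succ]; omega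
    · simp [IntExpr.eval, hN, ← hpdef]
  · rintro τ t ⟨h1, h2, s, hs, h3, h4, h5⟩ hb hpot
    simp only [Test.Holds, IntExpr.eval, not_lt] at hb
    have h30 : τ.int 30 0 = 1 := by
      have := Nat.two_pow_pos (L - s); omega
    have hsL : s = L := by
      by_contra h
      have : 2 ^ 1 ≤ 2 ^ (L - s) := Nat.pow_le_pow_right (by norm_num) (by omega)
      omega
    subst hsL
    refine ⟨?_, h1, h2, ?_⟩
    · have : Nat.log 2 (2 ^ s + p) ≤ s := by
        refine Nat.lt_succ_iff.mp (Nat.log_lt_of_lt_pow ?_ ?_)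
        · have := Nat.two_pow_pos s; omega
        · rw [pow_succ]; omega
      simp [Test.cost, IntExpr.cost, IntExpr.eval, hN, ← hpdef] at hpot ⊢
      omega
    · simpa [h30, prefixSum] using h5

/-- Register `30` receives the leaf `p` such that the sum of the leaves before `p` is at most the
value of register `31`, and the sum of the leaves up to `p` is larger. -/
def select (a : ℕ) : Program :=
  .seq (.set 30 (.const 1)) <|
  .seq (.loop (.intLt (reg 30) (reg 1)) <|
    .seq (.set 30 (.add (reg 30) (reg 30))) <|
    .branch (.intLt (reg 31) (.read a (reg 30))) .skip <|
      .seq (.set 31 (.sub (reg 31) (.read a (reg 30)))) <|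
      .set 30 (.add (reg 30) (.const 1))) <|
  .set 30 (.sub (reg 30) (reg 1))

/-- The descent reverses `rank_spec`: register `31` holds the wanted rank relative to the first leaf
of the current subtree and stays below the sum stored at the current node. A step to the right
subtracts the sum of the left child. -/
theorem select_spec {a L : ℕ} (ha : a < 30) {σ : State} (hN : σ.int 1 0 = 2 ^ L)
    (hf : IsTree (· + ·) (2 ^ L) (σ.int a))
    (hr : σ.int 31 0 < prefixSum (2 ^ L) (σ.int a) (2 ^ L)) :
    Wp (select a) σ fun τ t => t ≤ 40 * (L + 1) ∧ τ.real = σ.real ∧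
      (∀ x, x ≠ 30 → x ≠ 31 → τ.int x = σ.int x) ∧ τ.int 30 0 < 2 ^ L ∧
      prefixSum (2 ^ L) (σ.int a) (τ.int 30 0) ≤ σ.int 31 0 ∧
      σ.int 31 0 < prefixSum (2 ^ L) (σ.int a) (τ.int 30 0 + 1) := by
  have ha0 : a ≠ 30 := by omega
  have ha1 : a ≠ 31 := by omega
  apply Wp.seq; apply Wp.setInt
  apply Wp.seq
  have hsum1 : σ.int a 1 = prefixSum (2 ^ L) (σ.int a) (2 ^ L) := by
    have := hf.eq_sum L le_rfl 1 (by simp) (by simp)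
    rwa [one_mul] at this
  refine Wp.loop (fun τ => τ.real = σ.real ∧
    (∀ x, x ≠ 30 → x ≠ 31 → τ.int x = σ.int x) ∧
    ∃ s ≤ L, 2 ^ (L - s) ≤ τ.int 30 0 ∧ τ.int 30 0 < 2 ^ (L - s + 1) ∧
      τ.int 31 0 + prefixSum (2 ^ L) (σ.int a) (τ.int 30 0 * 2 ^ s - 2 ^ L) = σ.int 31 0 ∧
      τ.int 31 0 < σ.int a (τ.int 30 0))
    (fun τ => 35 * (L - Nat.log 2 (τ.int 30 0))) ?_ ?_ ?_
  · rintro τ ⟨h1, h2, s, hs, h3, h4, h5, h6⟩ hb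
    simp only [Test.Holds, IntExpr.eval, h2 1 (by norm_num) (by norm_num), hN] at hb
    set i := τ.int 30 0 with hi
    have hi1 : 1 ≤ i := by have := Nat.two_pow_pos (L - s); omega
    have hlogi : Nat.log 2 i < L := Nat.log_lt_of_lt_pow (by omega) hb
    have hlog : Nat.log 2 (i + i) = Nat.log 2 i + 1 := by
      rw [← two_mul, mul_comm, Nat.log_mul_base (by norm_num) (by omega)]
    have hlog' : Nat.log 2 (i + i + 1) = Nat.log 2 i + 1 := by
      rw [Nat.log_of_one_lt_of_le (by norm_num) (by omega)]
      congr 2; omega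
    obtain ⟨s, rfl⟩ : ∃ s', s = s' + 1 := by
      rcases s with _ | s
      · simp at h3; omega
      · exact ⟨s, rfl⟩
    have e1 : L - s = L - (s + 1) + 1 := by omega
    have e2 : 2 ^ L = 2 ^ (L - (s + 1)) * 2 ^ (s + 1) := by rw [← pow_add]; congr 1; omega
    have e3 : 2 ^ L ≤ i * 2 ^ (s + 1) := by
      rw [e2]; exact Nat.mul_le_mul_right _ (by omega)
    have hnode : σ.int a i = σ.int a (i + i) + σ.int a (i + i + 1) := by
      rw [hf i hi1 hb, two_mul]
    have e7 : (i + i) * 2 ^ s = i * 2 ^ (s + 1) := by ring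
    apply Wp.seq; apply Wp.setInt
    apply Wp.branch
    · intro hlt
      apply Wp.skip
      simp [IntExpr.eval, Test.Holds, ← hi, ha0, h2 a ha0 ha1] at hlt ⊢
      refine ⟨⟨h1, fun x hx0 hx1 => by simp [hx0, h2 x hx0 hx1],
        s, by omega, by rw [e1, pow_succ]; omega, by rw [e1, pow_succ]; omega, ?_, hlt⟩, ?_⟩
      · rw [e7, h5]
      · rw [hlog]; simp only [IntExpr.cost, Test.cost]; omega
    · intro hlt
      apply Wp.seq
      apply Wp.setInt
      apply Wp.setInt
      simp [IntExpr.eval, Test.Holds, ← hi, ha0, h2 a ha0 ha1] at hlt ⊢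
      refine ⟨⟨h1, fun x hx0 hx1 => by simp [hx0, hx1, h2 x hx0 hx1],
        s, by omega, by rw [e1, pow_succ]; omega, by rw [e1, pow_succ]; omega, ?_, by omega⟩, ?_⟩
      · have e8 : (i + i + 1) * 2 ^ s - 2 ^ L = (i * 2 ^ (s + 1) - 2 ^ L) + 2 ^ s := by
          have : (i + i + 1) * 2 ^ s = i * 2 ^ (s + 1) + 2 ^ s := by ring
          rw [this, Nat.sub_add_comm e3]
        have e9 : 2 ^ L + (i * 2 ^ (s + 1) - 2 ^ L) = (i + i) * 2 ^ s := by
          rw [e7]; omega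
        rw [e8, prefixSum_add, e9, ← hf.eq_sum s (by omega) (i + i) (by rw [e1, pow_succ]; omega)
          (by rw [e1, pow_succ]; omega)]
        omega
      · rw [hlog']; simp only [IntExpr.cost, Test.cost]; omega
  · refine ⟨by simp, fun x hx0 hx1 => by simp [hx0], L, le_rfl, ?_, ?_, ?_, ?_⟩
    · simp [IntExpr.eval]
    · simp [IntExpr.eval]
    · simp [IntExpr.eval, prefixSum]
    · simpa [IntExpr.eval, hsum1] using hr
  · rintro τ t ⟨h1, h2, s, hs, h3, h4, h5, h6⟩ hb hpot
    simp only [Test.Holds, IntExpr.eval, not_lt, h2 1 (by norm_num) (by norm_num), hN] at hb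
    have hs0 : s = 0 := by
      by_contra h
      have : 2 ^ (L - s + 1) ≤ 2 ^ L := Nat.pow_le_pow_right (by norm_num) (by omega)
      omega
    subst hs0
    simp only [Nat.sub_zero, pow_zero, mul_one, pow_succ] at h4 h5
    apply Wp.setInt
    simp [IntExpr.eval, h2 1, hN]
    refine ⟨?_, h1, fun x hx0 hx1 => by simp [hx0, h2 x hx0 hx1], by omega, by omega, ?_⟩
    · simp [Test.cost, IntExpr.cost, IntExpr.eval] at hpot ⊢
      omega
    · rw [prefixSum_succ, Nat.add_sub_cancel' hb]
      omega

end RealRAM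

namespace RealRAM

/-! ### Sets stored in trees of sums -/

/-- `f` holds the tree of sums of the indicator function of `B`. -/
structure StoresSet (L : ℕ) (f : ℕ → ℕ) (B : Finset ℕ) : Prop where
  isTree : IsTree (· + ·) (2 ^ L) f
  leaf : ∀ q < 2 ^ L, f (2 ^ L + q) = if q ∈ B then 1 else 0

theorem StoresSet.prefixSum_eq {L : ℕ} {f : ℕ → ℕ} {B : Finset ℕ} (h : StoresSet L f B) {p : ℕ}
    (hp : p ≤ 2 ^ L) : prefixSum (2 ^ L) f p = (B.filter (· < p)).card := by
  rw [prefixSum, Finset.sum_congr rfl fun q hq => h.leaf q (by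
    have := Finset.mem_range.mp hq; omega), Finset.sum_boole]
  simp only [Nat.cast_id]
  congr 1
  ext q
  simp [and_comm]

theorem storesSet_zero (L : ℕ) {f : ℕ → ℕ} (hf : ∀ q, f q = 0) : StoresSet L f ∅ :=
  ⟨fun j _ _ => by simp [hf], fun q _ => by simp [hf]⟩

/-- Insert the element held in register `30`. -/
def insertElem (a : ℕ) : Program := setLeaf (sumNode a) a (.const 1)

/-- Erase the element held in register `30`. -/
def eraseElem (a : ℕ) : Program := setLeaf (sumNode a) a (.const 0)

theorem insertElem_spec {a L : ℕ} (ha : a ≠ 30) {σ : State} {B : Finset ℕ} {p : ℕ}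
    (hN : σ.int 1 0 = 2 ^ L) (hB : StoresSet L (σ.int a) B) (hp : σ.int 30 0 = p)
    (hpL : p < 2 ^ L) :
    Wp (insertElem a) σ fun τ t => t ≤ 60 * (L + 1) ∧ τ.real = σ.real ∧
      (∀ x, x ≠ 30 → x ≠ a → τ.int x = σ.int x) ∧ StoresSet L (τ.int a) (insert p B) := by
  subst hp
  refine (setLeaf_spec (ρ := σ.real) ha (fun σ _ => sumNode_spec) rfl hN hB.isTree hpL 1 rfl).mono ?_
  rintro τ t ⟨h1, h2, h3, h4, h5⟩
  refine ⟨by simp only [IntExpr.cost] at h1; omega, h2, h3, h4, fun q hq => ?_⟩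
  rw [h5 _ (by omega), Function.update_apply]
  by_cases h : q = σ.int 30 0
  · simp [h]
  · simp [h, hB.leaf q hq]

theorem eraseElem_spec {a L : ℕ} (ha : a ≠ 30) {σ : State} {B : Finset ℕ} {p : ℕ}
    (hN : σ.int 1 0 = 2 ^ L) (hB : StoresSet L (σ.int a) B) (hp : σ.int 30 0 = p)
    (hpL : p < 2 ^ L) :
    Wp (eraseElem a) σ fun τ t => t ≤ 60 * (L + 1) ∧ τ.real = σ.real ∧
      (∀ x, x ≠ 30 → x ≠ a → τ.int x = σ.int x) ∧ StoresSet L (τ.int a) (B.erase p) := by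
  subst hp
  refine (setLeaf_spec (ρ := σ.real) ha (fun σ _ => sumNode_spec) rfl hN hB.isTree hpL 0 rfl).mono ?_
  rintro τ t ⟨h1, h2, h3, h4, h5⟩
  refine ⟨by simp only [IntExpr.cost] at h1; omega, h2, h3, h4, fun q hq => ?_⟩
  rw [h5 _ (by omega), Function.update_apply]
  by_cases h : q = σ.int 30 0
  · simp [h]
  · simp [h, hB.leaf q hq]

theorem rank_storesSet {a L : ℕ} (ha : a < 30) {σ : State} {B : Finset ℕ} {p : ℕ}
    (hN : σ.int 1 0 = 2 ^ L) (hB : StoresSet L (σ.int a) B) (hp : σ.int 30 0 = p)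
    (hpL : p < 2 ^ L) :
    Wp (rank a) σ fun τ t => t ≤ 40 * (L + 1) ∧ τ.real = σ.real ∧
      (∀ x, x ≠ 30 → x ≠ 31 → x ≠ 32 → τ.int x = σ.int x) ∧
      τ.int 31 0 = (B.filter (· < p)).card := by
  subst hp
  refine (rank_spec ha hN hB.isTree hpL).mono ?_
  rintro τ t ⟨h1, h2, h3, h4⟩
  exact ⟨h1, h2, h3, by rw [h4, hB.prefixSum_eq hpL.le]⟩

theorem select_storesSet {a L : ℕ} (ha : a < 30) {σ : State} {B : Finset ℕ} {r : ℕ}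
    (hN : σ.int 1 0 = 2 ^ L) (hB : StoresSet L (σ.int a) B) (hBL : ∀ b ∈ B, b < 2 ^ L)
    (hr : σ.int 31 0 = r) (hrB : r < B.card) :
    Wp (select a) σ fun τ t => t ≤ 40 * (L + 1) ∧ τ.real = σ.real ∧
      (∀ x, x ≠ 30 → x ≠ 31 → τ.int x = σ.int x) ∧ τ.int 30 0 ∈ B ∧
      (B.filter (· < τ.int 30 0)).card = r := by
  subst hr
  have hall : B.filter (· < 2 ^ L) = B := Finset.filter_true_of_mem hBL
  refine (select_spec ha hN hB.isTree (by rw [hB.prefixSum_eq le_rfl, hall]; exact hrB)).mono ?_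
  rintro τ t ⟨h1, h2, h3, h4, h5, h6⟩
  rw [prefixSum_succ, hB.leaf _ h4] at h6
  rw [hB.prefixSum_eq h4.le] at h5 h6
  refine ⟨h1, h2, h3, ?_, ?_⟩
  · by_contra h; rw [if_neg h] at h6; omega
  · split_ifs at h6 <;> omega

/-- The rank is strictly increasing on `B`. An element returned by `select` is therefore identified
by its rank alone. -/
theorem card_filter_lt_injOn {B : Finset ℕ} {x y : ℕ} (hx : x ∈ B) (hy : y ∈ B)
    (h : (B.filter (· < x)).card = (B.filter (· < y)).card) : x = y := by
  have key : ∀ {x y : ℕ}, x ∈ B → x < y → (B.filter (· < x)).card < (B.filter (· < y)).card := by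
    intro x y hx hxy
    refine Finset.card_lt_card (Finset.ssubset_iff_subset_ne.mpr ⟨?_, ?_⟩)
    · intro z hz
      simp only [Finset.mem_filter] at hz ⊢
      exact ⟨hz.1, by omega⟩
    · intro he
      have : x ∈ B.filter (· < y) := by simp [hx, hxy]
      rw [← he] at this
      simp at this
  rcases lt_trichotomy x y with hxy | hxy | hxy
  · have := key hx hxy; omega
  · exact hxy
  · have := key hy hxy; omega

/-- Register `30` receives the largest element below the number held in register `30`. -/
def predecessor (a : ℕ) : Program :=
  .seq (rank a) <| .seq (.set 31 (.sub (reg 31) (.const 1))) <| select a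

/-- The rank of `p` exceeds that of its predecessor `b` by one. As `b` exists, the truncated
subtraction of `1` loses nothing. -/
theorem predecessor_spec {a L : ℕ} (ha : a < 30) {σ : State} {B : Finset ℕ} {p b : ℕ}
    (hN : σ.int 1 0 = 2 ^ L) (hB : StoresSet L (σ.int a) B) (hBL : ∀ b ∈ B, b < 2 ^ L)
    (hp : σ.int 30 0 = p) (hpL : p < 2 ^ L) (hb : b ∈ B) (hbp : b < p)
    (hmax : ∀ x ∈ B, x < p → x ≤ b) :
    Wp (predecessor a) σ fun τ t => t ≤ 100 * (L + 1) ∧ τ.real = σ.real ∧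
      (∀ x, x ≠ 30 → x ≠ 31 → x ≠ 32 → τ.int x = σ.int x) ∧ τ.int 30 0 = b := by
  have ha0 : a ≠ 30 := by omega
  have ha1 : a ≠ 31 := by omega
  have ha2 : a ≠ 32 := by omega
  have hins : B.filter (· < p) = insert b (B.filter (· < b)) := by
    ext x
    simp only [Finset.mem_filter, Finset.mem_insert]
    constructor
    · rintro ⟨h1, h2⟩
      have := hmax x h1 h2
      rcases this.lt_or_eq with h | h
      · exact .inr ⟨h1, h⟩
      · exact .inl h
    · rintro (rfl | ⟨h1, h2⟩)
      · exact ⟨hb, hbp⟩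
      · exact ⟨h1, by omega⟩
  have hcard : (B.filter (· < p)).card = (B.filter (· < b)).card + 1 := by
    rw [hins, Finset.card_insert_of_notMem (by simp)]
  apply Wp.seq
  refine (rank_storesSet ha hN hB hp hpL).mono ?_
  rintro τ t ⟨h1, h2, h3, h4⟩
  apply Wp.seq; apply Wp.setInt
  refine (select_storesSet (B := B) (r := (B.filter (· < b)).card) ha ?_ ?_ hBL ?_ ?_).mono ?_
  · simp [h3 1, hN]
  · simpa [ha1, h3 a ha0 ha1 ha2] using hB
  · simp [IntExpr.eval, h4, hcard]
  · have := Finset.card_filter_le B (· < p)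
    omega
  · rintro υ s ⟨g1, g2, g3, g4, g5⟩
    refine ⟨by simp only [IntExpr.cost]; omega, by rw [g2]; simpa using h2, ?_,
      card_filter_lt_injOn g4 hb g5⟩
    intro x hx0 hx1 hx2
    rw [g3 x hx0 hx1]
    simp [hx1, h3 x hx0 hx1 hx2]

/-- Register `30` receives the smallest element above the number held in register `30`. -/
def successor (a : ℕ) : Program :=
  .seq (.set 30 (.add (reg 30) (.const 1))) <| .seq (rank a) <| select a

/-- The number of elements up to `p` is the rank of the next element. The query position `p + 1` is
still in range because `p + 1 ≤ b`. -/
theorem successor_spec {a L : ℕ} (ha : a < 30) {σ : State} {B : Finset ℕ} {p b : ℕ}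
    (hN : σ.int 1 0 = 2 ^ L) (hB : StoresSet L (σ.int a) B) (hBL : ∀ b ∈ B, b < 2 ^ L)
    (hp : σ.int 30 0 = p) (hb : b ∈ B) (hbp : p < b)
    (hmin : ∀ x ∈ B, p < x → b ≤ x) :
    Wp (successor a) σ fun τ t => t ≤ 100 * (L + 1) ∧ τ.real = σ.real ∧
      (∀ x, x ≠ 30 → x ≠ 31 → x ≠ 32 → τ.int x = σ.int x) ∧ τ.int 30 0 = b := by
  have ha0 : a ≠ 30 := by omega
  have ha1 : a ≠ 31 := by omega
  have ha2 : a ≠ 32 := by omega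
  have hbL := hBL b hb
  have hins : B.filter (· < p + 1) = B.filter (· < b) := by
    ext x
    simp only [Finset.mem_filter]
    refine and_congr_right fun h1 => ⟨fun h => by omega, fun h => ?_⟩
    by_contra h2
    have := hmin x h1 (by omega)
    omega
  apply Wp.seq; apply Wp.setInt
  apply Wp.seq
  refine (rank_storesSet (L := L) (B := B) (p := p + 1) ha ?_ ?_ ?_ (by omega)).mono ?_
  · simp [hN]
  · simpa [ha0] using hB
  · simp [IntExpr.eval, hp]
  rintro τ t ⟨h1, h2, h3, h4⟩
  refine (select_storesSet (B := B) (r := (B.filter (· < b)).card) ha ?_ ?_ hBL ?_ ?_).mono ?_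
  · simp [h3 1, hN]
  · simpa [ha0, h3 a ha0 ha1 ha2] using hB
  · rw [h4, hins]
  · refine Finset.card_lt_card (Finset.filter_ssubset.mpr ⟨b, hb, by simp⟩)
  · rintro υ s ⟨g1, g2, g3, g4, g5⟩
    refine ⟨by simp only [IntExpr.cost]; omega, by rw [g2]; simpa using h2, ?_,
      card_filter_lt_injOn g4 hb g5⟩
    intro x hx0 hx1 hx2
    rw [g3 x hx0 hx1, h3 x hx0 hx1 hx2]
    simp [hx0]

/-! ### Sorting -/

/-- The winner of two players; player `q` is represented by `q + 1`, and `0` stands for no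
player. -/
noncomputable def winner (K : ℕ → ℝ) (a b : ℕ) : ℕ :=
  if 0 < a then if 0 < b ∧ K (b - 1) < K (a - 1) then b else a else b

/-- Induction on the height of the node: the winner of a subtree is a player with least key among
the players on its leaves, or `0` if there are none. -/
theorem IsTree.winner_spec {L : ℕ} {K : ℕ → ℝ} {f : ℕ → ℕ} {S : Finset ℕ}
    (hf : IsTree (winner K) (2 ^ L) f)
    (hleaf : ∀ q < 2 ^ L, f (2 ^ L + q) = if q ∈ S then q + 1 else 0) :
    ∀ s ≤ L, ∀ j, 2 ^ (L - s) ≤ j → j < 2 ^ (L - s + 1) →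
      (f j = 0 ∧ ∀ q ∈ S, ¬ (j * 2 ^ s ≤ 2 ^ L + q ∧ 2 ^ L + q < (j + 1) * 2 ^ s)) ∨
      ∃ q ∈ S, f j = q + 1 ∧
        ∀ q' ∈ S, j * 2 ^ s ≤ 2 ^ L + q' → 2 ^ L + q' < (j + 1) * 2 ^ s → K q ≤ K q' := by
  intro s
  induction s with
  | zero =>
    intro _ j h1 h2
    obtain ⟨q, rfl⟩ := Nat.exists_eq_add_of_le h1
    simp only [Nat.sub_zero, pow_zero, mul_one, pow_succ] at *
    rw [hleaf q (by omega)]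
    by_cases hq : q ∈ S
    · refine .inr ⟨q, hq, by simp [hq], fun q' _ h3 h4 => ?_⟩
      rw [show q' = q by omega]
    · refine .inl ⟨by simp [hq], fun q' hq' h => hq ?_⟩
      rwa [show q = q' by omega]
  | succ s ih =>
    intro hs j h1 h2
    have e : L - s = L - (s + 1) + 1 := by omega
    have h3 : 2 ^ (L - (s + 1) + 1) ≤ 2 ^ L := Nat.pow_le_pow_right (by norm_num) (by omega)
    have h4 := Nat.two_pow_pos (L - (s + 1))
    have i1 := ih (by omega) (2 * j) (by rw [e, pow_succ]; omega) (by rw [e, pow_succ]; omega)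
    have i2 := ih (by omega) (2 * j + 1) (by rw [e, pow_succ]; omega)
      (by rw [e, pow_succ]; omega)
    rw [show 2 * j * 2 ^ s = j * 2 ^ (s + 1) by ring] at i1
    rw [show (2 * j + 1 + 1) * 2 ^ s = (j + 1) * 2 ^ (s + 1) by ring] at i2
    -- The first leaf of the right child, where the leaf range of `j` is cut in two.
    set m := (2 * j + 1) * 2 ^ s with hm
    have hm1 : j * 2 ^ (s + 1) ≤ m := by
      rw [hm, show j * 2 ^ (s + 1) = (2 * j) * 2 ^ s by ring]
      exact Nat.mul_le_mul_right _ (by omega)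
    have hm2 : m ≤ (j + 1) * 2 ^ (s + 1) := by
      rw [hm, show (j + 1) * 2 ^ (s + 1) = (2 * j + 2) * 2 ^ s by ring]
      exact Nat.mul_le_mul_right _ (by omega)
    rw [hf j (by omega) (by omega)]
    rcases i1 with ⟨z1, n1⟩ | ⟨q1, m1, z1, n1⟩ <;> rcases i2 with ⟨z2, n2⟩ | ⟨q2, m2, z2, n2⟩ <;>
      rw [z1, z2]
    · left
      refine ⟨by simp [winner], fun q hq h => ?_⟩
      have a1 := n1 q hq
      have a2 := n2 q hq
      omega
    · right
      refine ⟨q2, m2, by simp [winner], fun q hq g1 g2 => n2 q hq ?_ g2⟩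
      have a1 := n1 q hq
      omega
    · right
      refine ⟨q1, m1, by simp [winner], fun q hq g1 g2 => n1 q hq g1 ?_⟩
      have a1 := n2 q hq
      omega
    · right
      by_cases hlt : K q2 < K q1
      · refine ⟨q2, m2, by simp [winner, hlt], fun q hq g1 g2 => ?_⟩
        rcases lt_or_ge (2 ^ L + q) m with h | h
        · exact hlt.le.trans (n1 q hq g1 h)
        · exact n2 q hq h g2
      · refine ⟨q1, m1, by simp [winner, hlt], fun q hq g1 g2 => ?_⟩
        rcases lt_or_ge (2 ^ L + q) m with h | h
        · exact n1 q hq g1 h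
        · exact (not_lt.mp hlt).trans (n2 q hq h g2)

theorem IsTree.winner_root {L : ℕ} {K : ℕ → ℝ} {f : ℕ → ℕ} {S : Finset ℕ}
    (hf : IsTree (winner K) (2 ^ L) f)
    (hleaf : ∀ q < 2 ^ L, f (2 ^ L + q) = if q ∈ S then q + 1 else 0)
    (hSL : ∀ q ∈ S, q < 2 ^ L) (hS : S.Nonempty) :
    f 1 - 1 ∈ S ∧ ∀ q ∈ S, K (f 1 - 1) ≤ K q := by
  have h := hf.winner_spec hleaf L le_rfl 1 (by simp) (by simp)
  rcases h with ⟨-, h⟩ | ⟨q, hq, h1, h2⟩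
  · obtain ⟨q, hq⟩ := hS
    have := hSL q hq
    exact absurd ⟨by omega, by omega⟩ (h q hq)
  · rw [h1, Nat.add_sub_cancel]
    refine ⟨hq, fun q' hq' => h2 q' hq' (by omega) ?_⟩
    have := hSL q' hq'
    omega

/-- The program that recomputes a node of the tournament. -/
def winnerNode (ka a : ℕ) : Program :=
  let l : IntExpr := .read a (.add (reg 30) (reg 30))
  let r : IntExpr := .read a (.add (.add (reg 30) (reg 30)) (.const 1))
  .branch (.intLt (.const 0) l)
    (.branch (.and (.intLt (.const 0) r)
        (.realLt (.read ka (.sub r (.const 1))) (.read ka (.sub l (.const 1)))))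
      (.setInt a (reg 30) r) (.setInt a (reg 30) l))
    (.setInt a (reg 30) r)

theorem winnerNode_spec {ka a : ℕ} {ρ : ℕ → ℕ → ℝ} (σ : State) (hρ : σ.real = ρ) :
    Wp (winnerNode ka a) σ fun τ t => t ≤ 70 ∧ τ.real = σ.real ∧
      (∀ x, x ≠ a → τ.int x = σ.int x) ∧
      τ.int a = Function.update (σ.int a) (σ.int 30 0)
        (winner (ρ ka) (σ.int a (2 * σ.int 30 0)) (σ.int a (2 * σ.int 30 0 + 1))) := by
  subst hρ
  apply Wp.branch
  · intro h1
    apply Wp.branch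
    · intro h2
      apply Wp.setInt
      simp only [Test.Holds, IntExpr.eval, RealExpr.eval, ← two_mul] at h1 h2
      simp only [IntExpr.eval, ← two_mul, winner, if_pos h1, if_pos h2]
      refine ⟨by simp [IntExpr.cost, Test.cost, RealExpr.cost], rfl, fun x hx => ?_, ?_⟩
      · simp [hx]
      · simp
    · intro h2
      apply Wp.setInt
      simp only [Test.Holds, IntExpr.eval, RealExpr.eval, ← two_mul] at h1 h2
      simp only [IntExpr.eval, ← two_mul, winner, if_pos h1, if_neg h2]
      refine ⟨by simp [IntExpr.cost, Test.cost, RealExpr.cost], rfl, fun x hx => ?_, ?_⟩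
      · simp [hx]
      · simp
  · intro h1
    apply Wp.setInt
    simp only [Test.Holds, IntExpr.eval, ← two_mul] at h1
    simp only [IntExpr.eval, ← two_mul, winner, if_neg h1]
    refine ⟨by simp [IntExpr.cost, Test.cost], rfl, fun x hx => ?_, ?_⟩
    · simp [hx]
    · simp

/-- Sort the indices below the number held in register `2` by the keys in the real array `ka`; the
result is stored in the integer array `oa`, and `wa` holds the tournament. -/
def sort (ka wa oa : ℕ) : Program :=
  .seq (.set 33 (.const 0)) <|
  .seq (.loop (.intLt (reg 33) (reg 2)) <|
    .seq (.set 30 (reg 33)) <|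
    .seq (setLeaf (winnerNode ka wa) wa (.add (reg 33) (.const 1))) <|
    .set 33 (.add (reg 33) (.const 1))) <|
  .seq (.set 33 (.const 0)) <|
  .loop (.intLt (reg 33) (reg 2)) <|
    .seq (.setInt oa (reg 33) (.sub (.read wa (.const 1)) (.const 1))) <|
    .seq (.set 30 (.read oa (reg 33))) <|
    .seq (setLeaf (winnerNode ka wa) wa (.const 0)) <|
    .set 33 (.add (reg 33) (.const 1))

/-- `f 0, …, f (m - 1)` are the numbers below `m`, ordered by `K`. -/
structure IsSorting (K : ℕ → ℝ) (m : ℕ) (f : ℕ → ℕ) : Prop where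
  lt : ∀ i < m, f i < m
  inj : ∀ i < m, ∀ j < m, f i = f j → i = j
  mono : ∀ i j, i ≤ j → j < m → K (f i) ≤ K (f j)

theorem IsSorting.surj {K : ℕ → ℝ} {m : ℕ} {f : ℕ → ℕ} (h : IsSorting K m f) {q : ℕ}
    (hq : q < m) : ∃ i < m, f i = q := by
  have := Finset.surj_on_of_inj_on_of_card_le (s := Finset.range m) (t := Finset.range m)
    (fun i _ => f i) (fun i hi => by simpa using h.lt i (by simpa using hi))
    (fun i j hi hj hij => h.inj i (by simpa using hi) j (by simpa using hj) hij) le_rfl q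
    (by simpa using hq)
  obtain ⟨i, hi, he⟩ := this
  exact ⟨i, by simpa using hi, he.symm⟩

theorem sort_spec {ka wa oa L m : ℕ} (hw : 40 ≤ wa) (ho : 3 ≤ oa) (ho' : oa < 30) {σ : State}
    (hN : σ.int 1 0 = 2 ^ L) (hM : σ.int 2 0 = m) (hmN : m ≤ 2 ^ L) (hzero : ∀ q, σ.int wa q = 0) :
    Wp (sort ka wa oa) σ fun τ t => t ≤ 290 * ((L + 1) * (m + 1)) ∧ τ.real = σ.real ∧
      (∀ x, x ≠ 30 → x ≠ 33 → x ≠ wa → x ≠ oa → τ.int x = σ.int x) ∧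
      IsSorting (σ.real ka) m (τ.int oa) := by
  have hw0 : wa ≠ 30 := by omega
  have hw3 : wa ≠ 33 := by omega
  have hwo : wa ≠ oa := by omega
  have ho0 : oa ≠ 30 := by omega
  have ho3 : oa ≠ 33 := by omega
  have hw1 : 1 ≠ wa := by omega
  have hw2 : 2 ≠ wa := by omega
  have ho1 : 1 ≠ oa := by omega
  have ho2 : 2 ≠ oa := by omega
  set K := σ.real ka with hK
  apply Wp.seq; apply Wp.setInt
  apply Wp.seq
  refine Wp.loop (fun τ => τ.real = σ.real ∧
    (∀ x, x ≠ 30 → x ≠ 33 → x ≠ wa → x ≠ oa → τ.int x = σ.int x) ∧ τ.int 33 0 ≤ m ∧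
    IsTree (winner K) (2 ^ L) (τ.int wa) ∧
    ∀ q < 2 ^ L, τ.int wa (2 ^ L + q) = if q < τ.int 33 0 then q + 1 else 0)
    (fun τ => 140 * (L + 1) * (m - τ.int 33 0)) ?_ ?_ ?_
  · rintro τ ⟨h1, h2, h3, h4, h5⟩ hb
    simp only [Test.Holds, IntExpr.eval, h2 2 (by norm_num) (by norm_num) hw2 ho2, hM] at hb
    apply Wp.seq; apply Wp.setInt
    apply Wp.seq
    refine (setLeaf_spec (ρ := σ.real) (L := L) (v := τ.int 33 0 + 1) hw0
      (fun σ h => winnerNode_spec (ka := ka) σ h) ?_ ?_ ?_ ?_ ?_).mono ?_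
    · simpa using h1
    · simp [h2 1 (by norm_num) (by norm_num) hw1 ho1, hN]
    · simpa [hw0] using h4
    · simp [IntExpr.eval]; omega
    · simp [IntExpr.eval]
    rintro υ t ⟨g1, g2, g3, g4, g5⟩
    simp [IntExpr.eval, hw0] at g2 g3 g4 g5
    have e33 : υ.int 33 0 = τ.int 33 0 := by rw [g3 33 (by norm_num) hw3.symm]; simp
    apply Wp.setInt
    simp [IntExpr.eval, e33, hw3]
    refine ⟨⟨g2.trans h1, ?_, by omega, g4, ?_⟩, ?_⟩
    · intro x hx0 hx3 hxw hxo
      simp [hx3, g3 x hx0 hxw, hx0, h2 x hx0 hx3 hxw hxo]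
    · intro q hq
      rw [g5 _ (by omega), Function.update_apply]
      by_cases hqe : q = τ.int 33 0
      · subst hqe; simp
      · rw [if_neg (by omega), h5 q hq]
        congr 1
        simp only [eq_iff_iff]
        omega
    · have : m - τ.int 33 0 = (m - (τ.int 33 0 + 1)) + 1 := by omega
      rw [this, Nat.mul_succ (140 * (L + 1))]
      simp only [IntExpr.cost, Test.cost] at g1 ⊢
      omega
  · refine ⟨rfl, fun x hx0 hx3 _ _ => by simp [hx3], by simp [IntExpr.eval], ?_, ?_⟩
    · intro j _ _
      simp [hw3, hzero, winner]
    · intro q _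
      simp [IntExpr.eval, hw3, hzero]
  rintro τ t ⟨h1, h2, h3, h4, h5⟩ hb hpot
  simp only [Test.Holds, IntExpr.eval, h2 2 (by norm_num) (by norm_num) hw2 ho2, hM] at hb
  have e33 : τ.int 33 0 = m := by omega
  rw [e33] at h5
  apply Wp.seq; apply Wp.setInt
  refine Wp.loop (fun υ => υ.real = σ.real ∧
    (∀ x, x ≠ 30 → x ≠ 33 → x ≠ wa → x ≠ oa → υ.int x = σ.int x) ∧ υ.int 33 0 ≤ m ∧
    IsTree (winner K) (2 ^ L) (υ.int wa) ∧
    (∀ q < 2 ^ L, υ.int wa (2 ^ L + q) =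
      if q < m ∧ ∀ i < υ.int 33 0, υ.int oa i ≠ q then q + 1 else 0) ∧
    (∀ i < υ.int 33 0, υ.int oa i < m) ∧
    (∀ i < υ.int 33 0, ∀ j < υ.int 33 0, υ.int oa i = υ.int oa j → i = j) ∧
    (∀ i j, i ≤ j → j < υ.int 33 0 → K (υ.int oa i) ≤ K (υ.int oa j)) ∧
    -- No index already written has a larger key than an index still in the tournament. This is what
    -- makes the next winner extend the sorted list.
    ∀ i < υ.int 33 0, ∀ q < m, (∀ j < υ.int 33 0, υ.int oa j ≠ q) → K (υ.int oa i) ≤ K q)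
    (fun υ => 145 * (L + 1) * (m - υ.int 33 0)) ?_ ?_ ?_
  · rintro υ ⟨k1, k2, k3, k4, k5, k6, k7, k8, k9⟩ hb
    simp only [Test.Holds, IntExpr.eval, k2 2 (by norm_num) (by norm_num) hw2 ho2, hM] at hb
    set j := υ.int 33 0 with hj
    set S := (Finset.range m).filter fun q => ∀ i < j, υ.int oa i ≠ q with hS
    have hSL : ∀ q ∈ S, q < 2 ^ L := by
      intro q hq
      simp only [hS, Finset.mem_filter, Finset.mem_range] at hq
      omega
    have hSne : S.Nonempty := by
      -- Pigeonhole: the `j < m` indices written so far cannot exhaust the range, so the tournament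
      -- still has a player.
      have hlt : ((Finset.range j).image (υ.int oa)).card < (Finset.range m).card :=
        Finset.card_image_le.trans_lt (by simpa using hb)
      obtain ⟨q, hq, hq'⟩ := Finset.exists_mem_notMem_of_card_lt_card hlt
      refine ⟨q, ?_⟩
      simp only [hS, Finset.mem_filter, Finset.mem_range] at hq ⊢
      refine ⟨by simpa using hq, fun i hi he => hq' ?_⟩
      exact Finset.mem_image.mpr ⟨i, by simpa using hi, he⟩
    obtain ⟨r1, r2⟩ := k4.winner_root (S := S) (fun q hq => by
      rw [k5 q hq]; simp [hS]) hSL hSne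
    set w := υ.int wa 1 - 1 with hwdef
    have r3 : w < m ∧ ∀ i < j, υ.int oa i ≠ w := by simpa [hS] using r1
    apply Wp.seq; apply Wp.setInt
    apply Wp.seq; apply Wp.setInt
    apply Wp.seq
    refine (setLeaf_spec (ρ := σ.real) (L := L) (v := 0) hw0
      (fun σ h => winnerNode_spec (ka := ka) σ h) ?_ ?_ ?_ ?_ ?_).mono ?_
    · simpa using k1
    · simp [ho1, k2 1 (by norm_num) (by norm_num) hw1 ho1, hN]
    · simpa [hw0, hwo] using k4
    · simp [IntExpr.eval, ho3.symm, ← hwdef]; omega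
    · simp [IntExpr.eval]
    rintro ω s ⟨g1, g2, g3, g4, g5⟩
    simp [IntExpr.eval, hw0, hwo, ho3.symm, ← hwdef, ← hj] at g2 g3 g4 g5
    have e33 : ω.int 33 0 = j := by rw [g3 33 (by norm_num) hw3.symm]; simp [ho3.symm, hj]
    have eo : ω.int oa = Function.update (υ.int oa) j w := by
      rw [g3 oa ho0 hwo.symm]; simp [ho0]
    have eow : ∀ i < j, ω.int oa i = υ.int oa i := fun i hi => by
      rw [eo, Function.update_of_ne (by omega)]
    have eoj : ω.int oa j = w := by rw [eo, Function.update_self]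
    apply Wp.setInt
    simp only [IntExpr.eval, e33, State.setInt_int, hw3, ho3, if_true, if_false,
      Function.update_self, State.setInt_real]
    refine ⟨⟨g2.trans k1, ?_, by omega, g4, ?_, ?_, ?_, ?_, ?_⟩, ?_⟩
    · intro x hx0 hx3 hxw hxo
      simp [hx3, g3 x hx0 hxw, hx0, hxo, k2 x hx0 hx3 hxw hxo]
    · intro q hq
      rw [g5 _ (by omega), Function.update_apply]
      by_cases hqe : q = w
      · subst hqe
        rw [if_pos rfl, if_neg]
        rintro ⟨-, h⟩
        exact h j (by omega) eoj
      · rw [if_neg (by omega), k5 q hq]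
        congr 1
        simp only [eq_iff_iff]
        refine and_congr_right fun _ => ⟨fun h i hi => ?_, fun h i hi => ?_⟩
        · rcases (Nat.lt_succ_iff.mp hi).lt_or_eq with hij | hij
          · rw [eow i hij]; exact h i hij
          · rw [hij, eoj]; exact fun h => hqe h.symm
        · rw [← eow i hi]; exact h i (by omega)
    · intro i hi
      rcases (Nat.lt_succ_iff.mp hi).lt_or_eq with hij | hij
      · rw [eow i hij]; exact k6 i hij
      · rw [hij, eoj]; exact r3.1
    · intro i hi i' hi' he
      rcases (Nat.lt_succ_iff.mp hi).lt_or_eq with hij | hij <;>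
        rcases (Nat.lt_succ_iff.mp hi').lt_or_eq with hij' | hij'
      · rw [eow i hij, eow i' hij'] at he; exact k7 i hij i' hij' he
      · rw [eow i hij, hij', eoj] at he; exact absurd he (r3.2 i hij)
      · rw [eow i' hij', hij, eoj] at he; exact absurd he.symm (r3.2 i' hij')
      · omega
    · intro i i' hii hi'
      rcases (Nat.lt_succ_iff.mp hi').lt_or_eq with hij' | hij'
      · rw [eow i (by omega), eow i' hij']; exact k8 i i' hii hij'
      · rw [hij', eoj]
        rcases (hii.trans hij'.le).lt_or_eq with hij | hij
        · rw [eow i hij]; exact k9 i hij w r3.1 r3.2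
        · rw [hij, eoj]
    · intro i hi q hq h
      have hq' : ∀ i' < j, υ.int oa i' ≠ q := fun i' hi' => by
        rw [← eow i' hi']; exact h i' (by omega)
      rcases (Nat.lt_succ_iff.mp hi).lt_or_eq with hij | hij
      · rw [eow i hij]; exact k9 i hij q hq hq'
      · rw [hij, eoj]; exact r2 q (by simp [hS, hq]; exact hq')
    · have : m - j = (m - (j + 1)) + 1 := by omega
      rw [this, Nat.mul_succ (145 * (L + 1))]
      simp only [IntExpr.cost, Test.cost] at g1 ⊢
      omega
  · refine ⟨by simpa using h1, fun x hx0 hx3 hxw hxo => by simp [hx3, h2 x hx0 hx3 hxw hxo],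
      by simp [IntExpr.eval], by simpa [hw3] using h4, ?_, ?_, ?_, ?_, ?_⟩
    · intro q hq
      simp [IntExpr.eval, hw3, h5 q hq]
    all_goals simp [IntExpr.eval]
  · rintro υ s ⟨k1, k2, k3, k4, k5, k6, k7, k8, k9⟩ hb hpot'
    simp only [Test.Holds, IntExpr.eval, k2 2 (by norm_num) (by norm_num) hw2 ho2, hM] at hb
    have e33 : υ.int 33 0 = m := by omega
    rw [e33] at k6 k7 k8
    refine ⟨?_, k1, k2, k6, k7, k8⟩
    simp [IntExpr.eval, IntExpr.cost, Test.cost] at hpot hpot' ⊢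
    have : 290 * ((L + 1) * (m + 1)) = 140 * (L + 1) * m + 145 * (L + 1) * m +
        5 * ((L + 1) * m) + 290 * (L + 1) := by ring
    rw [this]
    omega

end RealRAM

/-! ### Scenes: boundaries, sightlines and keys -/

/-- A family of disjoint axis-parallel segments, given as boxes `[xl i, xr i] × [yl i, yr i]`. The
numbers `0, …, top` stand for heights: `ht` is increasing on them, `ht (lo i) = yl i` and
`ht (hi i) = yr i`. -/
structure Scene (n : ℕ) where
  xl : Fin n → ℝ
  xr : Fin n → ℝ
  yl : Fin n → ℝ
  yr : Fin n → ℝ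
  lo : Fin n → ℕ
  hi : Fin n → ℕ
  top : ℕ
  ht : ℕ → ℝ
  shape : ∀ i, (xl i < xr i ∧ yl i = yr i) ∨ (xl i = xr i ∧ yl i < yr i)
  disj : ∀ i j, i ≠ j → xl i ≤ xr j → xl j ≤ xr i → yl i ≤ yr j → yl j ≤ yr i → False
  ht_lt : ∀ a b, a < b → b ≤ top → ht a < ht b
  ht_lo : ∀ i, ht (lo i) = yl i
  ht_hi : ∀ i, ht (hi i) = yr i
  lo_pos : ∀ i, 0 < lo i
  hi_pos : ∀ i, 0 < hi i
  lo_lt : ∀ i, lo i < top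
  hi_lt : ∀ i, hi i < top
  top_pos : 0 < top

namespace Scene

variable {n : ℕ} (S : Scene n)

/-- The points of the segment `i`. -/
def box (i : Fin n) : Set Plane := {z | S.xl i ≤ z.1 ∧ z.1 ≤ S.xr i ∧ S.yl i ≤ z.2 ∧ z.2 ≤ S.yr i}

/-- A `k`-modem at `q` illuminates `p`. -/
def Sees (k : ℕ) (q p : Plane) : Prop :=
  {i : Fin n | (openSegment ℝ q p ∩ S.box i).Nonempty}.ncard ≤ k

/-- The height of a boundary; the boundaries `0` and `top` are at infinity. -/
noncomputable def bd (p : ℕ) : EReal := if p = 0 then ⊥ else if S.top ≤ p then ⊤ else (S.ht p : ℝ)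

/-- Vertical segments on a common line share their key. -/
noncomputable def key (i : Fin n) : Fin n ⊕ ℝ :=
  if S.xl i = S.xr i then .inr (S.xl i) else .inl i

/-- The segments in `P` that meet the rectangle to the right of `u` between `b` and `c`. -/
def hits (P : Set (Fin n)) (u : EReal) (b c : ℕ) : Set (Fin n) :=
  {i | i ∈ P ∧ u < S.xr i ∧ b < S.hi i ∧ S.lo i < c}

variable {S}

theorem ht_le {a b : ℕ} (h : a ≤ b) (hb : b ≤ S.top) : S.ht a ≤ S.ht b := by
  rcases h.lt_or_eq with h | rfl
  · exact (S.ht_lt a b h hb).le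
  · exact le_rfl

theorem lt_of_ht_lt {a b : ℕ} (ha : a ≤ S.top) (h : S.ht a < S.ht b) : a < b := by
  by_contra hab
  exact absurd (ht_le (not_lt.mp hab) ha) (not_le.mpr h)

theorem le_of_ht_le {a b : ℕ} (ha : a ≤ S.top) (h : S.ht a ≤ S.ht b) : a ≤ b := by
  by_contra hab
  exact absurd (S.ht_lt b a (not_le.mp hab) ha) (not_lt.mpr h)

theorem yl_le_yr (i : Fin n) : S.yl i ≤ S.yr i := by
  rcases S.shape i with h | h
  · exact h.2.le
  · exact h.2.le

theorem xl_le_xr (i : Fin n) : S.xl i ≤ S.xr i := by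
  rcases S.shape i with h | h
  · exact h.1.le
  · exact h.1.le

theorem lo_eq_hi {i : Fin n} (h : S.xl i < S.xr i) : S.lo i = S.hi i := by
  have hy : S.ht (S.lo i) = S.ht (S.hi i) := by
    rw [S.ht_lo, S.ht_hi]
    rcases S.shape i with h' | h'
    · exact h'.2
    · exact absurd h'.1 h.ne
  exact le_antisymm (le_of_ht_le (S.lo_lt i).le hy.le) (le_of_ht_le (S.hi_lt i).le hy.ge)

theorem lo_lt_hi {i : Fin n} (h : S.xl i = S.xr i) : S.lo i < S.hi i := by
  refine lt_of_ht_lt (S.lo_lt i).le ?_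
  rw [S.ht_lo, S.ht_hi]
  rcases S.shape i with h' | h'
  · exact absurd h h'.1.ne
  · exact h'.2

theorem bd_lt {a b : ℕ} (h : a < b) (hb : b ≤ S.top) : S.bd a < S.bd b := by
  unfold bd
  by_cases ha : a = 0
  · rw [if_pos ha, if_neg (by omega)]
    split_ifs
    · exact bot_lt_top
    · exact EReal.bot_lt_coe _
  · rw [if_neg ha, if_neg (by omega), if_neg (by omega)]
    split_ifs
    · exact EReal.coe_lt_top _
    · exact EReal.coe_lt_coe_iff.mpr (S.ht_lt a b h hb)

theorem bd_eq {p : ℕ} (h0 : 0 < p) (h1 : p < S.top) : S.bd p = (S.ht p : ℝ) := by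
  rw [bd, if_neg (by omega), if_neg (by omega)]

/-- Since `bd` is strictly increasing, comparisons of heights with the possibly infinite boundaries
reduce to comparisons of position numbers, the form used in `hits`. -/
theorem lt_hi_of_bd_lt {b : ℕ} {i : Fin n} (hb : b ≤ S.top) (h : S.bd b < S.yr i) : b < S.hi i := by
  by_contra hn
  rw [not_lt] at hn
  rw [← S.ht_hi, ← bd_eq (S.hi_pos i) (S.hi_lt i)] at h
  rcases hn.lt_or_eq with h' | h'
  · exact absurd (bd_lt h' hb) h.not_gt
  · rw [h'] at h; exact absurd h (lt_irrefl _)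

theorem lo_lt_of_lt_bd {c : ℕ} {i : Fin n} (h : S.yl i < S.bd c) : S.lo i < c := by
  by_contra hn
  rw [not_lt] at hn
  rw [← S.ht_lo, ← bd_eq (S.lo_pos i) (S.lo_lt i)] at h
  rcases hn.lt_or_eq with h' | h'
  · exact absurd (bd_lt h' (S.lo_lt i).le) h.not_gt
  · rw [h'] at h; exact absurd h (lt_irrefl _)

/-- The positions `0` and `top` carry finite heights in `ht` although `bd` places these boundaries
at infinity. The average of the two heights is thus a real ordinate inside the cell, even for an
unbounded cell. -/
theorem bd_mid {b c : ℕ} (h : b < c) (hc : c ≤ S.top) :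
    S.bd b < (((S.ht b + S.ht c) / 2 : ℝ) : EReal) ∧
      (((S.ht b + S.ht c) / 2 : ℝ) : EReal) < S.bd c := by
  have hlt := S.ht_lt b c h hc
  unfold bd
  constructor
  · split_ifs with h0 h1
    · exact EReal.bot_lt_coe _
    · omega
    · exact EReal.coe_lt_coe_iff.mpr (by linarith)
  · split_ifs with h0 h1
    · omega
    · exact EReal.coe_lt_top _
    · exact EReal.coe_lt_coe_iff.mpr (by linarith)

theorem convex_coord {a b s t r : ℝ} (ha : 0 < a) (hb : 0 < b) (hab : a + b = 1)
    (hs : s ≤ r) (ht : t < r) : a * t + b * s < r := by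
  have : r = a * r + b * r := by rw [← add_mul, hab, one_mul]
  rw [this]
  exact add_lt_add_of_lt_of_le (mul_lt_mul_of_pos_left ht ha) (mul_le_mul_of_nonneg_left hs hb.le)

theorem convex_coord' {a b s t r : ℝ} (ha : 0 < a) (hb : 0 < b) (hab : a + b = 1)
    (hs : r ≤ s) (ht : r < t) : r < a * t + b * s := by
  have : r = a * r + b * r := by rw [← add_mul, hab, one_mul]
  rw [this]
  exact add_lt_add_of_lt_of_le (mul_lt_mul_of_pos_left ht ha) (mul_le_mul_of_nonneg_left hs hb.le)

/-- The illuminated point may lie on the rim of its cell, but the modem is strictly inside; then so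
are all interior points of the sightline. -/
theorem convex_lt {a b s t : ℝ} {r : EReal} (ha : 0 < a) (hb : 0 < b) (hab : a + b = 1)
    (hs : (s : EReal) ≤ r) (ht : (t : EReal) < r) : ((a * t + b * s : ℝ) : EReal) < r := by
  induction r with
  | bot => simp at ht
  | top => exact EReal.coe_lt_top _
  | coe r =>
    rw [EReal.coe_le_coe_iff] at hs
    rw [EReal.coe_lt_coe_iff] at ht ⊢
    exact convex_coord ha hb hab hs ht

theorem lt_convex {a b s t : ℝ} {r : EReal} (ha : 0 < a) (hb : 0 < b) (hab : a + b = 1)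
    (hs : r ≤ (s : EReal)) (ht : r < (t : EReal)) : r < ((a * t + b * s : ℝ) : EReal) := by
  induction r with
  | bot => exact EReal.bot_lt_coe _
  | top => simp at ht
  | coe r =>
    rw [EReal.coe_le_coe_iff] at hs
    rw [EReal.coe_lt_coe_iff] at ht ⊢
    exact convex_coord' ha hb hab hs ht

/-- A modem in a rectangle that is met by segments with at most `k` keys illuminates the
rectangle. -/
theorem sees_of_keys {k : ℕ} {P : Set (Fin n)} {W : ℝ} {u : EReal} {b c : ℕ} {q p : Plane}
    (hb : b ≤ S.top) (hW : ∀ i, i ∉ P → W ≤ S.xl i)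
    (hk : (S.key '' {i | i ∈ S.hits P u b c ∧ S.xl i < W}).ncard ≤ k)
    (hp0 : u ≤ p.1) (hp1 : p.1 < W) (hp2 : S.bd b ≤ p.2) (hp3 : p.2 < S.bd c)
    (hq0 : u < q.1) (hq1 : q.1 < W) (hq2 : S.bd b < q.2) (hq3 : q.2 < S.bd c)
    (hq : ∀ i, S.xl i = S.xr i → S.xl i ≠ q.1) : S.Sees k q p := by
  -- A segment met by the sightline is met strictly inside the cell and left of `W`, so it is one of
  -- the segments counted in `hk`.
  have hsub : {i : Fin n | (openSegment ℝ q p ∩ S.box i).Nonempty} ⊆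
      {i | i ∈ S.hits P u b c ∧ S.xl i < W} := by
    rintro i ⟨z, ⟨α, β, hα, hβ, hαβ, rfl⟩, h1, h2, h3, h4⟩
    simp only [Prod.fst_add, Prod.smul_fst, smul_eq_mul, Prod.snd_add, Prod.smul_snd] at h1 h2 h3 h4
    have hx : S.xl i < W := h1.trans_lt (convex_coord hα hβ hαβ hp1.le hq1)
    refine ⟨⟨?_, ?_, ?_, ?_⟩, hx⟩
    · by_contra hi
      exact absurd (hW i hi) (not_le.mpr hx)
    · exact (lt_convex hα hβ hαβ hp0 hq0).trans_le (EReal.coe_le_coe_iff.mpr h2)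
    · exact lt_hi_of_bd_lt hb ((lt_convex hα hβ hαβ hp2 hq2).trans_le (EReal.coe_le_coe_iff.mpr h4))
    · exact lo_lt_of_lt_bd ((EReal.coe_le_coe_iff.mpr h3).trans_lt
        (convex_lt hα hβ hαβ hp3.le hq3))
  -- Two vertical segments with equal keys that are both met lie on a line which does not contain
  -- `q`. The sightline is then not vertical and crosses this line in a single point, which would
  -- belong to both disjoint segments.
  have hinj : Set.InjOn S.key {i : Fin n | (openSegment ℝ q p ∩ S.box i).Nonempty} := by
    rintro i ⟨z, ⟨α, β, hα, hβ, hαβ, rfl⟩, h1, h2, h3, h4⟩ j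
      ⟨w, ⟨γ, δ, hγ, hδ, hγδ, rfl⟩, g1, g2, g3, g4⟩ hij
    simp only [Prod.fst_add, Prod.smul_fst, smul_eq_mul, Prod.snd_add, Prod.smul_snd] at h1 h2 h3 h4
    simp only [Prod.fst_add, Prod.smul_fst, smul_eq_mul, Prod.snd_add, Prod.smul_snd] at g1 g2 g3 g4
    unfold key at hij
    split_ifs at hij with hi hj hj
    · by_contra hne
      simp only [Sum.inr.injEq] at hij
      have e1 : α * q.1 + β * p.1 = S.xl i := le_antisymm (h2.trans hi.ge) h1
      have e2 : γ * q.1 + δ * p.1 = S.xl i := by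
        rw [hij]; exact le_antisymm (g2.trans hj.ge) g1
      have hqp : q.1 ≠ p.1 := by
        intro h
        apply hq i hi
        rw [← e1, ← h, ← add_mul, hαβ, one_mul]
      have hαγ : α = γ := by
        have hβ' : β = 1 - α := by linarith
        have hδ' : δ = 1 - γ := by linarith
        rw [← e2, hβ', hδ'] at e1
        have : (α - γ) * (q.1 - p.1) = 0 := by linarith
        rcases mul_eq_zero.mp this with h | h
        · linarith
        · exact absurd (by linarith) hqp
      have hβδ : β = δ := by linarith
      subst hαγ hβδ
      exact S.disj i j hne (h1.trans g2) (g1.trans h2) (h3.trans g4) (g3.trans h4)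
    · simpa using hij
  calc _ = (S.key '' {i : Fin n | (openSegment ℝ q p ∩ S.box i).Nonempty}).ncard :=
        hinj.ncard_image.symm
    _ ≤ _ := Set.ncard_le_ncard (Set.image_mono hsub) (Set.toFinite _)
    _ ≤ k := hk

end Scene

/-! ### Consecutive boundaries and counts between them -/

/-- `b` and `c` are consecutive elements of `B`. -/
def Adj (B : Finset ℕ) (b c : ℕ) : Prop := b ∈ B ∧ c ∈ B ∧ b < c ∧ ∀ x ∈ B, x ≤ b ∨ c ≤ x

theorem Adj.right_unique {B : Finset ℕ} {b c c' : ℕ} (h : Adj B b c) (h' : Adj B b c') : c = c' := by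
  obtain ⟨h1, h2, h3, h4⟩ := h
  obtain ⟨g1, g2, g3, g4⟩ := h'
  have := h4 c' g2
  have := g4 c h2
  omega

/-- A boundary inserted inside one cell replaces it by two and leaves all other cells alone; the
clause `x ≠ b` excludes the cell that disappears. -/
theorem adj_insert {B : Finset ℕ} {b c d x y : ℕ} (h : Adj B b c) (hb : b < d) (hd : d < c) :
    Adj (insert d B) x y ↔ (x = b ∧ y = d) ∨ (x = d ∧ y = c) ∨ (x ≠ b ∧ Adj B x y) := by
  obtain ⟨h1, h2, h3, h4⟩ := h
  simp only [Adj, Finset.mem_insert, forall_eq_or_imp]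
  constructor
  · rintro ⟨g1, g2, g3, g4, g5⟩
    have a1 := g5 b h1
    have a2 := g5 c h2
    rcases g1 with rfl | g1 <;> rcases g2 with rfl | g2
    · omega
    · have := h4 y g2; omega
    · have := h4 x g1; omega
    · by_cases hx : x = b
      · subst hx; have := h4 y g2; omega
      · exact .inr (.inr ⟨hx, g1, g2, g3, g5⟩)
  · rintro (⟨rfl, rfl⟩ | ⟨rfl, rfl⟩ | ⟨hx, g1, g2, g3, g4⟩)
    · refine ⟨.inr h1, .inl rfl, hb, by omega, fun z hz => ?_⟩
      have := h4 z hz; omega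
    · refine ⟨.inl rfl, .inr h2, hd, by omega, fun z hz => ?_⟩
      have := h4 z hz; omega
    · refine ⟨.inr g1, .inr g2, g3, ?_, g4⟩
      have a1 := h4 x g1
      have a2 := h4 y g2
      have a3 := g4 b h1
      have a4 := g4 c h2
      omega

theorem adj_erase {B : Finset ℕ} {b c d x y : ℕ} (h : Adj B b c) (h' : Adj B c d) :
    Adj (B.erase c) x y ↔ (x = b ∧ y = d) ∨ (x ≠ b ∧ x ≠ c ∧ Adj B x y) := by
  obtain ⟨h1, h2, h3, h4⟩ := h
  obtain ⟨k1, k2, k3, k4⟩ := h'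
  simp only [Adj, Finset.mem_erase]
  constructor
  · rintro ⟨⟨g0, g1⟩, ⟨g2, g3⟩, g4, g5⟩
    have a1 := g5 b ⟨by omega, h1⟩
    have a2 := g5 d ⟨by omega, k2⟩
    have a3 := h4 x g1
    have a4 := h4 y g3
    have a5 := k4 x g1
    have a6 := k4 y g3
    by_cases hx : x = b
    · left; omega
    · refine .inr ⟨hx, g0, g1, g3, g4, fun z hz => ?_⟩
      by_cases hzc : z = c
      · omega
      · exact g5 z ⟨hzc, hz⟩
  · rintro (⟨rfl, rfl⟩ | ⟨hx, hxc, g1, g2, g3, g4⟩)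
    · refine ⟨⟨by omega, h1⟩, ⟨by omega, k2⟩, by omega, fun z hz => ?_⟩
      have := h4 z hz.2
      have := k4 z hz.2
      omega
    · have a1 := g4 b h1
      have a2 := g4 c h2
      have a3 := h4 y g2
      have a4 := h4 x g1
      refine ⟨⟨hxc, g1⟩, ⟨by omega, g2⟩, g3, fun z hz => g4 z hz.2⟩

/-- The number of elements of `H` strictly between `b` and `c`. -/
def between (H : Finset ℕ) (b c : ℕ) : ℕ := (H.filter fun p => b < p ∧ p < c).card

theorem between_insert_of_mem {H : Finset ℕ} {b c p : ℕ} (hp : p ∉ H) (hb : b < p) (hc : p < c) :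
    between (insert p H) b c = between H b c + 1 := by
  rw [between, Finset.filter_insert, if_pos ⟨hb, hc⟩, Finset.card_insert_of_notMem (by simp [hp])]
  rfl

theorem between_insert_of_notMem {H : Finset ℕ} {b c p : ℕ} (h : ¬ (b < p ∧ p < c)) :
    between (insert p H) b c = between H b c := by
  rw [between, Finset.filter_insert, if_neg h]
  rfl

theorem between_mono {H H' : Finset ℕ} (h : H' ⊆ H) (b c : ℕ) : between H' b c ≤ between H b c :=
  Finset.card_le_card (Finset.filter_subset_filter _ h)

/-- The summand `1` is the horizontal segment at which a cell is split; as a boundary it is counted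
on neither side. -/
theorem between_split {H : Finset ℕ} {b c p : ℕ} (hp : p ∈ H) (hb : b < p) (hc : p < c) :
    between H b c = between H b p + 1 + between H p c := by
  have : (H.filter fun x => b < x ∧ x < c) =
      insert p ((H.filter fun x => b < x ∧ x < p) ∪ (H.filter fun x => p < x ∧ x < c)) := by
    ext x
    simp only [Finset.mem_filter, Finset.mem_insert, Finset.mem_union]
    constructor
    · rintro ⟨h1, h2, h3⟩
      rcases lt_trichotomy x p with h | h | h
      · exact .inr (.inl ⟨h1, h2, h⟩)
      · exact .inl h
      · exact .inr (.inr ⟨h1, h, h3⟩)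
    · rintro (rfl | ⟨h1, h2, h3⟩ | ⟨h1, h2, h3⟩)
      · exact ⟨hp, hb, hc⟩
      · exact ⟨h1, h2, by omega⟩
      · exact ⟨h1, by omega, h3⟩
  rw [between, this, Finset.card_insert_of_notMem (by simp), Finset.card_union_of_disjoint]
  · simp only [between]; omega
  · rw [Finset.disjoint_left]
    intro x hx hx'
    simp only [Finset.mem_filter] at hx hx'
    omega

/-! ### Credits of cells -/

/-- The amount `φ` suffices to pay for the future of a cell in phase `ph` with counter `cnt` that is
crossed by `l` horizontal segments. A cell in phase `0` still owes the location of its modem. -/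
def CreditOK (k : ℕ) (ph cnt l : ℕ) (φ : ℤ) : Prop :=
  (ph = 0 ∧ 8 * (k : ℤ) ≤ φ ∧ 10 * (k : ℤ) - 8 * (k + 1 - cnt) ≤ φ ∧
      8 * (k : ℤ) + 14 * (l - (k + 1 - cnt)) ≤ φ) ∨
  (ph = 1 ∧ 4 * (k : ℤ) ≤ φ ∧ 8 * (k : ℤ) - 8 * (k + 1 - cnt) ≤ φ ∧
      (16 * (k : ℤ) - 14 * (k + 1 - cnt) ≤ φ ∨ 5 * (k : ℤ) - 14 * (k + 1 - cnt) + 22 * l ≤ φ))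

namespace CreditOK

variable {k ph c l l' : ℕ} {φ φ' : ℤ}

theorem four_mul_le (h : CreditOK k ph c l φ) : 4 * (k : ℤ) ≤ φ := by
  unfold CreditOK at h; omega

theorem mono (h : CreditOK k ph c l φ) (hl : l' ≤ l) (hφ : φ ≤ φ') : CreditOK k ph c l' φ' := by
  unfold CreditOK at *; omega

theorem eight_mul_le_of_zero (h : CreditOK k 0 c l φ) : 8 * (k : ℤ) ≤ φ := by
  unfold CreditOK at h; simp at h; omega

/-- With counter `1` the cell can still take `r = k` hits, so every requirement of phase 1 other
than `4k` becomes trivial. -/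
theorem paired (h : 4 * (k : ℤ) ≤ φ) : CreditOK k 1 (0 + 1) 0 φ := by
  refine .inr ⟨rfl, h, ?_, .inr ?_⟩ <;> push_cast <;> omega

/-- The hit lowers `r` and raises `l`. The largest increase is that of `5k - 14r + 22l` in phase 1,
by `14 + 22 = 36`; this accounts for the `36` units per segment. -/
theorem horizontal (h : CreditOK k ph c l φ) : CreditOK k ph (c + 1) (l + 1) (φ + 36) := by
  unfold CreditOK at *; push_cast; omega

/-- Every requirement has coefficient at most `14` at `r`, and `l` does not change. -/
theorem verticalEnd (h : CreditOK k ph c l φ) : CreditOK k ph (c + 1) l (φ + 14) := by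
  unfold CreditOK at *; push_cast; omega

/-- After the hit `r ≥ 0` and still `l = 0`, so the requirements with coefficient `14` follow from
the others: `8k - 14r ≤ 8k` in phase 0 and `5k - 14r ≤ 8k - 8r` in phase 1. Only coefficients `8`
remain. -/
theorem crossing (h : CreditOK k ph c 0 φ) (hc : c ≤ k) :
    CreditOK k ph (c + 1) 0 (φ + 8) := by
  unfold CreditOK at *; push_cast; omega

/-- At overflow `r = 0`, so `φ` is at least `10k` and `8k + 14l`. After payment of `6k` at least
`4k` and `2k + 14l` are left, and the latter is exactly `16k - 14r` for the new `r = k - l`. -/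
theorem nextPhase (h : CreditOK k 0 (k + 1) l φ) : CreditOK k 1 (l + 1) l (φ - 6 * k) := by
  unfold CreditOK at *; push_cast at *; simp at *; omega

/-- Here `r = k + 1 - l ≥ l`, so the terms depending on `r` and `l` stay below `8k`. -/
theorem fresh (h2 : 2 * l ≤ k + 1) (hφ : 8 * (k : ℤ) ≤ φ) : CreditOK k 0 l l φ := by
  unfold CreditOK; omega

/-- An overfull cell whose modem cannot be used twice pays for the modem, if due, and for one new
cell of `8k`, or for two if `l` is large. In phase 0 one has `l ≥ k`, so `8k + 14l ≥ 22k`. In phase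
1 the last requirement gives `16k` directly or through `5k + 22l` with `2l > k + 1`. -/
theorem eight_mul_le (h : CreditOK k ph (k + 1) l φ) (hph : ph = 0 → k < l + 1) (hl : l ≤ k + 1) :
    (if ph = 0 then 6 * (k : ℤ) else 0) + 8 * k ≤ φ ∧
      (k + 1 < 2 * l → (if ph = 0 then 6 * (k : ℤ) else 0) + 16 * k ≤ φ) := by
  unfold CreditOK at *
  push_cast at *
  split_ifs with h0 <;> simp_all <;> omega

end CreditOK

/-! ### State and invariant of the sweep -/

/-- The state of the sweep: boundaries, heights of the current horizontal segments, the data of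
the cells (indexed by their lower boundaries), the modems located so far, the number of the current
vertical line, an abscissa shortly before it, and its abscissa. -/
structure Sweep where
  B : Finset ℕ
  H : Finset ℕ
  cnt : ℕ → ℕ
  ph : ℕ → ℕ
  lv : ℕ → ℕ
  M : ℕ
  loc : ℕ → Plane
  g : ℕ
  m : ℝ
  X : ℝ

namespace Scene

variable {n : ℕ} (S : Scene n) (k : ℕ)

/-- The keys that are accounted for in a cell. -/
def keys (s : Sweep) (P : Set (Fin n)) (u : EReal) (b c : ℕ) : Set (Fin n ⊕ ℝ) :=
  S.key '' S.hits P u b c ∪ {κ | κ = .inr s.X ∧ s.lv b = s.g ∧ u < s.X}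

/-- The invariant of the cell between `b` and `c`, which extends from `u` to the right. -/
structure CellOK (s : Sweep) (P : Set (Fin n)) (D : Finset ℕ) (u : EReal) (φ : ℤ) (Xp : ℝ)
    (b c : ℕ) : Prop where
  credit : CreditOK k (s.ph b) (s.cnt b) (between s.H b c) φ
  live_le : between s.H b c ≤ s.cnt b
  small : s.cnt b ≤ k ∨ (b ∈ D ∧ s.cnt b = k + 1)
  keys_le : (S.keys s P u b c).ncard ≤ s.cnt b
  old_le : (S.key '' {i | i ∈ S.hits P u b c ∧ S.xl i < s.X}).ncard ≤ k
  start : u = s.X ∨ u ≤ Xp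
  modem : s.ph b = 1 → ∃ j < s.M, u < (s.loc j).1 ∧ (s.loc j).1 < s.X ∧
    (∀ i, S.xl i = S.xr i → S.xl i ≠ (s.loc j).1) ∧
    S.bd b < (s.loc j).2 ∧ (s.loc j).2 < S.bd c

/-- The invariant of the sweep; `P` is the set of processed segments, `D` contains the cells that
may be overfull, `cr` is the number of processed segments that were paid for, `u` and `φ` give the
left ends and the credits of the cells, and no endpoint lies strictly between `Xp` and `s.X`. -/
structure Inv (s : Sweep) (P : Set (Fin n)) (D : Finset ℕ) (cr : ℕ) (u : ℕ → EReal) (φ : ℕ → ℤ)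
    (Xp : ℝ) : Prop where
  zero_mem : 0 ∈ s.B
  top_mem : S.top ∈ s.B
  le_top : ∀ b ∈ s.B, b ≤ S.top
  processed : ∀ i ∈ P, S.xl i ≤ s.X
  unprocessed : ∀ i ∉ P, s.X ≤ S.xl i
  lt_m : Xp < s.m
  m_lt : s.m < s.X
  gap_l : ∀ i, S.xl i ≤ Xp ∨ s.X ≤ S.xl i
  gap_r : ∀ i, S.xr i ≤ Xp ∨ s.X ≤ S.xr i
  live : ∀ p, p ∈ s.H ↔ ∃ i ∈ P, S.xl i < S.xr i ∧ S.lo i = p ∧ s.X ≤ S.xr i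
  lv_le : ∀ b, s.lv b ≤ s.g
  cell : ∀ b c, Adj s.B b c → S.CellOK k s P D (u b) (φ b) Xp b c
  cover : ∀ p : Plane, (∃ j < s.M, S.Sees k (s.loc j) p) ∨
    ∃ b c, Adj s.B b c ∧ u b ≤ p.1 ∧ S.bd b ≤ p.2 ∧ p.2 < S.bd c
  top_credit : 0 ≤ φ S.top
  total : 6 * (k : ℤ) * s.M + ∑ b ∈ s.B, φ b ≤ 8 * k + 36 * cr

variable {S k}

theorem Inv.bd_lt_bd {s : Sweep} {P D cr u φ Xp} (h : S.Inv k s P D cr u φ Xp) {b c : ℕ}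
    (hbc : Adj s.B b c) : b < c ∧ c ≤ S.top ∧ b ≤ S.top ∧ b ≠ S.top := by
  have h1 := h.le_top c hbc.2.1
  have h2 := hbc.2.2.1
  exact ⟨h2, h1, by omega, by omega⟩

/-- The invariant of a cell depends only on the data of this cell. -/
theorem CellOK.congr {s s' : Sweep} {P : Set (Fin n)} {D D' : Finset ℕ} {u : EReal} {φ : ℤ}
    {Xp : ℝ} {b c : ℕ} (h : S.CellOK k s P D u φ Xp b c) (hH : between s'.H b c = between s.H b c)
    (hcnt : s'.cnt b = s.cnt b) (hph : s'.ph b = s.ph b) (hlv : s'.lv b = s.lv b)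
    (hM : s.M ≤ s'.M) (hloc : ∀ j < s.M, s'.loc j = s.loc j) (hg : s'.g = s.g) (hX : s'.X = s.X)
    (hD : b ∈ D → b ∈ D') : S.CellOK k s' P D' u φ Xp b c where
  credit := by rw [hH, hcnt, hph]; exact h.credit
  live_le := by rw [hH, hcnt]; exact h.live_le
  small := by
    rw [hcnt]
    exact h.small.imp_right fun h => ⟨hD h.1, h.2⟩
  keys_le := by
    have := h.keys_le
    unfold keys at this ⊢
    rwa [hcnt, hlv, hg, hX]
  old_le := by rw [hX]; exact h.old_le
  start := by rw [hX]; exact h.start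
  modem := by
    rw [hph, hX]
    intro h1
    obtain ⟨j, hj, h2⟩ := h.modem h1
    exact ⟨j, hj.trans_le hM, by rw [hloc j hj]; exact h2⟩

theorem finite_keys (s : Sweep) (P : Set (Fin n)) (u : EReal) (b c : ℕ) : (S.keys s P u b c).Finite :=
  (Set.toFinite _).union ((Set.finite_singleton (.inr s.X)).subset fun _ h => h.1)

/-- The horizontal segments in a cell to the right of `Xp` are current. -/
theorem Inv.ncard_horizontal_le {s : Sweep} {P D cr u φ Xp} (h : S.Inv k s P D cr u φ Xp) {v : EReal}
    (hv : (Xp : EReal) ≤ v) (b c : ℕ) :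
    (S.key '' {i | i ∈ S.hits P v b c ∧ S.xl i < S.xr i}).ncard ≤ between s.H b c := by
  classical
  -- No right end lies strictly between `Xp` and the current line, so reaching beyond `Xp` means
  -- reaching the line.
  have hr : ∀ i, v < S.xr i → s.X ≤ S.xr i := fun i hi => by
    rcases h.gap_r i with hg | hg
    · exact absurd (hv.trans_lt hi) (not_lt.mpr (EReal.coe_le_coe_iff.mpr hg))
    · exact hg
  refine (Set.ncard_image_le (Set.toFinite _)).trans ?_
  rw [between, ← Set.ncard_coe_finset]
  -- Distinct horizontal segments reaching the line have distinct heights, since otherwise they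
  -- would meet on it.
  refine Set.ncard_le_ncard_of_injOn S.lo ?_ ?_ (Set.toFinite _)
  · rintro i ⟨⟨h1, h2, h3, h4⟩, h5⟩
    simp only [Finset.coe_filter, Set.mem_ofPred_eq]
    exact ⟨(h.live _).mpr ⟨i, h1, h5, rfl, hr i h2⟩, by rw [lo_eq_hi h5]; exact h3, h4⟩
  · rintro i ⟨⟨h1, h2, h3, h4⟩, h5⟩ j ⟨⟨g1, g2, g3, g4⟩, g5⟩ hij
    by_contra hne
    have hy : S.yl i = S.yl j := by rw [← S.ht_lo, ← S.ht_lo, hij]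
    exact S.disj i j hne ((h.processed i h1).trans (hr j g2)) ((h.processed j g1).trans (hr i h2))
      (by rw [hy]; exact yl_le_yr j) (by rw [← hy]; exact yl_le_yr i)

/-- A cell that starts at the current line. -/
theorem Inv.cellOK_fresh {s : Sweep} {P D cr u φ Xp} (h : S.Inv k s P D cr u φ Xp) (s' : Sweep)
    {D' : Finset ℕ} {b c : ℕ} {ψ : ℤ} (hk : 0 < k) (hH : s'.H = s.H) (hX : s'.X = s.X)
    (hph : s'.ph b = 0) (hcnt : s'.cnt b = between s.H b c) (hl : 2 * between s.H b c ≤ k + 1)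
    (hψ : 8 * (k : ℤ) ≤ ψ) : S.CellOK k s' P D' s.X ψ Xp b c := by
  have h1 : (S.keys s' P s.X b c).ncard ≤ s'.cnt b := by
    rw [hcnt]
    refine le_trans (Set.ncard_le_ncard ?_ (Set.toFinite _)) (h.ncard_horizontal_le (v := s.X)
      (EReal.coe_le_coe_iff.mpr (h.lt_m.trans h.m_lt).le) b c)
    -- A processed segment with points strictly right of the line must be horizontal, and the
    -- reserved key of the line is void because the cell begins on it.
    rintro κ (⟨i, hi, rfl⟩ | ⟨-, -, h3⟩)
    · refine ⟨i, ⟨hi, lt_of_le_of_lt (h.processed i hi.1) (EReal.coe_lt_coe_iff.mp hi.2.1)⟩, rfl⟩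
    · rw [hX] at h3
      exact absurd h3 (lt_irrefl _)
  refine ⟨by rw [hH, hph, hcnt]; exact CreditOK.fresh hl hψ, by rw [hH, hcnt],
    .inl (by rw [hcnt]; omega), h1, ?_, .inl (by rw [hX]), by rw [hph]; intro h; omega⟩
  refine (Set.ncard_le_ncard ?_ (finite_keys _ _ _ _ _)).trans (h1.trans (by rw [hcnt]; omega))
  rintro _ ⟨i, hi, rfl⟩
  exact .inl ⟨i, hi.1, rfl⟩

/-- A cell that starts shortly before the current line, where a modem was placed. -/
theorem Inv.cellOK_paired {s : Sweep} {P D cr u φ Xp} (h : S.Inv k s P D cr u φ Xp) (s' : Sweep)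
    {D' : Finset ℕ} {b c : ℕ} {ψ : ℤ} (hH : s'.H = s.H) (hX : s'.X = s.X)
    (hph : s'.ph b = 1) (hcnt : s'.cnt b = between s.H b c + 1) (hl : between s.H b c + 1 ≤ k)
    (hψ : CreditOK k 1 (between s.H b c + 1) (between s.H b c) ψ)
    (hmod : ∃ j < s'.M, (s'.loc j).1 = s.m ∧ S.bd b < (s'.loc j).2 ∧ (s'.loc j).2 < S.bd c) :
    S.CellOK k s' P D' Xp ψ Xp b c := by
  have hk1 : (S.keys s' P Xp b c).ncard ≤ s'.cnt b := by
    -- Between `Xp` and the current line no segment begins or ends. A cell starting at `Xp` thus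
    -- meets only current horizontal segments and verticals on the line; the latter share one key,
    -- which gives the `+ 1`.
    have hsub : S.keys s' P Xp b c ⊆
        S.key '' {i | i ∈ S.hits P Xp b c ∧ S.xl i < S.xr i} ∪ {.inr s.X} := by
      rintro κ (⟨i, hi, rfl⟩ | ⟨rfl, -⟩)
      · rcases (xl_le_xr (S := S) i).lt_or_eq with hx | hx
        · exact .inl ⟨i, ⟨hi, hx⟩, rfl⟩
        · refine .inr ?_
          have : S.xl i = s.X := by
            refine le_antisymm (h.processed i hi.1) ?_
            rcases h.gap_r i with hg | hg
            · exact absurd hi.2.1 (not_lt.mpr (EReal.coe_le_coe_iff.mpr hg))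
            · rw [hx]; exact hg
          rw [key, if_pos hx, this]
          rfl
      · exact .inr (by rw [hX]; rfl)
    have h2 := h.ncard_horizontal_le (v := Xp) le_rfl b c
    rw [hcnt]
    refine (Set.ncard_le_ncard hsub (Set.toFinite _)).trans ((Set.ncard_union_le _ _).trans ?_)
    rw [Set.ncard_singleton]
    omega
  refine ⟨by rw [hph, hcnt, hH]; exact hψ, by rw [hH, hcnt]; omega, .inl (by rw [hcnt]; exact hl),
    hk1, ?_, .inr le_rfl, fun _ => ?_⟩
  · refine (Set.ncard_le_ncard ?_ (finite_keys _ _ _ _ _)).trans (hk1.trans (by rw [hcnt]; exact hl))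
    rintro _ ⟨i, hi, rfl⟩
    exact .inl ⟨i, hi.1, rfl⟩
  · obtain ⟨j, hj, h1, h2, h3⟩ := hmod
    refine ⟨j, hj, by rw [h1]; exact EReal.coe_lt_coe_iff.mpr h.lt_m, by rw [h1, hX]; exact h.m_lt,
      fun i _ he => ?_, h2, h3⟩
    rw [h1] at he
    have a1 := h.lt_m
    have a2 := h.m_lt
    rcases h.gap_l i with hg | hg <;> linarith

/-- The part of a cell to the left of the current line is illuminated by a modem located at the
abscissa `s.m`. -/
theorem Inv.sees_of_phase_zero {s : Sweep} {P D cr u φ Xp} (h : S.Inv k s P D cr u φ Xp) {b c : ℕ}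
    (hbc : Adj s.B b c) {y : ℝ} (hy : S.bd b < y) (hy' : y < S.bd c) {p : Plane}
    (h0 : u b ≤ p.1) (h1 : p.1 < s.X) (h2 : S.bd b ≤ p.2) (h3 : p.2 < S.bd c) :
    S.Sees k (s.m, y) p := by
  have hcell := h.cell b c hbc
  -- The cell has a point left of the line, so it does not start on the line; hence it starts at
  -- `Xp` or earlier, left of `m`.
  have hlm : u b < s.m := by
    rcases hcell.start with hs | hs
    · rw [hs, EReal.coe_le_coe_iff] at h0
      exact absurd h1 (not_lt.mpr h0)
    · exact hs.trans_lt (EReal.coe_lt_coe_iff.mpr h.lt_m)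
  refine sees_of_keys (h.bd_lt_bd hbc).2.2.1 h.unprocessed hcell.old_le h0 h1 h2 h3 hlm h.m_lt
    hy hy' fun i _ he => ?_
  have a1 := h.lt_m
  have a2 := h.m_lt
  rcases h.gap_l i with hg | hg <;> simp only at he <;> linarith

/-- The modem already present lies strictly inside the cell and left of the line, and at most `k`
keys begin before the line. -/
theorem Inv.sees_of_phase_one {s : Sweep} {P D cr u φ Xp} (h : S.Inv k s P D cr u φ Xp) {b c : ℕ}
    (hbc : Adj s.B b c) (hph : s.ph b = 1) {p : Plane}
    (h0 : u b ≤ p.1) (h1 : p.1 < s.X) (h2 : S.bd b ≤ p.2) (h3 : p.2 < S.bd c) :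
    ∃ j < s.M, S.Sees k (s.loc j) p := by
  have hcell := h.cell b c hbc
  obtain ⟨j, hj, g1, g2, g3, g4, g5⟩ := hcell.modem hph
  exact ⟨j, hj, sees_of_keys (h.bd_lt_bd hbc).2.2.1 h.unprocessed hcell.old_le h0 h1 h2 h3 g1 g2
    g4 g5 g3⟩

end Scene

/-! ### Settling and merging cells -/

namespace Scene

variable {n : ℕ} (S : Scene n) (k : ℕ)

/-- Locate the modem of the cell between `b` and `c` if it is still due. -/
noncomputable def discharge (s : Sweep) (b c : ℕ) : Sweep :=
  if s.ph b = 0 then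
    { s with M := s.M + 1, loc := Function.update s.loc s.M (s.m, (S.ht b + S.ht c) / 2) }
  else s

/-- Restore the invariant of the overfull cell between `b` and `c`; if the cell is split, this is
done at `d`. -/
noncomputable def settle (s : Sweep) (b c d : ℕ) : Sweep :=
  let l := between s.H b c
  let s' := S.discharge s b c
  if s.cnt b ≤ k then s
  else if s.ph b = 0 ∧ l + 1 ≤ k then
    { s' with ph := Function.update s.ph b 1, cnt := Function.update s.cnt b (l + 1) }
  else if 2 * l ≤ k + 1 then
    { s' with ph := Function.update s.ph b 0, cnt := Function.update s.cnt b l }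
  else
    { s' with
      B := insert d s.B
      ph := Function.update (Function.update s.ph b 0) d 0
      cnt := Function.update (Function.update s.cnt b (l / 2)) d (l - 1 - l / 2) }

/-- Merge the cell between `b` and `c` and the cell between `c` and `d`. -/
noncomputable def merge (s : Sweep) (b c d : ℕ) : Sweep :=
  let f := if s.ph b = 0 ∨ s.ph c = 0 then 1 else 0
  { S.discharge (S.discharge s b c) c d with
    B := s.B.erase c
    ph := Function.update s.ph b f
    cnt := Function.update s.cnt b f
    lv := Function.update s.lv b s.g }

variable {S k}

section discharge

variable (s : Sweep) (b c : ℕ)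

@[simp] theorem discharge_B : (S.discharge s b c).B = s.B := by unfold discharge; split_ifs <;> rfl
@[simp] theorem discharge_H : (S.discharge s b c).H = s.H := by unfold discharge; split_ifs <;> rfl
@[simp] theorem discharge_cnt : (S.discharge s b c).cnt = s.cnt := by
  unfold discharge; split_ifs <;> rfl
@[simp] theorem discharge_ph : (S.discharge s b c).ph = s.ph := by
  unfold discharge; split_ifs <;> rfl
@[simp] theorem discharge_lv : (S.discharge s b c).lv = s.lv := by
  unfold discharge; split_ifs <;> rfl
@[simp] theorem discharge_g : (S.discharge s b c).g = s.g := by unfold discharge; split_ifs <;> rfl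
@[simp] theorem discharge_m : (S.discharge s b c).m = s.m := by unfold discharge; split_ifs <;> rfl
@[simp] theorem discharge_X : (S.discharge s b c).X = s.X := by unfold discharge; split_ifs <;> rfl

theorem discharge_M : (S.discharge s b c).M = s.M + if s.ph b = 0 then 1 else 0 := by
  unfold discharge; split_ifs <;> rfl

theorem le_discharge_M : s.M ≤ (S.discharge s b c).M := by rw [discharge_M]; omega

theorem discharge_loc {j : ℕ} (hj : j < s.M) : (S.discharge s b c).loc j = s.loc j := by
  unfold discharge
  split_ifs
  · exact Function.update_of_ne (by omega) _ _
  · rfl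

theorem discharge_new (h : s.ph b = 0) :
    s.M < (S.discharge s b c).M ∧
      (S.discharge s b c).loc s.M = (s.m, (S.ht b + S.ht c) / 2) := by
  unfold discharge
  rw [if_pos h]
  exact ⟨Nat.lt_succ_self _, Function.update_self _ _ _⟩

end discharge

/-- After the modem of a cell has been located, the part of the cell to the left of the current line
is illuminated. -/
theorem Inv.sees_discharge {s : Sweep} {P D cr u φ Xp} (h : S.Inv k s P D cr u φ Xp) {b c : ℕ}
    (hbc : Adj s.B b c) {p : Plane} (h0 : u b ≤ p.1) (h1 : p.1 < s.X) (h2 : S.bd b ≤ p.2)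
    (h3 : p.2 < S.bd c) :
    ∃ j < (S.discharge s b c).M, S.Sees k ((S.discharge s b c).loc j) p := by
  have hlt := h.bd_lt_bd hbc
  by_cases hph : s.ph b = 0
  · obtain ⟨g1, g2⟩ := discharge_new (S := S) s b c hph
    refine ⟨s.M, g1, ?_⟩
    rw [g2]
    have hm := bd_mid (S := S) hlt.1 hlt.2.1
    exact h.sees_of_phase_zero hbc hm.1 hm.2 h0 h1 h2 h3
  · have hph1 : s.ph b = 1 := by
      rcases (h.cell b c hbc).credit with hc | hc
      · exact absurd hc.1 hph
      · exact hc.1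
    obtain ⟨j, hj, hs⟩ := h.sees_of_phase_one hbc hph1 h0 h1 h2 h3
    exact ⟨j, hj.trans_le (le_discharge_M _ _ _), by rw [discharge_loc s b c hj]; exact hs⟩

/-- Replace some cells by others. -/
theorem Inv.modify {s s' : Sweep} {P D cr u φ Xp} (h : S.Inv k s P D cr u φ Xp) {D' : Finset ℕ}
    {u' : ℕ → EReal} {φ' : ℕ → ℤ} (h0 : 0 ∈ s'.B) (htop : S.top ∈ s'.B) (hle : ∀ b ∈ s'.B, b ≤ S.top)
    (hH : s'.H = s.H) (hX : s'.X = s.X) (hm : s'.m = s.m) (hg : s'.g = s.g)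
    (hlv : ∀ b, s'.lv b ≤ s'.g) (hM : s.M ≤ s'.M) (hloc : ∀ j < s.M, s'.loc j = s.loc j)
    (hcell : ∀ x y, Adj s'.B x y →
      (Adj s.B x y ∧ s'.cnt x = s.cnt x ∧ s'.ph x = s.ph x ∧ s'.lv x = s.lv x ∧ u' x = u x ∧
        φ' x = φ x ∧ (x ∈ D → x ∈ D')) ∨ S.CellOK k s' P D' (u' x) (φ' x) Xp x y)
    (hcover : ∀ b c, Adj s.B b c → ∀ p : Plane, u b ≤ p.1 → S.bd b ≤ p.2 → p.2 < S.bd c →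
      (∃ j < s'.M, S.Sees k (s'.loc j) p) ∨
        ∃ x y, Adj s'.B x y ∧ u' x ≤ p.1 ∧ S.bd x ≤ p.2 ∧ p.2 < S.bd y)
    (htopc : 0 ≤ φ' S.top)
    (htotal : 6 * (k : ℤ) * s'.M + ∑ b ∈ s'.B, φ' b ≤ 6 * (k : ℤ) * s.M + ∑ b ∈ s.B, φ b) :
    S.Inv k s' P D' cr u' φ' Xp where
  zero_mem := h0
  top_mem := htop
  le_top := hle
  processed := by rw [hX]; exact h.processed
  unprocessed := by rw [hX]; exact h.unprocessed
  lt_m := by rw [hm]; exact h.lt_m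
  m_lt := by rw [hm, hX]; exact h.m_lt
  gap_l := by rw [hX]; exact h.gap_l
  gap_r := by rw [hX]; exact h.gap_r
  live := by rw [hH, hX]; exact h.live
  lv_le := hlv
  cell := by
    intro x y hxy
    rcases hcell x y hxy with ⟨h1, h2, h3, h4, h5, h6, h7⟩ | hc
    · rw [h5, h6]
      exact (h.cell x y h1).congr (by rw [hH]) h2 h3 h4 hM hloc hg hX h7
    · exact hc
  cover := by
    intro p
    rcases h.cover p with ⟨j, hj, hs⟩ | ⟨b, c, hbc, h1, h2, h3⟩
    · exact .inl ⟨j, hj.trans_le hM, by rw [hloc j hj]; exact hs⟩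
    · exact hcover b c hbc p h1 h2 h3
  top_credit := htopc
  total := htotal.trans h.total

theorem sum_update {B : Finset ℕ} {φ : ℕ → ℤ} {b : ℕ} (hb : b ∈ B) (v : ℤ) :
    ∑ x ∈ B, Function.update φ b v x = ∑ x ∈ B, φ x + (v - φ b) := by
  rw [Finset.sum_update_of_mem hb, ← Finset.sum_sdiff (Finset.singleton_subset_iff.mpr hb)]
  simp only [Finset.sum_singleton]
  ring

/-- The counter of an overfull cell. -/
theorem Inv.cnt_eq {s : Sweep} {P D cr u φ Xp} (h : S.Inv k s P D cr u φ Xp) {b c : ℕ}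
    (hbc : Adj s.B b c) (hc : ¬ s.cnt b ≤ k) : s.cnt b = k + 1 := by
  rcases (h.cell b c hbc).small with h1 | h1
  · exact absurd h1 hc
  · exact h1.2

theorem Inv.ph_le {s : Sweep} {P D cr u φ Xp} (h : S.Inv k s P D cr u φ Xp) {b c : ℕ}
    (hbc : Adj s.B b c) : s.ph b = 0 ∨ s.ph b = 1 :=
  (h.cell b c hbc).credit.imp (fun h => h.1) fun h => h.1

/-- In each case points of the old cell left of the line are seen by its modem, old or newly
located, and points from the line on belong to the successors. The successor starts at `Xp` if the
modem is reused, and on the line otherwise. For `l ≤ k + 1` a split at the median leaves at most `(k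
+ 1) / 2` horizontal segments on either side, as `cellOK_fresh` requires. -/
theorem Inv.settle {s : Sweep} {P D cr u φ Xp} (h : S.Inv k s P D cr u φ Xp) (hk : 0 < k)
    {b c d : ℕ} (hbc : Adj s.B b c)
    (hd : k < s.cnt b → ¬ (s.ph b = 0 ∧ between s.H b c + 1 ≤ k) →
      k + 1 < 2 * between s.H b c → d ∈ s.H ∧ b < d ∧ d < c ∧
      between s.H b d = between s.H b c / 2) :
    ∃ u' φ', S.Inv k (S.settle k s b c d) P (D.erase b) cr u' φ' Xp := by
  obtain ⟨hbc1, hbc2, hbc3, hbc4⟩ := h.bd_lt_bd hbc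
  have hcell := h.cell b c hbc
  have hcredit := hcell.credit
  have hlive := hcell.live_le
  have hXpX : (Xp : EReal) < s.X := EReal.coe_lt_coe_iff.mpr (h.lt_m.trans h.m_lt)
  have hMd := discharge_M (S := S) s b c
  unfold Scene.settle
  by_cases hc : s.cnt b ≤ k
  · rw [if_pos hc]
    refine ⟨u, φ, h.modify h.zero_mem h.top_mem h.le_top rfl rfl rfl rfl h.lv_le le_rfl
      (fun _ _ => rfl) (fun x y hxy => ?_) (fun x y hxy p h1 h2 h3 => .inr ⟨x, y, hxy, h1, h2, h3⟩)
      h.top_credit le_rfl⟩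
    by_cases hx : x = b
    · subst hx
      have : y = c := hxy.right_unique hbc
      subst this
      exact .inr ⟨hcell.credit, hcell.live_le, .inl hc, hcell.keys_le, hcell.old_le, hcell.start,
        hcell.modem⟩
    · exact .inl ⟨hxy, rfl, rfl, rfl, rfl, rfl, fun hD => Finset.mem_erase.mpr ⟨hx, hD⟩⟩
  have hck := h.cnt_eq hbc hc
  rw [hck] at hcredit hlive
  simp only [if_neg hc]
  split_ifs with h1 h2
  · -- second phase
    rw [if_pos h1.1] at hMd
    rw [h1.1] at hcredit
    refine ⟨Function.update u b Xp, Function.update φ b (φ b - 6 * k), h.modify (by simpa using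
      h.zero_mem) (by simpa using h.top_mem) (by simpa using h.le_top) (by simp) (by simp)
      (by simp) (by simp) (by simpa using h.lv_le) (le_discharge_M _ _ _)
      (fun j hj => discharge_loc _ _ _ hj) ?_ ?_ ?_ ?_⟩
    · intro x y hxy
      simp only [discharge_B] at hxy
      by_cases hx : x = b
      · subst hx
        obtain rfl : y = c := hxy.right_unique hbc
        right
        rw [Function.update_self, Function.update_self]
        obtain ⟨g1, g2⟩ := discharge_new (S := S) s x y h1.1
        have hm := bd_mid (S := S) hbc1 hbc2
        exact h.cellOK_paired _ (by simp) (by simp) (by simp) (by simp) h1.2 hcredit.nextPhase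
          ⟨s.M, g1, by simp [g2], by simpa [g2] using hm.1, by simpa [g2] using hm.2⟩
      · left
        simp [hx, hxy]
    · intro x y hxy p g0 g2 g3
      by_cases hx : x = b
      · subst hx
        obtain rfl : y = c := hxy.right_unique hbc
        rcases lt_or_ge p.1 s.X with hp | hp
        · exact .inl (h.sees_discharge hxy g0 hp g2 g3)
        · refine .inr ⟨x, y, by simpa using hxy, ?_, g2, g3⟩
          rw [Function.update_self]
          exact hXpX.le.trans (EReal.coe_le_coe_iff.mpr hp)
      · refine .inr ⟨x, y, by simpa using hxy, by rwa [Function.update_of_ne hx], g2, g3⟩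
    · rw [Function.update_of_ne (Ne.symm hbc4)]; exact h.top_credit
    · simp only [discharge_B, hMd]
      rw [sum_update hbc.1]
      push_cast
      linarith
  · -- the cell is replaced by one new cell
    have h8 := (hcredit.eight_mul_le (fun h0 => by
      by_contra hlt
      exact h1 ⟨h0, by omega⟩) hlive).1
    -- The price of the modem, zero if it was located earlier.
    set e : ℤ := if s.ph b = 0 then 6 * (k : ℤ) else 0 with he
    have hMd' : 6 * (k : ℤ) * (S.discharge s b c).M = 6 * k * s.M + e := by
      rw [hMd, he]; split_ifs <;> push_cast <;> ring
    refine ⟨Function.update u b s.X, Function.update φ b (φ b - e), h.modify (by simpa using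
      h.zero_mem) (by simpa using h.top_mem) (by simpa using h.le_top) (by simp) (by simp)
      (by simp) (by simp) (by simpa using h.lv_le) (le_discharge_M _ _ _)
      (fun j hj => discharge_loc _ _ _ hj) ?_ ?_ ?_ ?_⟩
    · intro x y hxy
      simp only [discharge_B] at hxy
      by_cases hx : x = b
      · subst hx
        obtain rfl : y = c := hxy.right_unique hbc
        right
        rw [Function.update_self, Function.update_self]
        exact h.cellOK_fresh _ hk (by simp) (by simp) (by simp) (by simp) h2 (by linarith)
      · left
        simp [hx, hxy]
    · intro x y hxy p g0 g2 g3
      by_cases hx : x = b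
      · subst hx
        obtain rfl : y = c := hxy.right_unique hbc
        rcases lt_or_ge p.1 s.X with hp | hp
        · exact .inl (h.sees_discharge hxy g0 hp g2 g3)
        · refine .inr ⟨x, y, by simpa using hxy, ?_, g2, g3⟩
          rw [Function.update_self]
          exact EReal.coe_le_coe_iff.mpr hp
      · refine .inr ⟨x, y, by simpa using hxy, by rwa [Function.update_of_ne hx], g2, g3⟩
    · rw [Function.update_of_ne (Ne.symm hbc4)]; exact h.top_credit
    · simp only [discharge_B]
      rw [hMd', sum_update hbc.1]
      linarith
  · -- the cell is split
    have h8 := (hcredit.eight_mul_le (fun h0 => by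
      by_contra hlt
      exact h1 ⟨h0, by omega⟩) hlive).2 (by omega)
    obtain ⟨hd1, hd2, hd3, hd4⟩ := hd (not_le.mp hc) h1 (by omega)
    have hsplit := between_split hd1 hd2 hd3
    have hdB : d ∉ s.B := fun hdB => by
      have := hbc.2.2.2 d hdB; omega
    have hdt : d ≠ S.top := by omega
    set e : ℤ := if s.ph b = 0 then 6 * (k : ℤ) else 0 with he
    have hMd' : 6 * (k : ℤ) * (S.discharge s b c).M = 6 * k * s.M + e := by
      rw [hMd, he]; split_ifs <;> push_cast <;> ring
    -- Both halves start on the line with credit `8k`; together with `e` this is covered by `h8`.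
    refine ⟨Function.update (Function.update u b s.X) d s.X,
      Function.update (Function.update φ b (8 * k)) d (8 * k), h.modify
      (Finset.mem_insert_of_mem h.zero_mem) (Finset.mem_insert_of_mem h.top_mem) ?_ (by simp)
      (by simp) (by simp) (by simp) (by simpa using h.lv_le) (le_discharge_M _ _ _)
      (fun j hj => discharge_loc _ _ _ hj) ?_ ?_ ?_ ?_⟩
    · intro x hx
      rcases Finset.mem_insert.mp hx with rfl | hx
      · omega
      · exact h.le_top x hx
    · intro x y hxy
      simp only at hxy
      rw [adj_insert hbc hd2 hd3] at hxy
      rcases hxy with ⟨rfl, rfl⟩ | ⟨rfl, rfl⟩ | ⟨hx, hxy⟩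
      · right
        have e1 : Function.update (Function.update u x (s.X : EReal)) y s.X x = s.X := by
          rw [Function.update_of_ne hd2.ne, Function.update_self]
        have e2 : Function.update (Function.update φ x (8 * (k : ℤ))) y (8 * k) x = 8 * k := by
          rw [Function.update_of_ne hd2.ne, Function.update_self]
        rw [e1, e2]
        refine h.cellOK_fresh _ hk (by simp) (by simp) ?_ ?_ (by omega) le_rfl
        · simp [Function.update_apply]
        · simp only []
          rw [Function.update_of_ne hd2.ne, Function.update_self, hd4]
      · right
        rw [Function.update_self, Function.update_self]
        refine h.cellOK_fresh _ hk (by simp) (by simp) ?_ ?_ (by omega) le_rfl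
        · simp
        · simp only []
          rw [Function.update_self]; omega
      · left
        have hxd : x ≠ d := fun hxd => hdB (hxd ▸ hxy.1)
        simp [hx, hxd, hxy]
    · intro x y hxy p g0 g2 g3
      simp only [adj_insert hbc hd2 hd3]
      by_cases hx : x = b
      · subst hx
        obtain rfl : y = c := hxy.right_unique hbc
        rcases lt_or_ge p.1 s.X with hp | hp
        · exact .inl (h.sees_discharge hxy g0 hp g2 g3)
        · right
          have hp' := EReal.coe_le_coe_iff.mpr hp
          rcases lt_or_ge (p.2 : EReal) (S.bd d) with hp2 | hp2
          · refine ⟨x, d, .inl ⟨rfl, rfl⟩, ?_, g2, hp2⟩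
            rwa [Function.update_of_ne (by omega), Function.update_self]
          · refine ⟨d, y, .inr (.inl ⟨rfl, rfl⟩), ?_, hp2, g3⟩
            rwa [Function.update_self]
      · have hxd : x ≠ d := fun hxd => hdB (hxd ▸ hxy.1)
        refine .inr ⟨x, y, .inr (.inr ⟨hx, hxy⟩), ?_, g2, g3⟩
        rwa [Function.update_of_ne hxd, Function.update_of_ne hx]
    · rw [Function.update_of_ne (Ne.symm hdt), Function.update_of_ne (Ne.symm hbc4)]
      exact h.top_credit
    · simp only
      rw [hMd', Finset.sum_insert hdB, Function.update_self,
        Finset.sum_congr rfl fun x hx => Function.update_of_ne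
          (show x ≠ d from fun hxd => hdB (hxd ▸ hx)) _ _, sum_update hbc.1]
      linarith

/-- No current horizontal segment meets a vertical segment on the current line. -/
theorem Inv.between_eq_zero {s : Sweep} {P D cr u φ Xp} (h : S.Inv k s P D cr u φ Xp) {V : Fin n}
    (hV : S.xl V = S.xr V) (hVX : S.xl V = s.X) {b c : ℕ} (hb : S.lo V ≤ b) (hc : c ≤ S.hi V) :
    between s.H b c = 0 := by
  rw [between, Finset.card_eq_zero, Finset.filter_eq_empty_iff]
  rintro p hp ⟨h1, h2⟩
  obtain ⟨i, hi, h3, h4, h5⟩ := (h.live p).mp hp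
  have hhi := S.hi_lt V
  refine S.disj i V (fun hiV => ?_) ?_ ?_ ?_ ?_
  · subst hiV; exact h3.ne hV
  · rw [← hV, hVX]; exact h.processed i hi
  · rw [hVX]; exact h5
  · rw [← S.ht_lo, ← S.ht_hi, h4]; exact ht_le (by omega) (by omega)
  · rw [← S.ht_lo, ← S.ht_hi, ← lo_eq_hi h3, h4]; exact ht_le (by omega) (by omega)

/-- Both cells are free of current horizontal segments. If one of them owed a modem, the modem
located for it also lies in the merged cell, which continues in phase 1 and needs `4k`. The worst
case is two debtors, where `16k - 12k` remains. If neither owed one, the two credits of `4k` pay for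
a fresh cell in phase 0. Recording the number of the line in `lv` prevents the crossing segment from
being counted there again. -/
theorem Inv.merge {s : Sweep} {P D cr u φ Xp} (h : S.Inv k s P D cr u φ Xp) (hk : 0 < k)
    {V : Fin n} (hV : S.xl V = S.xr V) (hVX : S.xl V = s.X) {b c d : ℕ} (hbc : Adj s.B b c)
    (hcd : Adj s.B c d) (hb : S.lo V ≤ b) (hd : d ≤ S.hi V) :
    ∃ u' φ', S.Inv k (S.merge s b c d) P D cr u' φ' Xp := by
  obtain ⟨hbc1, hbc2, hbc3, hbc4⟩ := h.bd_lt_bd hbc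
  obtain ⟨hcd1, hcd2, hcd3, hcd4⟩ := h.bd_lt_bd hcd
  have hXpX : (Xp : EReal) < s.X := EReal.coe_lt_coe_iff.mpr (h.lt_m.trans h.m_lt)
  have hl := h.between_eq_zero hV hVX hb hd
  have hcb := (h.cell b c hbc).credit
  have hcc := (h.cell c d hcd).credit
  have hM1 := discharge_M (S := S) s b c
  have hM2 := discharge_M (S := S) (S.discharge s b c) c d
  rw [discharge_ph, hM1] at hM2
  have hle1 := le_discharge_M (S := S) s b c
  have hle2 := le_discharge_M (S := S) (S.discharge s b c) c d
  have hloc : ∀ j < s.M, (S.discharge (S.discharge s b c) c d).loc j = s.loc j := fun j hj => by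
    rw [discharge_loc _ _ _ (hj.trans_le hle1), discharge_loc _ _ _ hj]
  set e : ℤ := 6 * (k : ℤ) * ((S.discharge (S.discharge s b c) c d).M - s.M) with he
  -- This number is both the new phase and the new counter: a cell in phase 1 starts before the line
  -- and reserves the key of the line, one in phase 0 starts on it with nothing to count.
  set f := if s.ph b = 0 ∨ s.ph c = 0 then 1 else 0 with hf
  -- the modem that serves the merged cell
  have hmod : f = 1 → ∃ j < (S.discharge (S.discharge s b c) c d).M,
      ((S.discharge (S.discharge s b c) c d).loc j).1 = s.m ∧
      S.bd b < ((S.discharge (S.discharge s b c) c d).loc j).2 ∧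
      ((S.discharge (S.discharge s b c) c d).loc j).2 < S.bd d := by
    intro hf1
    have hor : s.ph b = 0 ∨ s.ph c = 0 := by
      by_contra hn
      rw [hf, if_neg hn] at hf1
      omega
    by_cases h0 : s.ph b = 0
    · obtain ⟨g1, g2⟩ := discharge_new (S := S) s b c h0
      have hm := bd_mid (S := S) hbc1 hbc2
      refine ⟨s.M, g1.trans_le hle2, ?_⟩
      rw [discharge_loc _ _ _ g1, g2]
      exact ⟨rfl, hm.1, hm.2.trans (bd_lt hcd1 hcd2)⟩
    · have hc0 : s.ph c = 0 := hor.resolve_left h0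
      obtain ⟨g1, g2⟩ := discharge_new (S := S) (S.discharge s b c) c d (by simpa using hc0)
      have hm := bd_mid (S := S) hcd1 hcd2
      refine ⟨_, g1, ?_⟩
      rw [g2]
      exact ⟨by simp, (bd_lt hbc1 hbc2).trans hm.1, hm.2⟩
  have hψ : (f = 1 → 4 * (k : ℤ) ≤ φ b + φ c - e) ∧ (f = 0 → 8 * (k : ℤ) ≤ φ b + φ c - e) := by
    clear hmod
    have hb4 := hcb.four_mul_le
    have hc4 := hcc.four_mul_le
    have hb8 : s.ph b = 0 → 8 * (k : ℤ) ≤ φ b := fun h0 =>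
      CreditOK.eight_mul_le_of_zero (h0 ▸ hcb)
    have hc8 : s.ph c = 0 → 8 * (k : ℤ) ≤ φ c := fun h0 =>
      CreditOK.eight_mul_le_of_zero (h0 ▸ hcc)
    rw [hM2] at he
    by_cases h0 : s.ph b = 0 <;> by_cases h1 : s.ph c = 0 <;>
      simp only [h0, h1, if_true, if_false, or_true, true_or, or_self, forall_true_left] at hf he hb8 hc8 <;>
      push_cast at he <;> refine ⟨fun hf' => ?_, fun hf' => ?_⟩ <;>
      omega
  refine ⟨Function.update u b (if f = 1 then (Xp : EReal) else s.X),
    Function.update φ b (φ b + φ c - e), h.modify ?_ ?_ ?_ (by simp [Scene.merge])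
    (by simp [Scene.merge]) (by simp [Scene.merge]) (by simp [Scene.merge]) ?_ ?_ hloc ?_ ?_ ?_ ?_⟩
  · exact Finset.mem_erase.mpr ⟨by omega, h.zero_mem⟩
  · exact Finset.mem_erase.mpr ⟨Ne.symm hcd4, h.top_mem⟩
  · exact fun x hx => h.le_top x (Finset.mem_of_mem_erase hx)
  · intro x
    simp only [Scene.merge, discharge_g, Function.update_apply]
    split_ifs
    · exact le_rfl
    · exact h.lv_le x
  · exact hle1.trans hle2
  · intro x y hxy
    simp only [Scene.merge] at hxy
    rw [adj_erase hbc hcd] at hxy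
    rcases hxy with ⟨rfl, rfl⟩ | ⟨hx, hxc, hxy⟩
    · right
      rw [Function.update_self, Function.update_self]
      by_cases hf1 : f = 1
      · rw [if_pos hf1]
        refine h.cellOK_paired _ (by simp [Scene.merge]) (by simp [Scene.merge]) ?_ ?_ (by omega) ?_
          (hmod hf1)
        · simp only [Scene.merge, Function.update_self]; exact hf1
        · simp only [Scene.merge, Function.update_self, hl]; exact hf1
        · rw [hl]
          exact CreditOK.paired (hψ.1 hf1)
      · have hf0 : f = 0 := by
          rw [hf] at hf1 ⊢
          split_ifs at hf1 ⊢ <;> simp_all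
        rw [if_neg hf1]
        refine h.cellOK_fresh _ hk (by simp [Scene.merge]) (by simp [Scene.merge]) ?_ ?_ (by omega)
          (hψ.2 hf0)
        · simp only [Scene.merge, Function.update_self]; exact hf0
        · simp only [Scene.merge, Function.update_self, hl]; exact hf0
    · left
      simp [Scene.merge, hx, hxy]
  · have hXle : (if f = 1 then (Xp : EReal) else s.X) ≤ s.X := by
      split_ifs
      · exact hXpX.le
      · exact le_rfl
    have key : ∀ p : Plane, s.X ≤ p.1 → S.bd b ≤ p.2 → p.2 < S.bd d →
        ∃ x y, Adj (S.merge s b c d).B x y ∧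
          Function.update u b (if f = 1 then (Xp : EReal) else s.X) x ≤ p.1 ∧
          S.bd x ≤ p.2 ∧ p.2 < S.bd y := by
      intro p hp g2 g3
      refine ⟨b, d, ?_, ?_, g2, g3⟩
      · simp only [Scene.merge]
        rw [adj_erase hbc hcd]
        exact .inl ⟨rfl, rfl⟩
      · rw [Function.update_self]
        exact hXle.trans (EReal.coe_le_coe_iff.mpr hp)
    intro x y hxy p g0 g2 g3
    by_cases hx : x = b
    · subst hx
      obtain rfl : y = c := hxy.right_unique hbc
      rcases lt_or_ge p.1 s.X with hp | hp
      · left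
        obtain ⟨j, hj, hs⟩ := h.sees_discharge hxy g0 hp g2 g3
        exact ⟨j, hj.trans_le hle2, by
          simp only [Scene.merge]; rw [discharge_loc _ _ _ hj]; exact hs⟩
      · exact .inr (key p hp g2 (g3.trans (bd_lt hcd1 hcd2)))
    by_cases hxc : x = c
    · subst hxc
      obtain rfl : y = d := hxy.right_unique hcd
      rcases lt_or_ge p.1 s.X with hp | hp
      · left
        by_cases h0 : s.ph x = 0
        · obtain ⟨k1, k2⟩ := discharge_new (S := S) (S.discharge s b x) x y (by simpa using h0)
          have hm := bd_mid (S := S) hcd1 hcd2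
          refine ⟨_, k1, ?_⟩
          simp only [Scene.merge]
          rw [k2, discharge_m]
          exact h.sees_of_phase_zero hxy hm.1 hm.2 g0 hp g2 g3
        · obtain ⟨j, hj, hs⟩ := h.sees_of_phase_one hxy ((h.ph_le hxy).resolve_left h0) g0 hp g2 g3
          refine ⟨j, hj.trans_le (hle1.trans hle2), ?_⟩
          simp only [Scene.merge]
          rw [hloc j hj]
          exact hs
      · exact .inr (key p hp ((bd_lt hbc1 hbc2).le.trans g2) g3)
    · refine .inr ⟨x, y, ?_, by rwa [Function.update_of_ne hx], g2, g3⟩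
      simp only [Scene.merge]
      rw [adj_erase hbc hcd]
      exact .inr ⟨hx, hxc, hxy⟩
  · rw [Function.update_of_ne (Ne.symm hbc4)]; exact h.top_credit
  · have h1 := Finset.add_sum_erase s.B φ hcd.1
    have h2 := sum_update (B := s.B.erase c) (φ := φ) (b := b)
      (Finset.mem_erase.mpr ⟨by omega, hbc.1⟩) (φ b + φ c - e)
    simp only [Scene.merge]
    rw [h2]
    linarith

end Scene

/-! ### Processing segments, moving the line, beginning and end -/

namespace Scene

variable {n : ℕ} {S : Scene n} {k : ℕ}

/-- Count the vertical line in the cell with lower boundary `b` unless this was done before. -/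
def bump (s : Sweep) (b : ℕ) : Sweep :=
  if s.lv b = s.g then s
  else { s with cnt := Function.update s.cnt b (s.cnt b + 1), lv := Function.update s.lv b s.g }

section bump

variable (s : Sweep) (b x : ℕ)

@[simp] theorem bump_B : (bump s b).B = s.B := by unfold bump; split_ifs <;> rfl
@[simp] theorem bump_H : (bump s b).H = s.H := by unfold bump; split_ifs <;> rfl
@[simp] theorem bump_ph : (bump s b).ph = s.ph := by unfold bump; split_ifs <;> rfl
@[simp] theorem bump_M : (bump s b).M = s.M := by unfold bump; split_ifs <;> rfl
@[simp] theorem bump_loc : (bump s b).loc = s.loc := by unfold bump; split_ifs <;> rfl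
@[simp] theorem bump_g : (bump s b).g = s.g := by unfold bump; split_ifs <;> rfl
@[simp] theorem bump_m : (bump s b).m = s.m := by unfold bump; split_ifs <;> rfl
@[simp] theorem bump_X : (bump s b).X = s.X := by unfold bump; split_ifs <;> rfl

theorem bump_lv : (bump s b).lv x = if x = b then s.g else s.lv x := by
  unfold bump
  split_ifs with h1 h2 h2
  · rw [h2, h1]
  · rfl
  · simp [h2]
  · simp [h2]

theorem bump_cnt :
    (bump s b).cnt x = if x = b ∧ s.lv x ≠ s.g then s.cnt x + 1 else s.cnt x := by
  unfold bump
  by_cases hx : x = b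
  · subst hx; by_cases h : s.lv x = s.g <;> simp [h]
  · by_cases h : s.lv b = s.g <;> simp [h, hx]

end bump

theorem bump₃_lv (s : Sweep) (b c d x : ℕ) : (bump (bump (bump s b) c) d).lv x =
    if x = b ∨ x = c ∨ x = d then s.g else s.lv x := by
  simp only [bump_lv, bump_g]
  split_ifs <;> simp_all

/-- The three boundaries may coincide. The test of `lv` in `bump` ensures that a cell is counted at
most once per vertical line all the same. -/
theorem bump₃_cnt (s : Sweep) (b c d x : ℕ) : (bump (bump (bump s b) c) d).cnt x =
    if (x = b ∨ x = c ∨ x = d) ∧ s.lv x ≠ s.g then s.cnt x + 1 else s.cnt x := by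
  simp only [bump_lv, bump_g, bump_cnt]
  by_cases h1 : x = b <;> by_cases h2 : x = c <;> by_cases h3 : x = d <;>
    by_cases h4 : s.lv x = s.g <;> simp [h1, h2, h3, h4] <;> simp_all

section CellOK

variable {s s' : Sweep} {P : Set (Fin n)} {D D' : Finset ℕ} {u : EReal} {φ φ' : ℤ} {Xp : ℝ}
  {b c : ℕ} {i : Fin n}

theorem hits_insert (h : ¬ (b < S.hi i ∧ S.lo i < c)) :
    S.hits (insert i P) u b c = S.hits P u b c := by
  ext j
  simp only [hits, Set.mem_insert_iff, Set.mem_ofPred_eq]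
  constructor
  · rintro ⟨rfl | h1, h2, h3⟩
    · exact absurd h3 h
    · exact ⟨h1, h2, h3⟩
  · rintro ⟨h1, h2⟩
    exact ⟨.inr h1, h2⟩

/-- The new segment begins on the current line, so it does not affect what a modem placed before the
line has to see. -/
theorem old_insert (hi : S.xl i = s.X) : {j | j ∈ S.hits (insert i P) u b c ∧ S.xl j < s.X} =
    {j | j ∈ S.hits P u b c ∧ S.xl j < s.X} := by
  ext j
  simp only [hits, Set.mem_insert_iff, Set.mem_ofPred_eq]
  constructor
  · rintro ⟨⟨rfl | h1, h2⟩, h3⟩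
    · exact absurd hi h3.ne
    · exact ⟨⟨h1, h2⟩, h3⟩
  · rintro ⟨⟨h1, h2⟩, h3⟩
    exact ⟨⟨.inr h1, h2⟩, h3⟩

/-- A new segment does not meet the cell, or its key is already accounted for. -/
theorem CellOK.insert_of_keys (h : S.CellOK k s P D u φ Xp b c) (hiX : S.xl i = s.X)
    (hkeys : S.keys s' (insert i P) u b c ⊆ S.keys s P u b c)
    (hH : between s'.H b c = between s.H b c) (hcnt : s'.cnt b = s.cnt b) (hph : s'.ph b = s.ph b)
    (hM : s'.M = s.M) (hloc : s'.loc = s.loc) (hX : s'.X = s.X) (hD : b ∈ D → b ∈ D')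
    (hφ : φ ≤ φ') : S.CellOK k s' (insert i P) D' u φ' Xp b c where
  credit := by rw [hH, hcnt, hph]; exact h.credit.mono le_rfl hφ
  live_le := by rw [hH, hcnt]; exact h.live_le
  small := by rw [hcnt]; exact h.small.imp_right fun h => ⟨hD h.1, h.2⟩
  keys_le := by
    rw [hcnt]
    exact (Set.ncard_le_ncard hkeys (finite_keys _ _ _ _ _)).trans h.keys_le
  old_le := by rw [hX, old_insert hiX]; exact h.old_le
  start := by rw [hX]; exact h.start
  modem := by rw [hph, hX, hM, hloc]; exact h.modem

/-- A new segment meets the cell. -/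
theorem CellOK.insert_of_succ (h : S.CellOK k s P D u φ Xp b c) (hiX : S.xl i = s.X)
    (hkeys : S.keys s' (insert i P) u b c ⊆ insert (S.key i) (S.keys s P u b c))
    (hcnt : s'.cnt b = s.cnt b + 1) (hph : s'.ph b = s.ph b)
    (hM : s'.M = s.M) (hloc : s'.loc = s.loc) (hX : s'.X = s.X) (hk : s.cnt b ≤ k) (hD : b ∈ D')
    (hl : between s'.H b c ≤ s.cnt b + 1)
    (hφ : CreditOK k (s.ph b) (s.cnt b + 1) (between s'.H b c) φ') :
    S.CellOK k s' (insert i P) D' u φ' Xp b c where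
  credit := by rw [hcnt, hph]; exact hφ
  live_le := by rw [hcnt]; exact hl
  small := by
    rw [hcnt]
    rcases hk.lt_or_eq with hk | hk
    · exact .inl hk
    · exact .inr ⟨hD, by rw [hk]⟩
  keys_le := by
    rw [hcnt]
    exact (Set.ncard_le_ncard hkeys ((finite_keys _ _ _ _ _).insert _)).trans
      ((Set.ncard_insert_le _ _).trans (Nat.add_le_add_right h.keys_le 1))
  old_le := by rw [hX, old_insert hiX]; exact h.old_le
  start := by rw [hX]; exact h.start
  modem := by rw [hph, hX, hM, hloc]; exact h.modem

/-- Setting the marker `lv` adds the key of the current line to `keys`. This is harmless when the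
new segment has that very key. -/
theorem keys_insert_subset (hg : s'.g = s.g) (hX : s'.X = s.X)
    (hlv : s'.lv b = s.lv b ∨ S.key i = .inr s.X) :
    S.keys s' (insert i P) u b c ⊆ insert (S.key i) (S.keys s P u b c) := by
  rintro κ (⟨j, ⟨rfl | hj, hj'⟩, rfl⟩ | ⟨rfl, h1, h2⟩)
  · exact .inl rfl
  · exact .inr (.inl ⟨j, ⟨hj, hj'⟩, rfl⟩)
  · rw [hX] at h2 ⊢
    rcases hlv with h | h
    · rw [h, hg] at h1
      exact .inr (.inr ⟨rfl, h1, h2⟩)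
    · exact .inl h.symm

end CellOK

theorem key_vertical {i : Fin n} (h : S.xl i = S.xr i) : S.key i = .inr (S.xl i) := by
  rw [key, if_pos h]

/-- A new horizontal segment does not lie at the height of a current one. -/
theorem Inv.lo_notMem {s : Sweep} {P D cr u φ Xp} (h : S.Inv k s P D cr u φ Xp) {i : Fin n}
    (hi : i ∉ P) (hiX : S.xl i = s.X) (hh : S.xl i < S.xr i) : S.lo i ∉ s.H := by
  intro hp
  obtain ⟨j, hj, h1, h2, h3⟩ := (h.live _).mp hp
  have hy : S.yl j = S.yl i := by rw [← S.ht_lo, ← S.ht_lo, h2]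
  refine S.disj i j (fun hij => hi (hij ▸ hj)) (by rw [hiX]; exact h3)
    ((h.processed j hj).trans (by rw [← hiX]; exact hh.le)) ?_ ?_
  · rw [← hy]; exact yl_le_yr j
  · rw [hy]; exact yl_le_yr i

theorem Inv.live_insert {s : Sweep} {P D cr u φ Xp} (h : S.Inv k s P D cr u φ Xp) {i : Fin n}
    (hiX : S.xl i = s.X) (hh : S.xl i < S.xr i) (p : ℕ) : p ∈ insert (S.lo i) s.H ↔
      ∃ j ∈ insert i P, S.xl j < S.xr j ∧ S.lo j = p ∧ s.X ≤ S.xr j := by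
  rw [Finset.mem_insert, h.live]
  constructor
  · rintro (rfl | ⟨j, hj, h1⟩)
    · exact ⟨i, .inl rfl, hh, rfl, by rw [← hiX]; exact hh.le⟩
    · exact ⟨j, .inr hj, h1⟩
  · rintro ⟨j, rfl | hj, h1, h2, h3⟩
    · exact .inl h2.symm
    · exact .inr ⟨j, hj, h1, h2, h3⟩

/-- A horizontal segment begins on a boundary. -/
theorem Inv.insert_boundary {s : Sweep} {P D cr u φ Xp} (h : S.Inv k s P D cr u φ Xp) {i : Fin n}
    (hiX : S.xl i = s.X) (hh : S.xl i < S.xr i) (hB : S.lo i ∈ s.B) :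
    S.Inv k { s with H := insert (S.lo i) s.H } (insert i P) D (cr + 1) u φ Xp where
  zero_mem := h.zero_mem
  top_mem := h.top_mem
  le_top := h.le_top
  processed := by
    rintro j (rfl | hj)
    · exact hiX.le
    · exact h.processed j hj
  unprocessed := fun j hj => h.unprocessed j fun hj' => hj (.inr hj')
  lt_m := h.lt_m
  m_lt := h.m_lt
  gap_l := h.gap_l
  gap_r := h.gap_r
  live := h.live_insert hiX hh
  lv_le := h.lv_le
  cell := by
    intro b c hbc
    -- No boundary lies inside a cell, and a segment on a boundary obstructs no sightline strictly
    -- inside a cell. No cell is hit and the `36` units remain unspent.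
    have hn : ¬ (b < S.lo i ∧ S.lo i < c) := fun hn => by
      have := hbc.2.2.2 _ hB; omega
    refine (h.cell b c hbc).insert_of_keys hiX ?_ (between_insert_of_notMem hn) rfl rfl rfl rfl rfl
      id le_rfl
    unfold keys
    rw [hits_insert (by rwa [← lo_eq_hi hh])]
  cover := h.cover
  top_credit := h.top_credit
  total := by have := h.total; push_cast; linarith

/-- A horizontal segment begins in the interior of a cell. -/
theorem Inv.insert_interior {s : Sweep} {P cr u φ Xp} (h : S.Inv k s P ∅ cr u φ Xp) {i : Fin n}
    (hi : i ∉ P) (hiX : S.xl i = s.X) (hh : S.xl i < S.xr i) {b c : ℕ} (hbc : Adj s.B b c)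
    (hb : b < S.lo i) (hc : S.lo i < c) :
    ∃ φ', S.Inv k
      { s with H := insert (S.lo i) s.H, cnt := Function.update s.cnt b (s.cnt b + 1) }
      (insert i P) {b} (cr + 1) u φ' Xp := by
  have hbt := (h.bd_lt_bd hbc).2.2.2
  refine ⟨Function.update φ b (φ b + 36), h.zero_mem, h.top_mem, h.le_top, ?_,
    fun j hj => h.unprocessed j fun hj' => hj (.inr hj'), h.lt_m, h.m_lt, h.gap_l, h.gap_r,
    h.live_insert hiX hh, h.lv_le, ?_, h.cover, ?_, ?_⟩
  · rintro j (rfl | hj)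
    · exact hiX.le
    · exact h.processed j hj
  · intro x y hxy
    by_cases hx : x = b
    · subst hx
      obtain rfl : y = c := hxy.right_unique hbc
      have hcell := h.cell x y hxy
      have hbet := between_insert_of_mem (h.lo_notMem hi hiX hh) hb hc
      rw [Function.update_self]
      refine hcell.insert_of_succ hiX (keys_insert_subset rfl rfl (.inl rfl))
        (by simp only [Function.update_self]) rfl rfl rfl rfl ?_ (by simp) ?_ ?_
      · exact hcell.small.resolve_right (by simp)
      · simp only [hbet]; exact Nat.add_le_add_right hcell.live_le 1
      · simp only [hbet]; exact hcell.credit.horizontal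
    · have hn : ¬ (x < S.lo i ∧ S.lo i < y) := fun hn => by
        have a1 := hxy.2.2.2 b hbc.1
        have a2 := hxy.2.2.2 c hbc.2.1
        have a3 := hbc.2.2.2 x hxy.1
        omega
      refine (h.cell x y hxy).insert_of_keys hiX ?_ (between_insert_of_notMem hn)
        (by simp only [Function.update_of_ne hx]) rfl rfl rfl rfl (by simp)
        (by rw [Function.update_of_ne hx])
      unfold keys
      rw [hits_insert (by rwa [← lo_eq_hi hh])]
  · rw [Function.update_of_ne (Ne.symm hbt)]; exact h.top_credit
  · have h1 := h.total
    have h2 := sum_update (φ := φ) hbc.1 (φ b + 36)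
    simp only
    rw [h2]
    push_cast
    linarith

/-- A vertical segment is processed: its ends lie in the cells of `b₁` and `b₂`, and it crosses at
most one further cell, that of `z`, that is not yet accounted for. -/
theorem Inv.insert_vertical {s : Sweep} {P cr u φ Xp} (h : S.Inv k s P ∅ cr u φ Xp) {V : Fin n}
    (hVX : S.xl V = s.X) (hV : S.xl V = S.xr V) {z b₁ b₂ : ℕ}
    (hz : z = b₁ ∨ ∃ c, Adj s.B z c ∧ S.lo V ≤ z ∧ c ≤ S.hi V)
    (hhit : ∀ x y, Adj s.B x y → x < S.hi V → S.lo V < y →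
      x = z ∨ x = b₁ ∨ x = b₂ ∨ s.lv x = s.g) :
    ∃ φ', S.Inv k (bump (bump (bump s z) b₁) b₂) (insert V P) {z, b₁, b₂} (cr + 1) u φ' Xp := by
  -- The three amounts add up to `36`; a cell named twice just receives more than it needs.
  refine ⟨fun x => φ x + ((if x = b₁ then 14 else 0) + (if x = b₂ then 14 else 0) +
    (if x = z then 8 else 0)), by simpa using h.zero_mem, by simpa using h.top_mem,
    by simpa using h.le_top, ?_, ?_, by simpa using h.lt_m, by simpa using h.m_lt,
    by simpa using h.gap_l, by simpa using h.gap_r, ?_, ?_, ?_, by simpa using h.cover, ?_, ?_⟩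
  · simp only [bump_X]
    rintro j (rfl | hj)
    · exact hVX.le
    · exact h.processed j hj
  · simp only [bump_X]
    exact fun j hj => h.unprocessed j fun hj' => hj (.inr hj')
  · intro p
    simp only [bump_X, bump_H]
    rw [h.live]
    constructor
    · rintro ⟨j, hj, h1⟩; exact ⟨j, .inr hj, h1⟩
    · rintro ⟨j, rfl | hj, h1, h2⟩
      · exact absurd hV h1.ne
      · exact ⟨j, hj, h1, h2⟩
  · intro b
    rw [bump₃_lv]
    simp only [bump_g]
    split_ifs
    · exact le_rfl
    · exact h.lv_le b
  · intro x y hxy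
    simp only [bump_B] at hxy
    have hcell := h.cell x y hxy
    have hsmall := hcell.small.resolve_right (by simp)
    have hnn : (0 : ℤ) ≤ (if x = b₁ then 14 else 0) + (if x = b₂ then 14 else 0) +
        (if x = z then 8 else 0) := by split_ifs <;> norm_num
    -- In a marked cell the key of the current line is included in `keys` already, as far as the
    -- cell extends to the left of the line.
    by_cases hlv : s.lv x = s.g
    · refine hcell.insert_of_keys hVX ?_ (by simp) (by rw [bump₃_cnt]; simp [hlv]) (by simp)
        (by simp) (by simp) (by simp) (by simp) (by linarith)
      rintro κ (⟨j, ⟨rfl | hj, hj'⟩, rfl⟩ | ⟨rfl, h1, h2⟩)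
      · refine .inr ⟨by rw [key_vertical hV, hVX], hlv, ?_⟩
        rw [← hVX, hV]; exact hj'.1
      · exact .inl ⟨j, ⟨hj, hj'⟩, rfl⟩
      · simp only [bump_X] at h2 ⊢
        exact .inr ⟨rfl, hlv, h2⟩
    · by_cases hx : x = z ∨ x = b₁ ∨ x = b₂
      · refine hcell.insert_of_succ hVX (keys_insert_subset (by simp) (by simp)
          (.inr (by rw [key_vertical hV, hVX]))) (by rw [bump₃_cnt]; simp [hlv, hx]) (by simp)
          (by simp) (by simp) (by simp) hsmall (by simpa using hx) ?_ ?_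
        · have := hcell.live_le
          simp only [bump_H]
          omega
        · simp only [bump_H]
          by_cases hx' : x = b₁ ∨ x = b₂
          · refine hcell.credit.verticalEnd.mono le_rfl ?_
            split_ifs <;> omega
          · have hxz : x = z := by tauto
            subst hxz
            -- Only the crossed cell is left. The segment passes through all of it, so no current
            -- horizontal segment lies inside and the cheaper rule applies.
            rcases hz with hz | ⟨c, hzc, h1, h2⟩
            · exact absurd (.inl hz) hx'
            · obtain rfl : c = y := hzc.right_unique hxy
              have h0 := h.between_eq_zero hV hVX h1 h2
              have hcr := hcell.credit
              rw [h0] at hcr ⊢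
              refine (hcr.crossing hsmall).mono le_rfl ?_
              push Not at hx'
              simp [hx'.1, hx'.2]
      · refine hcell.insert_of_keys hVX ?_ (by simp) (by rw [bump₃_cnt]; simp [hx]) (by simp)
          (by simp) (by simp) (by simp) (by simp) (by linarith)
        unfold keys
        rw [hits_insert (fun hh => by
          have := hhit x y hxy hh.1 hh.2
          tauto), bump₃_lv, if_neg hx]
        simp
  · have := h.top_credit
    have hnn : (0 : ℤ) ≤ (if S.top = b₁ then 14 else 0) + (if S.top = b₂ then 14 else 0) +
        (if S.top = z then 8 else 0) := by split_ifs <;> norm_num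
    linarith
  · have h1 := h.total
    simp only [bump_M, bump_B]
    rw [Finset.sum_add_distrib, Finset.sum_add_distrib, Finset.sum_add_distrib,
      Finset.sum_ite_eq', Finset.sum_ite_eq', Finset.sum_ite_eq']
    have a1 : (if b₁ ∈ s.B then (14 : ℤ) else 0) ≤ 14 := by split_ifs <;> norm_num
    have a2 : (if b₂ ∈ s.B then (14 : ℤ) else 0) ≤ 14 := by split_ifs <;> norm_num
    have a3 : (if z ∈ s.B then (8 : ℤ) else 0) ≤ 8 := by split_ifs <;> norm_num
    push_cast
    linarith

/-- The sweep moves on to the next vertical line. -/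
theorem Inv.advance {s : Sweep} {P cr u φ Xp} (h : S.Inv k s P ∅ cr u φ Xp) {X' m' : ℝ}
    {H' : Finset ℕ} (hm : s.X < m') (hm' : m' < X') (hun : ∀ i ∉ P, X' ≤ S.xl i)
    (hgl : ∀ i, S.xl i ≤ s.X ∨ X' ≤ S.xl i) (hgr : ∀ i, S.xr i ≤ s.X ∨ X' ≤ S.xr i)
    (hlive : ∀ p, p ∈ H' ↔ ∃ i ∈ P, S.xl i < S.xr i ∧ S.lo i = p ∧ X' ≤ S.xr i) :
    S.Inv k { s with H := H', g := s.g + 1, m := m', X := X' } P ∅ cr u φ s.X where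
  zero_mem := h.zero_mem
  top_mem := h.top_mem
  le_top := h.le_top
  processed := fun i hi => (h.processed i hi).trans (hm.trans hm').le
  unprocessed := hun
  lt_m := hm
  m_lt := hm'
  gap_l := hgl
  gap_r := hgr
  live := hlive
  lv_le := fun b => (h.lv_le b).trans (Nat.le_succ _)
  cell := by
    intro b c hbc
    have hcell := h.cell b c hbc
    have hsub : H' ⊆ s.H := by
      intro p hp
      obtain ⟨i, h1, h2, h3, h4⟩ := (hlive p).mp hp
      exact (h.live p).mpr ⟨i, h1, h2, h3, (hm.trans hm').le.trans h4⟩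
    have hbet := between_mono hsub b c
    have hsmall := hcell.small.resolve_right (by simp)
    refine ⟨hcell.credit.mono hbet le_rfl, hbet.trans hcell.live_le, .inl hsmall, ?_, ?_, ?_, ?_⟩
    · refine (Set.ncard_le_ncard ?_ (finite_keys _ _ _ _ _)).trans hcell.keys_le
      rintro κ (h1 | ⟨-, h1, -⟩)
      · exact .inl h1
      -- The number of the new line exceeds all markers, so no cell reserves its key yet.
      · have := h.lv_le b
        simp only at h1
        omega
    · refine (Set.ncard_le_ncard ?_ (finite_keys _ _ _ _ _)).trans (hcell.keys_le.trans hsmall)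
      rintro _ ⟨i, hi, rfl⟩
      exact .inl ⟨i, hi.1, rfl⟩
    · right
      rcases hcell.start with h1 | h1
      · exact h1.le
      · exact h1.trans (EReal.coe_le_coe_iff.mpr (h.lt_m.trans h.m_lt).le)
    · intro hph
      obtain ⟨j, hj, h1, h2, h3⟩ := hcell.modem hph
      exact ⟨j, hj, h1, h2.trans (hm.trans hm'), h3⟩
  cover := h.cover
  top_credit := h.top_credit
  total := h.total

/-- The initial state. -/
theorem inv_init {s : Sweep} {Xp : ℝ} (hB : s.B = {0, S.top}) (hH : s.H = ∅)
    (hcnt : s.cnt 0 = 0) (hph : s.ph 0 = 0) (hlv : ∀ b, s.lv b = 0) (hM : s.M = 0) (hg : 0 < s.g)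
    (hm : Xp < s.m) (hm' : s.m < s.X) (hX : ∀ i, s.X ≤ S.xl i) :
    ∃ u φ, S.Inv k s ∅ ∅ 0 u φ Xp := by
  have htop := S.top_pos
  -- Initially the whole plane is one cell in phase 0, which accounts for the summand `8k` in
  -- `total`.
  refine ⟨fun _ => ⊥, Function.update 0 0 (8 * (k : ℤ)), by simp [hB], by simp [hB], ?_, by simp,
    fun i _ => hX i, hm, hm', fun i => .inr (hX i), fun i => .inr ((hX i).trans (xl_le_xr i)), ?_,
    fun b => by rw [hlv]; omega, ?_, ?_, ?_, ?_⟩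
  · intro b hb
    rw [hB] at hb
    simp only [Finset.mem_insert, Finset.mem_singleton] at hb
    omega
  · intro p
    simp [hH]
  · intro b c hbc
    have hb : b = 0 := by
      have h1 := hbc.1
      have h2 := hbc.2.1
      have h3 := hbc.2.2.1
      rw [hB] at h1 h2
      simp only [Finset.mem_insert, Finset.mem_singleton] at h1 h2
      omega
    subst hb
    rw [Function.update_self]
    have h0 : between s.H 0 c = 0 := by simp [between, hH]
    refine ⟨?_, by rw [h0]; omega, .inl (by rw [hcnt]; omega), ?_, ?_, .inr bot_le,
      by rw [hph]; intro h; omega⟩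
    · rw [h0, hph, hcnt]
      exact CreditOK.fresh (by omega) le_rfl
    · rw [hcnt, Nat.le_zero, Set.ncard_eq_zero (finite_keys _ _ _ _ _)]
      ext κ
      simp only [keys, hits, Set.mem_empty_iff_false, false_and, Set.mem_union, iff_false, hlv]
      rintro (⟨i, hi, -⟩ | ⟨-, h1, -⟩)
      · exact hi
      · omega
    · simp [hits]
  · intro p
    rcases lt_or_ge (p.2 : EReal) (S.bd S.top) with h | h
    · refine .inr ⟨0, S.top, ⟨by simp [hB], by simp [hB], htop, fun x hx => ?_⟩, bot_le, ?_, h⟩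
      · rw [hB] at hx
        simp only [Finset.mem_insert, Finset.mem_singleton] at hx
        omega
      · simp [bd]
    · rw [bd, if_neg (by omega), if_pos le_rfl] at h
      exact absurd (EReal.coe_lt_top _) (not_lt.mpr h)
  · rw [Function.update_of_ne (by omega)]
    rfl
  · rw [hM, hB, Finset.sum_pair (by omega), Function.update_self, Function.update_of_ne (by omega)]
    simp

/-- When all segments are processed, a cell is illuminated by its modem, or by a modem to the right
of all segments. -/
theorem Inv.sees_final {s : Sweep} {cr u φ Xp} (h : S.Inv k s Set.univ ∅ cr u φ Xp) {b c : ℕ}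
    (hbc : Adj s.B b c) {p : Plane} (h0 : u b ≤ p.1) (h2 : S.bd b ≤ p.2) (h3 : p.2 < S.bd c) :
    (s.ph b = 1 → ∃ j < s.M, S.Sees k (s.loc j) p) ∧
      S.Sees k (s.X + 1, (S.ht b + S.ht c) / 2) p := by
  obtain ⟨hbc1, hbc2, hbc3, hbc4⟩ := h.bd_lt_bd hbc
  have hcell := h.cell b c hbc
  have hsmall := hcell.small.resolve_right (by simp)
  -- Any abscissa beyond both the point and the modem would do, since no segment is left
  -- unprocessed.
  set W := max p.1 (s.X + 1) + 1 with hW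
  have hW1 : p.1 < W := lt_of_le_of_lt (le_max_left _ _) (lt_add_one _)
  have hW2 : s.X + 1 < W := lt_of_le_of_lt (le_max_right _ _) (lt_add_one _)
  have hk : (S.key '' {i | i ∈ S.hits Set.univ (u b) b c ∧ S.xl i < W}).ncard ≤ k := by
    refine (Set.ncard_le_ncard ?_ (finite_keys _ _ _ _ _)).trans (hcell.keys_le.trans hsmall)
    rintro _ ⟨i, hi, rfl⟩
    exact .inl ⟨i, hi.1, rfl⟩
  have hunp : ∀ i, i ∉ (Set.univ : Set (Fin n)) → W ≤ S.xl i := fun i hi => absurd trivial hi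
  have huX : u b ≤ s.X := by
    rcases hcell.start with h1 | h1
    · exact h1.le
    · exact h1.trans (EReal.coe_le_coe_iff.mpr (h.lt_m.trans h.m_lt).le)
  constructor
  · intro hph
    obtain ⟨j, hj, g1, g2, g3, g4, g5⟩ := hcell.modem hph
    exact ⟨j, hj, sees_of_keys hbc3 hunp hk h0 hW1 h2 h3 g1 (by linarith) g4 g5 g3⟩
  · have hm := bd_mid (S := S) hbc1 hbc2
    refine sees_of_keys hbc3 hunp hk h0 hW1 h2 h3 ?_ hW2 hm.1 hm.2 fun i _ he => ?_
    · exact huX.trans_lt (EReal.coe_lt_coe_iff.mpr (lt_add_one _))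
    · have := h.processed i trivial
      simp only at he
      linarith

end Scene

/-! ### Representation of the sweep in storage; settling by machine -/

namespace RealRAM

/-- Amortised rule for loops; `I σ p` means that the invariant holds in the state `σ` with the
potential `p`. -/
theorem Wp.loop_potential {b : Test} {P : Program} (I : State → ℕ → Prop)
    (hbody : ∀ σ p, I σ p → b.Holds σ →
      Wp P σ fun τ t => ∃ p', I τ p' ∧ p' + t + (b.cost + 1) ≤ p)
    {σ : State} {p : ℕ} (hσ : I σ p) {Q : State → ℕ → Prop}
    (hQ : ∀ τ t p', I τ p' → ¬ b.Holds τ → p' + t ≤ p + (b.cost + 1) → Q τ t) :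
    Wp (.loop b P) σ Q := by
  suffices H : ∀ p σ, I σ p →
      Wp (.loop b P) σ fun τ t => ∃ p', I τ p' ∧ ¬ b.Holds τ ∧ p' + t ≤ p + (b.cost + 1) from
    (H _ σ hσ).mono fun τ t ⟨p', h1, h2, h3⟩ => hQ τ t p' h1 h2 h3
  intro p
  induction p using Nat.strong_induction_on with
  | _ p ih =>
    intro σ hσ
    by_cases hb : b.Holds σ
    · obtain ⟨τ, s, h1, p', h2, h3⟩ := hbody σ p hσ hb
      obtain ⟨υ, t, h4, p'', h5, h6, h7⟩ := ih p' (by omega) τ h2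
      exact ⟨υ, _, .loop_true hb h1 h4, p'', h5, h6, by omega⟩
    · exact ⟨σ, _, .loop_false hb, p, hσ, hb, le_rfl⟩

/-- The storage `σ` represents the state `s` of the sweep. -/
structure Rep {n : ℕ} (S : Scene n) (k L : ℕ) (σ : State) (s : Sweep) : Prop where
  size : σ.int 1 0 = 2 ^ L
  quota : σ.int 0 1 = k
  B : StoresSet L (σ.int 15) s.B
  H : StoresSet L (σ.int 16) s.H
  cnt : σ.int 17 = s.cnt
  ph : σ.int 18 = s.ph
  lv : σ.int 19 = s.lv
  M : σ.int 20 0 = s.M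
  g : σ.int 21 0 = s.g
  loc : ∀ j < s.M, (σ.real 0 j, σ.real 1 j) = s.loc j
  ht : ∀ p ≤ S.top, σ.real 6 p = S.ht p
  X : σ.real 7 0 = s.X
  m : σ.real 8 0 = s.m
  top_lt : S.top < 2 ^ L

variable {n : ℕ} {S : Scene n} {k L : ℕ} {s : Sweep} {σ τ υ : State} {b c d : ℕ}

/-- Of the integer arrays only `0`, `1` and `15` to `21` enter the representation, so the others may
be overwritten freely as registers or scratch space. -/
theorem Rep.congr (h : Rep S k L σ s) (hi : ∀ x < 22, x < 2 ∨ 14 < x → τ.int x = σ.int x) (hr : τ.real = σ.real) :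
    Rep S k L τ s := by
  obtain ⟨h1, h2, h3, h4, h5, h6, h7, h8, h9, h10, h11, h12, h13, h14⟩ := h
  constructor <;> first | rw [hi _ (by norm_num) (by norm_num)]; assumption | rw [hr]; assumption | assumption

/-- The integer arrays below `m` and the real arrays above `1` are unchanged. -/
structure Keeps (m : ℕ) (σ τ : State) : Prop where
  int : ∀ x < m, τ.int x = σ.int x
  real : ∀ x, 2 ≤ x → τ.real x = σ.real x

theorem Keeps.trans {m : ℕ} (h : Keeps m σ τ) (h' : Keeps m τ υ) : Keeps m σ υ :=
  ⟨fun x hx => (h'.int x hx).trans (h.int x hx), fun x hx => (h'.real x hx).trans (h.real x hx)⟩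

theorem Keeps.mono {m m' : ℕ} (h : Keeps m σ τ) (hm : m' ≤ m) : Keeps m' σ τ :=
  ⟨fun x hx => h.int x (hx.trans_le hm), h.real⟩

/-- Locate the modem of the cell whose boundaries are held in registers `x` and `y` if it is still
due. -/
def discharge (x y : ℕ) : Program :=
  .branch (.intLt (.read 18 (reg x)) (.const 1))
    (.seq (.setReal 0 (reg 20) (rreg 8)) <|
     .seq (.setReal 1 (reg 20)
        (.div (.add (.read 6 (reg x)) (.read 6 (reg y))) (.const 2))) <|
     .set 20 (.add (reg 20) (.const 1)))
    .skip

theorem discharge_spec (h : Rep S k L σ s) {x y : ℕ} (hb : σ.int x 0 = b) (hc : σ.int y 0 = c)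
    (hbt : b ≤ S.top) (hct : c ≤ S.top) :
    Wp (discharge x y) σ fun τ t => t ≤ 100 ∧ (∀ a, a ≠ 20 → τ.int a = σ.int a) ∧
      (∀ a, 2 ≤ a → τ.real a = σ.real a) ∧ Rep S k L τ (S.discharge s b c) := by
  apply Wp.branch
  · intro h0
    simp only [Test.Holds, IntExpr.eval, h.ph, hb] at h0
    have h0' : s.ph b = 0 := by omega
    apply Wp.seq; apply Wp.setReal
    apply Wp.seq; apply Wp.setReal
    apply Wp.setInt
    refine ⟨by simp [Test.cost, IntExpr.cost, RealExpr.cost], fun a ha => by simp [ha],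
      fun a ha => ?_, ?_⟩
    · simp [show a ≠ 0 by omega, show a ≠ 1 by omega]
    · unfold Scene.discharge
      rw [if_pos h0']
      obtain ⟨h1, h2, h3, h4, h5, h6, h7, h8, h9, h10, h11, h12, h13, h14⟩ := h
      refine ⟨by simpa, by simpa, by simpa, by simpa, by simpa, by simpa, by simpa, ?_, by simpa, ?_,
        by simpa, by simpa, by simpa, h14⟩
      · simp [IntExpr.eval, h8]
      · intro j hj
        simp only at hj
        simp only [State.setInt_real, State.setReal_real, State.setReal_int, IntExpr.eval,
          RealExpr.eval, h8, hb, hc]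
        rcases Nat.lt_succ_iff_lt_or_eq.mp hj with hj | rfl
        · have := h10 j hj
          simp only [Function.update_of_ne hj.ne]
          simpa [hj.ne] using this
        · simp [h13, h11 b hbt, h11 c hct]
  · intro h0
    simp only [Test.Holds, IntExpr.eval, h.ph, hb] at h0
    have h0' : s.ph b ≠ 0 := by omega
    apply Wp.skip
    refine ⟨by simp [Test.cost, IntExpr.cost], fun _ _ => rfl, fun _ _ => rfl, ?_⟩
    unfold Scene.discharge
    rwa [if_neg h0']

/-- Register `r` receives the boundary after the one given by `e`. -/
def nextBoundary (e : IntExpr) (r : ℕ) : Program :=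
  .seq (.set 30 e) <| .seq (successor 15) <| .set r (reg 30)

theorem nextBoundary_spec (h : Rep S k L σ s) (htop : ∀ b ∈ s.B, b ≤ S.top) {e : IntExpr} {r : ℕ}
    (he : e.eval σ = b) (hbc : Adj s.B b c) :
    Wp (nextBoundary e r) σ fun τ t => t ≤ 100 * (L + 1) + e.cost + 10 ∧ τ.real = σ.real ∧
      (∀ x < 30, x ≠ r → τ.int x = σ.int x) ∧ τ.int r 0 = c := by
  apply Wp.seq; apply Wp.setInt; apply Wp.seq
  have hBL : ∀ b ∈ s.B, b < 2 ^ L := fun b hb => (htop b hb).trans_lt h.top_lt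
  refine (successor_spec (L := L) (B := s.B) (b := c) (by norm_num) (by simpa using h.size)
    (by simpa using h.B) hBL (by simp [IntExpr.eval, he]) hbc.2.1 hbc.2.2.1
    fun x hx hbx => ?_).mono ?_
  · rcases hbc.2.2.2 x hx with h1 | h1
    · omega
    · exact h1
  · rintro τ t ⟨h1, h2, h3, h4⟩
    apply Wp.setInt
    refine ⟨by simp [IntExpr.cost]; omega, by simpa using h2, fun x hx hxr => ?_, ?_⟩
    · have := h3 x (by omega) (by omega) (by omega)
      simp [hxr, this, show x ≠ 30 by omega]
    · simp [IntExpr.eval, h4]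

/-- Register `r` receives the last boundary below the number given by `e`. -/
def prevBoundary (e : IntExpr) (r : ℕ) : Program :=
  .seq (.set 30 e) <| .seq (predecessor 15) <| .set r (reg 30)

theorem prevBoundary_spec (h : Rep S k L σ s) (htop : ∀ b ∈ s.B, b ≤ S.top) {e : IntExpr} {r : ℕ}
    {p : ℕ} (he : e.eval σ = p) (hp : p ≤ S.top) (hb : b ∈ s.B) (hbp : b < p)
    (hmax : ∀ x ∈ s.B, x < p → x ≤ b) :
    Wp (prevBoundary e r) σ fun τ t => t ≤ 100 * (L + 1) + e.cost + 10 ∧ τ.real = σ.real ∧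
      (∀ x < 30, x ≠ r → τ.int x = σ.int x) ∧ τ.int r 0 = b := by
  apply Wp.seq; apply Wp.setInt; apply Wp.seq
  have hBL : ∀ b ∈ s.B, b < 2 ^ L := fun b hb => (htop b hb).trans_lt h.top_lt
  refine (predecessor_spec (L := L) (B := s.B) (b := b) (p := p) (by norm_num)
    (by simpa using h.size)
    (by simpa using h.B) hBL (by simp [IntExpr.eval, he]) (hp.trans_lt h.top_lt) hb hbp hmax).mono ?_
  · rintro τ t ⟨h1, h2, h3, h4⟩
    apply Wp.setInt
    refine ⟨by simp [IntExpr.cost]; omega, by simpa using h2, fun x hx hxr => ?_, ?_⟩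
    · have := h3 x (by omega) (by omega) (by omega)
      simp [hxr, this, show x ≠ 30 by omega]
    · simp [IntExpr.eval, h4]

/-- Register `r` receives the number of current horizontal segments below the position given
by `e`. -/
def rankCurrent (e : IntExpr) (r : ℕ) : Program :=
  .seq (.set 30 e) <| .seq (rank 16) <| .set r (reg 31)

theorem rankCurrent_spec (h : Rep S k L σ s) {e : IntExpr} {r p : ℕ}
    (he : e.eval σ = p) (hp : p ≤ S.top) :
    Wp (rankCurrent e r) σ fun τ t => t ≤ 40 * (L + 1) + e.cost + 10 ∧ τ.real = σ.real ∧
      (∀ x < 30, x ≠ r → τ.int x = σ.int x) ∧ τ.int r 0 = (s.H.filter (· < p)).card := by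
  apply Wp.seq; apply Wp.setInt; apply Wp.seq
  refine (rank_storesSet (L := L) (B := s.H) (p := p) (by norm_num) (by simpa using h.size)
    (by simpa using h.H) (by simp [IntExpr.eval, he]) (hp.trans_lt h.top_lt)).mono ?_
  · rintro τ t ⟨h1, h2, h3, h4⟩
    apply Wp.setInt
    refine ⟨by simp [IntExpr.cost]; omega, by simpa using h2, fun x hx hxr => ?_, ?_⟩
    · have := h3 x (by omega) (by omega) (by omega)
      simp [hxr, this, show x ≠ 30 by omega]
    · simp [IntExpr.eval, h4]

/-- Two rank queries give the number of current horizontal segments in a cell; the shift by `1`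
drops the segment that may lie on the lower boundary. -/
theorem between_eq_sub {H : Finset ℕ} {b c : ℕ} (hbc : b < c) :
    between H b c = (H.filter (· < c)).card - (H.filter (· < b + 1)).card := by
  have : H.filter (· < c) = H.filter (· < b + 1) ∪ H.filter fun p => b < p ∧ p < c := by
    ext x
    simp only [Finset.mem_filter, Finset.mem_union]
    constructor
    · rintro ⟨h1, h2⟩
      by_cases h : b < x
      · exact .inr ⟨h1, h, h2⟩
      · exact .inl ⟨h1, by omega⟩
    · rintro (⟨h1, h2⟩ | ⟨h1, h2, h3⟩)
      · exact ⟨h1, by omega⟩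
      · exact ⟨h1, h3⟩
  rw [this, Finset.card_union_of_disjoint, Nat.add_sub_cancel_left]
  · rfl
  · rw [Finset.disjoint_left]
    intro x hx hx'
    simp only [Finset.mem_filter] at hx hx'
    omega

theorem current_lt_top {P D cr u φ Xp} (h : S.Inv k s P D cr u φ Xp) {p : ℕ} (hp : p ∈ s.H) :
    p < S.top := by
  obtain ⟨i, -, -, rfl, -⟩ := (h.live p).mp hp
  exact S.lo_lt i

theorem exists_adj {B : Finset ℕ} {b t : ℕ} (hb : b ∈ B) (ht : t ∈ B) (hbt : b < t) :
    ∃ c, Adj B b c := by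
  have hne : (B.filter (b < ·)).Nonempty := ⟨t, by simp [ht, hbt]⟩
  refine ⟨(B.filter (b < ·)).min' hne, hb, ?_, ?_, fun x hx => ?_⟩
  · exact (Finset.mem_filter.mp (Finset.min'_mem _ hne)).1
  · exact (Finset.mem_filter.mp (Finset.min'_mem _ hne)).2
  · by_cases h : x ≤ b
    · exact .inl h
    · exact .inr (Finset.min'_le _ _ (by simp [hx, not_le.mp h]))

/-- The element of `H` that has `r` elements of `H` between itself and `b`. -/
theorem between_of_card_filter {H : Finset ℕ} {b c d r : ℕ} (hbc : b < c) (hd : d ∈ H)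
    (hr : r < between H b c)
    (hcard : (H.filter (· < d)).card = (H.filter (· < b + 1)).card + r) :
    b < d ∧ d < c ∧ between H b d = r := by
  have hmono : ∀ {x y : ℕ}, x ≤ y → (H.filter (· < x)).card ≤ (H.filter (· < y)).card := by
    intro x y hxy
    refine Finset.card_le_card fun z hz => ?_
    simp only [Finset.mem_filter] at hz ⊢
    exact ⟨hz.1, by omega⟩
  rw [between_eq_sub hbc] at hr
  have h1 : b < d := by
    by_contra hbd
    have : (H.filter (· < d)).card < (H.filter (· < b + 1)).card := by
      refine Finset.card_lt_card (Finset.ssubset_iff_subset_ne.mpr ⟨fun z hz => ?_, fun he => ?_⟩)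
      · simp only [Finset.mem_filter] at hz ⊢
        exact ⟨hz.1, by omega⟩
      · have : d ∈ H.filter (· < b + 1) := by simp [hd]; omega
        rw [← he] at this
        simp at this
    omega
  refine ⟨h1, ?_, ?_⟩
  · by_contra hdc
    have := hmono (not_lt.mp hdc)
    omega
  · rw [between_eq_sub h1]
    omega

/-- The number `k`. -/
abbrev quota : IntExpr := .read 0 (.const 1)

/-- Give the cell whose boundaries are held in registers `22` and `23` its new data: register `24`
holds the number of current horizontal segments in it, register `25` that of the segments below it
and register `27` its phase. -/
def renew : Program :=
  .branch (.and (.intLt (reg 27) (.const 1)) (.intLe (.add (reg 24) (.const 1)) quota))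
    (.seq (.setInt 18 (reg 22) (.const 1)) <| .setInt 17 (reg 22) (.add (reg 24) (.const 1))) <|
  .branch (.intLe (.add (reg 24) (reg 24)) (.add quota (.const 1)))
    (.seq (.setInt 18 (reg 22) (.const 0)) <| .setInt 17 (reg 22) (reg 24)) <|
  .seq (.set 31 (.add (reg 25) (.half (reg 24)))) <|
  .seq (select 16) <|
  .seq (.set 26 (reg 30)) <|
  .seq (insertElem 15) <|
  .seq (.setInt 18 (reg 22) (.const 0)) <|
  .seq (.setInt 18 (reg 26) (.const 0)) <|
  .seq (.setInt 17 (reg 22) (.half (reg 24))) <|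
  .setInt 17 (reg 26) (.sub (.sub (reg 24) (.const 1)) (.half (reg 24)))

/-- Restore the invariant of the cell whose lower boundary is held in register `22`. -/
def settle : Program :=
  .branch (.intLt quota (.read 17 (reg 22)))
    (.seq (nextBoundary (reg 22) 23) <|
     .seq (rankCurrent (reg 23) 24) <|
     .seq (rankCurrent (.add (reg 22) (.const 1)) 25) <|
     .seq (.set 24 (.sub (reg 24) (reg 25))) <|
     .seq (.set 27 (.read 18 (reg 22))) <|
     .seq (discharge 22 23) renew)
    .skip

/-- The place `d` of a split is found by the machine, so it appears existentially, with exactly the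
property that `Scene.Inv.settle` demands. Register `27` keeps the old phase. -/
theorem renew_spec {P D cr u φ Xp} (hinv : S.Inv k s P D cr u φ Xp)
    (h : Rep S k L σ (S.discharge s b c)) (hbc : Adj s.B b c) (h22 : σ.int 22 0 = b)
    (h24 : σ.int 24 0 = between s.H b c) (h25 : σ.int 25 0 = (s.H.filter (· < b + 1)).card)
    (h27 : σ.int 27 0 = s.ph b) (hcnt : k < s.cnt b) :
    Wp renew σ fun τ t => t ≤ 200 * (L + 1) ∧ Keeps 15 σ τ ∧
      ∃ d, (k < s.cnt b → ¬ (s.ph b = 0 ∧ between s.H b c + 1 ≤ k) →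
        k + 1 < 2 * between s.H b c → d ∈ s.H ∧ b < d ∧ d < c ∧
        between s.H b d = between s.H b c / 2) ∧ Rep S k L τ (S.settle k s b c d) := by
  unfold renew
  have hk : ¬ s.cnt b ≤ k := by omega
  apply Wp.branch
  · intro h1
    simp only [Test.Holds, IntExpr.eval, h24, h27, h.quota] at h1
    apply Wp.seq; apply Wp.setInt; apply Wp.setInt
    refine ⟨by simp [Test.cost, IntExpr.cost]; omega, ⟨fun x hx => ?_, fun _ _ => rfl⟩, 0, ?_, ?_⟩
    · simp [show x ≠ 18 by omega, show x ≠ 17 by omega]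
    · omega
    · unfold Scene.settle
      simp only [if_neg hk]
      rw [if_pos ⟨by omega, by omega⟩]
      obtain ⟨h1, h2, h3, h4, h5, h6, h7, h8, h9, h10, h11, h12, h13, h14⟩ := h
      refine ⟨by simpa, by simpa, by simpa using h3, by simpa using h4, ?_, ?_, by simpa using h7,
        by simpa, by simpa using h9, by simpa using h10, by simpa, by simpa using h12,
        by simpa using h13, h14⟩
      · simp only [Scene.discharge_cnt] at h5
        simp [IntExpr.eval, h22, h24, h5]
      · simp only [Scene.discharge_ph] at h6
        simp [IntExpr.eval, h22, h6]
  intro h1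
  simp only [Test.Holds, IntExpr.eval, h24, h27, h.quota] at h1
  apply Wp.branch
  · intro h2
    simp only [Test.Holds, IntExpr.eval, h24, h.quota] at h2
    apply Wp.seq; apply Wp.setInt; apply Wp.setInt
    refine ⟨by simp [Test.cost, IntExpr.cost]; omega, ⟨fun x hx => ?_, fun _ _ => rfl⟩, 0, ?_, ?_⟩
    · simp [show x ≠ 18 by omega, show x ≠ 17 by omega]
    · omega
    · unfold Scene.settle
      simp only [if_neg hk]
      rw [if_neg (by omega), if_pos (by omega)]
      obtain ⟨h1, h2, h3, h4, h5, h6, h7, h8, h9, h10, h11, h12, h13, h14⟩ := h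
      refine ⟨by simpa, by simpa, by simpa using h3, by simpa using h4, ?_, ?_, by simpa using h7,
        by simpa, by simpa using h9, by simpa using h10, by simpa, by simpa using h12,
        by simpa using h13, h14⟩
      · simp only [Scene.discharge_cnt] at h5
        simp [IntExpr.eval, h22, h24, h5]
      · simp only [Scene.discharge_ph] at h6
        simp [IntExpr.eval, h22, h6]
  · intro h2
    simp only [Test.Holds, IntExpr.eval, h24, h.quota] at h2
    have hHL : ∀ p ∈ s.H, p < 2 ^ L := fun p hp => (current_lt_top hinv hp).trans h.top_lt
    -- The median has `l / 2` current segments between itself and `b`. Its rank among all current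
    -- segments is this number plus that of the segments at or below `b`.
    have hr : between s.H b c / 2 < between s.H b c := by omega
    have hlt := hbc.2.2.1
    apply Wp.seq; apply Wp.setInt; apply Wp.seq
    refine (select_storesSet (a := 16) (L := L) (B := s.H)
      (r := (s.H.filter (· < b + 1)).card + between s.H b c / 2) (by norm_num)
      (by simpa using h.size) (by simpa using h.H) hHL (by simp [IntExpr.eval, h24, h25]) ?_).mono ?_
    · have h3 := between_eq_sub (H := s.H) hlt
      have h4 := Finset.card_filter_le s.H (· < c)
      omega
    rintro τ₁ t₁ ⟨a1, a2, a3, a4, a5⟩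
    obtain ⟨a6, a7, a8⟩ := between_of_card_filter hlt a4 hr a5
    replace a3 : ∀ x < 30, τ₁.int x = σ.int x := fun x hx => by
      rw [a3 x (by omega) (by omega)]
      simp [show x ≠ 31 by omega]
    replace a2 : τ₁.real = σ.real := a2
    set d := τ₁.int 30 0 with hd
    apply Wp.seq; apply Wp.setInt; apply Wp.seq
    refine (insertElem_spec (a := 15) (L := L) (B := s.B) (p := d) (by norm_num) ?_ ?_ ?_ ?_).mono ?_
    · simp [a3, h.size]
    · have := h.B
      rw [Scene.discharge_B] at this
      simpa [a3] using this
    · simp [hd]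
    · exact hHL _ a4
    rintro τ₂ t₂ ⟨b1, b2, b3, b4⟩
    replace b2 : τ₂.real = σ.real := b2.trans a2
    have c1 : ∀ x < 30, x ≠ 15 → x ≠ 26 → τ₂.int x = σ.int x := fun x hx h15 h26 => by
      rw [b3 x (by omega) h15]
      simp [h26, a3 x hx]
    have c2 : τ₂.int 26 0 = d := by
      rw [b3 26 (by norm_num) (by norm_num)]
      simp [IntExpr.eval, hd]
    have c22 : τ₂.int 22 0 = b := by rw [c1 22 (by norm_num) (by norm_num) (by norm_num), h22]
    have c24 : τ₂.int 24 0 = between s.H b c := by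
      rw [c1 24 (by norm_num) (by norm_num) (by norm_num), h24]
    have c17 : τ₂.int 17 = s.cnt := by
      rw [c1 17 (by norm_num) (by norm_num) (by norm_num), h.cnt, Scene.discharge_cnt]
    have c18 : τ₂.int 18 = s.ph := by
      rw [c1 18 (by norm_num) (by norm_num) (by norm_num), h.ph, Scene.discharge_ph]
    apply Wp.seq; apply Wp.setInt; apply Wp.seq; apply Wp.setInt
    apply Wp.seq; apply Wp.setInt; apply Wp.setInt
    refine ⟨by simp [Test.cost, IntExpr.cost]; omega, ⟨fun x hx => ?_, fun x _ => ?_⟩, d,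
      fun _ _ _ => ⟨a4, a6, a7, a8⟩, ?_⟩
    · simp [show x ≠ 18 by omega, show x ≠ 17 by omega]
      exact c1 x (by omega) (by omega) (by omega)
    · simp [b2]
    · unfold Scene.settle
      simp only [if_neg hk]
      rw [if_neg (by omega), if_neg (by omega)]
      obtain ⟨h1, h2, h3, h4, h5, h6, h7, h8, h9, h10, h11, h12, h13, h14⟩ := h
      refine ⟨?_, ?_, ?_, ?_, ?_, ?_, ?_, ?_, ?_, ?_, ?_, ?_, ?_, h14⟩
      · simpa [c1]
      · simpa [c1]
      · simpa using b4
      · simpa [c1] using h4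
      · simp [IntExpr.eval, c22, c24, c2, c17]
      · simp [IntExpr.eval, c22, c2, c18]
      · simpa [c1] using h7
      · simpa [c1] using h8
      · simpa [c1] using h9
      · simpa [b2] using h10
      · simpa [b2] using h11
      · simpa [b2] using h12
      · simpa [b2] using h13

/-- The growth of `B` is bounded by one because new boundaries have to be paid for in the potential;
old boundaries survive, so several cells can be settled in succession. -/
theorem settle_spec (hk : 0 < k) {P D cr u φ Xp} (hinv : S.Inv k s P D cr u φ Xp)
    (h : Rep S k L σ s) (h22 : σ.int 22 0 = b) (hb : b ∈ s.B) (hbt : b < S.top) :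
    Wp settle σ fun τ t => t ≤ 800 * (L + 1) ∧ Keeps 15 σ τ ∧ ∃ s' u' φ', Rep S k L τ s' ∧
      S.Inv k s' P (D.erase b) cr u' φ' Xp ∧ s.B ⊆ s'.B ∧ s'.B.card ≤ s.B.card + 1 := by
  obtain ⟨c, hbc⟩ := exists_adj hb hinv.top_mem hbt
  have hlt := hbc.2.2.1
  have hct := hinv.le_top c hbc.2.1
  unfold settle
  apply Wp.branch
  · intro h0
    simp only [Test.Holds, IntExpr.eval, h22, h.quota, h.cnt] at h0
    apply Wp.seq
    refine (nextBoundary_spec h hinv.le_top (by simpa [IntExpr.eval]) hbc).mono ?_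
    rintro τ₁ t₁ ⟨a1, a2, a3, a4⟩
    have r1 : Rep S k L τ₁ s := h.congr (fun x hx _ => a3 x (by omega) (by omega)) a2
    have a22 : τ₁.int 22 0 = b := by rw [a3 22 (by norm_num) (by norm_num), h22]
    apply Wp.seq
    refine (rankCurrent_spec r1 (p := c) (by simpa [IntExpr.eval]) hct).mono ?_
    rintro τ₂ t₂ ⟨b1, b2, b3, b4⟩
    have r2 : Rep S k L τ₂ s := r1.congr (fun x hx _ => b3 x (by omega) (by omega)) b2
    have b22 : τ₂.int 22 0 = b := by rw [b3 22 (by norm_num) (by norm_num), a22]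
    have b23 : τ₂.int 23 0 = c := by rw [b3 23 (by norm_num) (by norm_num), a4]
    apply Wp.seq
    refine (rankCurrent_spec r2 (p := b + 1) (by simpa [IntExpr.eval]) (by omega)).mono ?_
    rintro τ₃ t₃ ⟨c1, c2, c3, c4⟩
    have r3 : Rep S k L τ₃ s := r2.congr (fun x hx _ => c3 x (by omega) (by omega)) c2
    have c22 : τ₃.int 22 0 = b := by rw [c3 22 (by norm_num) (by norm_num), b22]
    have c23 : τ₃.int 23 0 = c := by rw [c3 23 (by norm_num) (by norm_num), b23]
    have c24 : τ₃.int 24 0 = (s.H.filter (· < c)).card := by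
      rw [c3 24 (by norm_num) (by norm_num), b4]
    apply Wp.seq; apply Wp.setInt; apply Wp.seq; apply Wp.setInt; apply Wp.seq
    refine (discharge_spec (k := k) (L := L) (s := s) (b := b) (c := c) ?_ (by simp [c22]) (by simp [c23]) hbt.le
      hct).mono ?_
    · refine r3.congr (fun x hx _ => ?_) rfl
      simp [show x ≠ 24 by omega, show x ≠ 27 by omega]
    rintro τ₄ t₄ ⟨d1, d2, d3, d4⟩
    refine (renew_spec hinv d4 hbc ?_ ?_ ?_ ?_ h0).mono ?_
    · rw [d2 22 (by norm_num)]; simp [c22]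
    · rw [d2 24 (by norm_num)]; simp [IntExpr.eval, c24, c4, between_eq_sub hlt]
    · rw [d2 25 (by norm_num)]; simp [c4]
    · rw [d2 27 (by norm_num)]; simp [IntExpr.eval, c22, r3.ph]
    rintro τ₅ t₅ ⟨e1, e2, d, e3, e4⟩
    obtain ⟨u', φ', hinv'⟩ := hinv.settle hk hbc e3
    refine ⟨by simp only [Test.cost, IntExpr.cost] at *; omega, Keeps.trans ⟨fun x hx => ?_, fun x hx => ?_⟩ e2, _, u', φ',
      e4, hinv', ?_, ?_⟩
    · rw [d2 x (by omega)]
      simp [show x ≠ 24 by omega, show x ≠ 27 by omega, c3 x (by omega) (by omega),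
        b3 x (by omega) (by omega), a3 x (by omega) (by omega)]
    · rw [d3 x hx]
      simp [c2, b2, a2]
    · unfold Scene.settle
      simp only
      split_ifs <;> simp
    · unfold Scene.settle
      simp only
      split_ifs <;> simp [Finset.card_insert_le]
  · intro h0
    simp only [Test.Holds, IntExpr.eval, h22, h.quota, h.cnt] at h0
    -- The cell is not overfull, so the place of a split is irrelevant and `0` is a dummy.
    have hsettle : S.settle k s b c 0 = s := by
      unfold Scene.settle
      simp only [if_pos (not_lt.mp h0)]
    obtain ⟨u', φ', hinv'⟩ := hinv.settle hk hbc (d := 0) (fun hl => absurd hl h0)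
    rw [hsettle] at hinv'
    apply Wp.skip
    exact ⟨by simp [Test.cost, IntExpr.cost]; omega, ⟨fun _ _ => rfl, fun _ _ => rfl⟩, s, u', φ', h,
      hinv', subset_rfl, by omega⟩

end RealRAM

/-! ### Merging and counting by machine -/

namespace RealRAM

variable {n : ℕ} {S : Scene n} {k L : ℕ} {s : Sweep} {σ τ υ : State} {b c d : ℕ}

/-- Merge the cells below and above the boundary held in register `29`; register `11` holds the
boundary before it, and afterwards register `29` holds the boundary after it. -/
def mergeCells : Program :=
  .seq (nextBoundary (reg 29) 24) <|
  .seq (.set 26 (.sub (.const 1)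
    (.sub (.add (.read 18 (reg 11)) (.read 18 (reg 29))) (.const 1)))) <|
  .seq (discharge 11 29) <|
  .seq (discharge 29 24) <|
  .seq (.set 30 (reg 29)) <|
  .seq (eraseElem 15) <|
  .seq (.setInt 18 (reg 11) (reg 26)) <|
  .seq (.setInt 17 (reg 11) (reg 26)) <|
  .seq (.setInt 19 (reg 11) (reg 21)) <|
  .set 29 (reg 24)

theorem mergeCells_spec {P D cr u φ Xp} (hinv : S.Inv k s P D cr u φ Xp) (h : Rep S k L σ s)
    (h11 : σ.int 11 0 = b) (h29 : σ.int 29 0 = c) (hbc : Adj s.B b c) (hcd : Adj s.B c d) :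
    Wp mergeCells σ fun τ t => t ≤ 600 * (L + 1) ∧ Keeps 15 σ τ ∧ τ.int 29 0 = d ∧
      Rep S k L τ (S.merge s b c d) := by
  obtain ⟨hbc1, hbc2, hbc3, hbc4⟩ := hinv.bd_lt_bd hbc
  obtain ⟨hcd1, hcd2, hcd3, hcd4⟩ := hinv.bd_lt_bd hcd
  apply Wp.seq
  refine (nextBoundary_spec h hinv.le_top (by simpa [IntExpr.eval]) hcd).mono ?_
  rintro τ₁ t₁ ⟨a1, a2, a3, a4⟩
  have r1 : Rep S k L τ₁ s := h.congr (fun x hx _ => a3 x (by omega) (by omega)) a2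
  have a11 : τ₁.int 11 0 = b := by rw [a3 11 (by norm_num) (by norm_num), h11]
  have a29 : τ₁.int 29 0 = c := by rw [a3 29 (by norm_num) (by norm_num), h29]
  apply Wp.seq; apply Wp.setInt; apply Wp.seq
  refine (discharge_spec (k := k) (L := L) (s := s) (b := b) (c := c) ?_ ?_ ?_ hbc3
    hbc2).mono ?_
  · refine r1.congr (fun x hx _ => ?_) rfl
    simp [show x ≠ 26 by omega]
  · simp [a11]
  · simp [a29]
  rintro τ₂ t₂ ⟨b1, b2', b3, b4⟩
  have b2 : ∀ x, x ≠ 20 → x ≠ 26 → τ₂.int x = τ₁.int x := fun x hx hx' => by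
    rw [b2' x hx]; simp [hx']
  -- With truncated subtraction `1 - ((p + q) - 1)` is `0` if both phases are `1`, and `1`
  -- otherwise.
  have b26 : τ₂.int 26 0 = if s.ph b = 0 ∨ s.ph c = 0 then 1 else 0 := by
    rw [b2' 26 (by norm_num)]
    simp [IntExpr.eval, r1.ph, a11, a29]
    have h1 := hinv.ph_le hbc
    have h2 := hinv.ph_le hcd
    split_ifs <;> omega
  replace b3 : ∀ x, 2 ≤ x → τ₂.real x = τ₁.real x := b3
  apply Wp.seq
  refine (discharge_spec (b := c) (c := d) b4 (by rw [b2 29 (by norm_num) (by norm_num), a29])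
    (by rw [b2 24 (by norm_num) (by norm_num), a4]) hcd3 hcd2).mono ?_
  rintro τ₃ t₃ ⟨c1, c2, c3, c4⟩
  apply Wp.seq; apply Wp.setInt; apply Wp.seq
  refine (eraseElem_spec (a := 15) (L := L) (B := s.B) (p := c) (by norm_num)
    (by simpa using c4.size) (by simpa using c4.B) ?_ (hcd3.trans_lt c4.top_lt)).mono ?_
  · simp [IntExpr.eval, c2, b2, a29]
  rintro τ₄ t₄ ⟨d1, d2, d3, d4⟩
  replace d2 : τ₄.real = τ₃.real := d2
  replace d3 : ∀ x < 30, x ≠ 15 → τ₄.int x = τ₃.int x := fun x hx hx' => by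
    rw [d3 x (by omega) hx']; simp [show x ≠ 30 by omega]
  have d11 : τ₄.int 11 0 = b := by simp [d3, c2, b2, a11]
  have d26 : τ₄.int 26 0 = if s.ph b = 0 ∨ s.ph c = 0 then 1 else 0 := by
    rw [d3 26 (by norm_num) (by norm_num), c2 26 (by norm_num), b26]
  apply Wp.seq; apply Wp.setInt; apply Wp.seq; apply Wp.setInt
  apply Wp.seq; apply Wp.setInt; apply Wp.setInt
  refine ⟨by simp only [IntExpr.cost] at *; omega, ⟨fun x hx => ?_, fun x hx => ?_⟩, ?_,
    ?_⟩
  · simp [show x ≠ 29 by omega, show x ≠ 19 by omega, show x ≠ 17 by omega, show x ≠ 18 by omega]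
    rw [d3 x (by omega) (by omega), c2 x (by omega), b2 x (by omega) (by omega),
      a3 x (by omega) (by omega)]
  · simp [d2, c3 x hx, b3 x hx, a2]
  · simp [IntExpr.eval, d3, c2, b2, a4]
  · obtain ⟨h1, h2, h3, h4, h5, h6, h7, h8, h9, h10, h11, h12, h13, h14⟩ := c4
    refine ⟨by simpa [d3], by simpa [d3], by simpa [Scene.merge] using d4,
      by simpa [Scene.merge, d3] using h4, ?_, ?_, ?_, by simpa [Scene.merge, d3] using h8,
      by simpa [Scene.merge, d3] using h9, by simpa [Scene.merge, d2] using h10,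
      by simpa [d2] using h11, by simpa [Scene.merge, d2] using h12,
      by simpa [Scene.merge, d2] using h13, h14⟩
    · simp only [Scene.discharge_cnt] at h5
      simp [IntExpr.eval, d11, d26, d3, h5, Scene.merge]
    · simp only [Scene.discharge_ph] at h6
      simp [IntExpr.eval, d11, d26, d3, h6, Scene.merge]
    · simp only [Scene.discharge_lv] at h7
      simp only [Scene.discharge_g] at h9
      simp [IntExpr.eval, d11, d3, h7, h9, Scene.merge]

/-- Count the current vertical line in the cell whose lower boundary is held in register `r`, unless
this was done before. -/
def bump (r : ℕ) : Program :=
  .branch (.intLt (.read 19 (reg r)) (reg 21))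
    (.seq (.setInt 17 (reg r) (.add (.read 17 (reg r)) (.const 1))) <|
     .setInt 19 (reg r) (reg 21))
    .skip

theorem bump_spec (h : Rep S k L σ s) {r : ℕ} (hr : r < 15) (hb : σ.int r 0 = b)
    (hlv : s.lv b ≤ s.g) :
    Wp (bump r) σ fun τ t => t ≤ 100 ∧ Keeps 15 σ τ ∧ Rep S k L τ (Scene.bump s b) := by
  unfold bump
  apply Wp.branch
  · intro h0
    simp only [Test.Holds, IntExpr.eval, h.lv, h.g, hb] at h0
    apply Wp.seq; apply Wp.setInt; apply Wp.setInt
    refine ⟨by simp [Test.cost, IntExpr.cost], ⟨fun x hx => ?_, fun _ _ => rfl⟩, ?_⟩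
    · simp [show x ≠ 17 by omega, show x ≠ 19 by omega]
    · unfold Scene.bump
      rw [if_neg h0.ne]
      obtain ⟨h1, h2, h3, h4, h5, h6, h7, h8, h9, h10, h11, h12, h13, h14⟩ := h
      refine ⟨by simpa, by simpa, by simpa, by simpa, ?_, by simpa, ?_, by simpa, by simpa, h10, h11,
        h12, h13, h14⟩
      · simp [IntExpr.eval, hb, h5]
      · simp [IntExpr.eval, hb, h7, h9, show r ≠ 17 by omega]
  · intro h0
    simp only [Test.Holds, IntExpr.eval, h.lv, h.g, hb] at h0
    apply Wp.skip
    refine ⟨by simp [Test.cost, IntExpr.cost], ⟨fun _ _ => rfl, fun _ _ => rfl⟩, ?_⟩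
    unfold Scene.bump
    rwa [if_pos (by omega)]

/-- Merge the cells that the vertical segment crosses. Register `12` holds the boundary below its
lower end, register `11` the following boundary, and register `13` the boundary below its upper
end. Afterwards register `11` holds the lower boundary of the crossed cell, or the number in
register `12`. -/
def crossCells : Program :=
  .branch (.intLt (reg 11) (reg 13))
    (.seq (nextBoundary (reg 11) 29) <| .loop (.intLt (reg 29) (reg 13)) mergeCells)
    (.set 11 (reg 12))

/-- The cells crossed completely are those between `z`, the first boundary above the lower end, and
`b₂`, the last one below the upper end. Each merge removes a boundary and is paid for by the `1000 *
(L + 1)` units released. -/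
theorem crossCells_spec (hk : 0 < k) {P cr u φ Xp} (hinv : S.Inv k s P ∅ cr u φ Xp)
    (h : Rep S k L σ s) {V : Fin n} (hV : S.xl V = S.xr V) (hVX : S.xl V = s.X) {z b₁ b₂ : ℕ}
    (h11 : σ.int 11 0 = z) (h12 : σ.int 12 0 = b₁) (h13 : σ.int 13 0 = b₂)
    (hz : Adj s.B b₁ z) (hb₁ : ∀ x ∈ s.B, x ≤ S.lo V → x ≤ b₁) (hb₁' : b₁ ≤ S.lo V)
    (hb₂ : b₂ ∈ s.B) (hb₂' : b₂ < S.hi V) (hmax : ∀ x ∈ s.B, x < S.hi V → x ≤ b₂) :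
    Wp crossCells σ fun τ t => Keeps 11 σ τ ∧ τ.int 12 = σ.int 12 ∧ τ.int 13 = σ.int 13 ∧
      ∃ s' u' φ' z', Rep S k L τ s' ∧ S.Inv k s' P ∅ cr u' φ' Xp ∧ s'.X = s.X ∧ τ.int 11 0 = z' ∧
        z' ∈ s'.B ∧ b₁ ∈ s'.B ∧ b₂ ∈ s'.B ∧ z' < S.top ∧
        (z' = b₁ ∨ ∃ c, Adj s'.B z' c ∧ S.lo V ≤ z' ∧ c ≤ S.hi V) ∧
        (∀ x y, Adj s'.B x y → x < S.hi V → S.lo V < y →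
          x = z' ∨ x = b₁ ∨ x = b₂ ∨ s'.lv x = s'.g) ∧
        t + 1000 * ((L + 1) * s'.B.card) ≤ 1000 * ((L + 1) * s.B.card) + 1000 * (L + 1) := by
  have hlh := Scene.lo_lt_hi hV
  have hht := S.hi_lt V
  have hzlo : S.lo V < z := by
    by_contra hn
    have h1 := hb₁ z hz.2.1 (not_lt.mp hn)
    have h2 := hz.2.2.1
    omega
  unfold crossCells
  apply Wp.branch
  · intro h0
    simp only [Test.Holds, IntExpr.eval, h11, h13] at h0
    obtain ⟨c, hzc⟩ := exists_adj hz.2.1 hb₂ h0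
    apply Wp.seq
    refine (nextBoundary_spec h hinv.le_top (by simpa [IntExpr.eval]) hzc).mono ?_
    rintro τ₁ t₁ ⟨a1, a2, a3, a4⟩
    have r1 : Rep S k L τ₁ s := h.congr (fun x hx _ => a3 x (by omega) (by omega)) a2
    have hcb : c ≤ b₂ := (hzc.2.2.2 b₂ hb₂).resolve_left (by omega)
    -- The cells from `z` up to the current boundary `c'` have become one cell; the cells below `z`
    -- and above `b₂` are untouched.
    refine Wp.loop_potential (fun υ p => Keeps 15 σ υ ∧ ∃ s' u' φ' c', Rep S k L υ s' ∧
      S.Inv k s' P ∅ cr u' φ' Xp ∧ s'.X = s.X ∧ υ.int 29 0 = c' ∧ Adj s'.B z c' ∧ c' ≤ b₂ ∧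
      Adj s'.B b₁ z ∧ b₂ ∈ s'.B ∧ (∀ x ∈ s'.B, x < S.hi V → x ≤ b₂) ∧
      p = 1000 * ((L + 1) * s'.B.card)) ?_
      ⟨⟨fun x hx => a3 x (by omega) (by omega), fun x _ => by rw [a2]⟩, s, u, φ, c, r1, hinv, rfl,
        a4, hzc, hcb, hz, hb₂, hmax, rfl⟩ ?_
    · rintro υ p ⟨hkeep, s', u', φ', c', i1, i2, i3, i4, i5, i6, i7, i8, i9, rfl⟩ hlt
      have k11 : υ.int 11 0 = z := by rw [hkeep.int 11 (by norm_num), h11]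
      have k13 : υ.int 13 0 = b₂ := by rw [hkeep.int 13 (by norm_num), h13]
      simp only [Test.Holds, IntExpr.eval, i4, k13] at hlt
      obtain ⟨d, hcd⟩ := exists_adj i5.2.1 i8 hlt
      have hdb : d ≤ b₂ := (hcd.2.2.2 b₂ i8).resolve_left (by omega)
      refine (mergeCells_spec i2 i1 k11 i4 i5 hcd).mono ?_
      rintro ω t ⟨m1, m2, m3, m4⟩
      obtain ⟨u'', φ'', hinv'⟩ := i2.merge hk hV (hVX.trans i3.symm) i5 hcd (by omega) (by omega)
      have hcard : (S.merge s' z c' d).B.card + 1 = s'.B.card := by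
        simp only [Scene.merge]
        exact Finset.card_erase_add_one i5.2.1
      have hzc' := i5.2.2.1
      have hbz' := i7.2.2.1
      have hcd' := hcd.2.2.1
      refine ⟨_, ⟨hkeep.trans m2, _, u'', φ'', d, m4, hinv', ?_, m3, ?_, hdb, ?_, ?_, ?_, rfl⟩, ?_⟩
      · simpa [Scene.merge] using i3
      · simp only [Scene.merge]
        rw [adj_erase i5 hcd]
        exact .inl ⟨rfl, rfl⟩
      · simp only [Scene.merge]
        rw [adj_erase i5 hcd]
        exact .inr ⟨by omega, by omega, i7⟩
      · simp only [Scene.merge]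
        exact Finset.mem_erase.mpr ⟨by omega, i8⟩
      · simp only [Scene.merge]
        exact fun x hx => i9 x (Finset.mem_of_mem_erase hx)
      · rw [← hcard]
        simp only [Test.cost, IntExpr.cost]
        rw [mul_add (L + 1)]
        omega
    · rintro υ t p ⟨hkeep, s', u', φ', c', i1, i2, i3, i4, i5, i6, i7, i8, i9, rfl⟩ hlt ht
      have k11 : υ.int 11 0 = z := by rw [hkeep.int 11 (by norm_num), h11]
      have k13 : υ.int 13 0 = b₂ := by rw [hkeep.int 13 (by norm_num), h13]
      simp only [Test.Holds, IntExpr.eval, i4, k13] at hlt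
      obtain rfl : c' = b₂ := by omega
      refine ⟨hkeep.mono (by norm_num), hkeep.int 12 (by norm_num), hkeep.int 13 (by norm_num), s',
        u', φ', z, i1, i2, i3, k11, i5.1, i7.1, i8, by omega, .inr ⟨c', i5, by omega, by omega⟩,
        fun x y hxy h1 h2 => ?_, ?_⟩
      · have g1 := i9 x hxy.1 h1
        have g2 := i7.2.2.2 x hxy.1
        have g3 := i5.2.2.2 x hxy.1
        have g4 := hxy.2.2.2 z i5.1
        have g5 := hxy.2.2.2 b₁ i7.1
        have g6 := i7.2.2.2 y hxy.2.1
        omega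
      · simp only [Test.cost, IntExpr.cost] at *
        omega
  · intro h0
    simp only [Test.Holds, IntExpr.eval, h11, h13] at h0
    -- No cell is crossed completely. The lower end cell `b₁` stands in for the missing one, and
    -- treating it twice does no harm.
    apply Wp.setInt
    refine ⟨⟨fun x hx => ?_, fun _ _ => rfl⟩, by simp, by simp, s, u, φ, b₁,
      h.congr (fun x _ hx => ?_) rfl, hinv, rfl, ?_, hz.1, hz.1, hb₂, by omega, .inl rfl, ?_, ?_⟩
    · simp [show x ≠ 11 by omega]
    · simp [show x ≠ 11 by omega]
    · simp [IntExpr.eval, h12]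
    · intro x y hxy h1 h2
      have g1 := hmax x hxy.1 h1
      have g2 := hz.2.2.2 x hxy.1
      have g3 := hz.2.2.2 y hxy.2.1
      have g4 := hxy.2.2.2 b₁ hz.1
      have g5 := hxy.2.2.2 z hz.2.1
      omega
    · simp only [Test.cost, IntExpr.cost]
      omega

end RealRAM

/-! ### Processing one segment by machine -/

namespace RealRAM

variable {n : ℕ} {S : Scene n} {k L : ℕ} {s : Sweep} {σ τ υ : State} {b c d : ℕ}

/-- Copy register `r` to register `22` and restore the invariant of the cell. -/
def settleAt (r : ℕ) : Program := .seq (.set 22 (reg r)) settle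

theorem settleAt_spec (hk : 0 < k) {P D cr u φ Xp} (hinv : S.Inv k s P D cr u φ Xp)
    (h : Rep S k L σ s) {r : ℕ} (hr : σ.int r 0 = b) (hb : b ∈ s.B) (hbt : b < S.top) :
    Wp (settleAt r) σ fun τ t => t ≤ 810 * (L + 1) ∧ Keeps 15 σ τ ∧ ∃ s' u' φ', Rep S k L τ s' ∧
      S.Inv k s' P (D.erase b) cr u' φ' Xp ∧ s.B ⊆ s'.B ∧ s'.B.card ≤ s.B.card + 1 := by
  apply Wp.seq; apply Wp.setInt
  refine (settle_spec (L := L) (b := b) hk hinv ?_ ?_ hb hbt).mono ?_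
  · refine h.congr (fun x hx _ => ?_) rfl
    simp [show x ≠ 22 by omega]
  · simp [IntExpr.eval, hr]
  rintro τ t ⟨h1, h2, h3⟩
  refine ⟨by simp only [IntExpr.cost]; omega, ⟨fun x hx => ?_, h2.real⟩, h3⟩
  rw [h2.int x hx]
  simp [show x ≠ 22 by omega]

/-- Process the vertical segment whose lower and upper ends are the items in registers `9`
and `10`. -/
def vertical : Program :=
  .seq (prevBoundary (.add (.read 3 (reg 9)) (.const 1)) 12) <|
  .seq (prevBoundary (.read 3 (reg 10)) 13) <|
  .seq (nextBoundary (reg 12) 11) <|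
  .seq crossCells <|
  .seq (bump 11) <|
  .seq (bump 12) <|
  .seq (bump 13) <|
  .seq (settleAt 11) <|
  .seq (settleAt 12) <|
  settleAt 13

/-- There is a last element below `p`. -/
theorem exists_last {B : Finset ℕ} (h0 : 0 ∈ B) {p : ℕ} (hp : 0 < p) :
    ∃ b ∈ B, b < p ∧ ∀ x ∈ B, x < p → x ≤ b := by
  have hne : (B.filter (· < p)).Nonempty := ⟨0, by simp [h0, hp]⟩
  have := Finset.mem_filter.mp (Finset.max'_mem _ hne)
  exact ⟨_, this.1, this.2, fun x hx hxp => Finset.le_max' _ _ (by simp [hx, hxp])⟩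

/-- An end that lies on a boundary belongs to the cell into which the segment extends. Hence `b₁` is
the last boundary at or below the lower end, found by a search from `lo + 1`, and `b₂` the last one
strictly below the upper end. -/
theorem vertical_spec (hk : 0 < k) {P cr u φ Xp} (hinv : S.Inv k s P ∅ cr u φ Xp)
    (h : Rep S k L σ s) {V : Fin n} (hV : S.xl V = S.xr V) (hVX : S.xl V = s.X)
    (hlo : σ.int 3 (σ.int 9 0) = S.lo V) (hhi : σ.int 3 (σ.int 10 0) = S.hi V) :
    Wp vertical σ fun τ t => Keeps 11 σ τ ∧ ∃ s' u' φ', Rep S k L τ s' ∧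
      S.Inv k s' (insert V P) ∅ (cr + 1) u' φ' Xp ∧
      t + 1000 * ((L + 1) * s'.B.card) ≤ 1000 * ((L + 1) * s.B.card) + 8000 * (L + 1) := by
  have hlh := Scene.lo_lt_hi hV
  have hht := S.hi_lt V
  obtain ⟨b₁, hb₁, hb₁lt, hb₁max⟩ := exists_last hinv.zero_mem (Nat.succ_pos (S.lo V))
  obtain ⟨b₂, hb₂, hb₂lt, hb₂max⟩ := exists_last hinv.zero_mem (S.hi_pos V)
  obtain ⟨z, hz⟩ := exists_adj hb₁ hinv.top_mem (by omega)
  apply Wp.seq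
  refine (prevBoundary_spec h hinv.le_top (b := b₁) (p := S.lo V + 1) (by simp [IntExpr.eval, hlo])
    (by omega) hb₁ hb₁lt hb₁max).mono ?_
  rintro τ₁ t₁ ⟨a1, a2, a3, a4⟩
  have r1 : Rep S k L τ₁ s := h.congr (fun x hx _ => a3 x (by omega) (by omega)) a2
  apply Wp.seq
  refine (prevBoundary_spec r1 hinv.le_top (b := b₂) (p := S.hi V)
    (by simp [IntExpr.eval, a3, hhi]) (by omega) hb₂ hb₂lt hb₂max).mono ?_
  rintro τ₂ t₂ ⟨b1, b2, b3, b4⟩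
  have r2 : Rep S k L τ₂ s := r1.congr (fun x hx _ => b3 x (by omega) (by omega)) b2
  have b12 : τ₂.int 12 0 = b₁ := by rw [b3 12 (by norm_num) (by norm_num), a4]
  apply Wp.seq
  refine (nextBoundary_spec r2 hinv.le_top (by simpa [IntExpr.eval]) hz).mono ?_
  rintro τ₃ t₃ ⟨c1, c2, c3, c4⟩
  have r3 : Rep S k L τ₃ s := r2.congr (fun x hx _ => c3 x (by omega) (by omega)) c2
  apply Wp.seq
  refine (crossCells_spec hk hinv r3 hV hVX c4 (by rw [c3 12 (by norm_num) (by norm_num), b12])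
    (by rw [c3 13 (by norm_num) (by norm_num), b4]) hz
    (fun x hx hxl => hb₁max x hx (by omega)) (by omega) hb₂ hb₂lt hb₂max).mono ?_
  rintro τ₄ t₄ ⟨d1, d2, d3, s₄, u₄, φ₄, z', r4, i4, d4, d5, d6, d7, d8, d9, d10, d11, d12⟩
  have d12' : τ₄.int 12 0 = b₁ := by rw [d2, c3 12 (by norm_num) (by norm_num), b12]
  have d13' : τ₄.int 13 0 = b₂ := by rw [d3, c3 13 (by norm_num) (by norm_num), b4]
  apply Wp.seq
  refine (bump_spec r4 (by norm_num) d5 (i4.lv_le _)).mono ?_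
  rintro τ₅ t₅ ⟨e1, e2, r5⟩
  apply Wp.seq
  refine (bump_spec r5 (b := b₁) (by norm_num) (by rw [e2.int 12 (by norm_num), d12']) ?_).mono ?_
  · simp only [Scene.bump_lv, Scene.bump_g]
    split_ifs
    · exact le_rfl
    · exact i4.lv_le _
  rintro τ₆ t₆ ⟨f1, f2, r6⟩
  replace f2 := e2.trans f2
  apply Wp.seq
  refine (bump_spec r6 (b := b₂) (by norm_num) (by rw [f2.int 13 (by norm_num), d13']) ?_).mono ?_
  · simp only [Scene.bump_lv, Scene.bump_g]
    split_ifs <;> first | exact le_rfl | exact i4.lv_le _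
  rintro τ₇ t₇ ⟨g1, g2, r7⟩
  replace g2 := f2.trans g2
  obtain ⟨φ₇, i7⟩ := i4.insert_vertical (hVX.trans d4.symm) hV d10 d11
  apply Wp.seq
  refine (settleAt_spec (b := z') hk i7 r7 (by rw [g2.int 11 (by norm_num), d5]) (by simpa) d9).mono ?_
  rintro τ₈ t₈ ⟨j1, j2, s₈, u₈, φ₈, r8, i8, j3, j4⟩
  simp only [Scene.bump_B] at j3 j4
  replace j2 := g2.trans j2
  apply Wp.seq
  refine (settleAt_spec (b := b₁) hk i8 r8 (by rw [j2.int 12 (by norm_num), d12']) (j3 d7)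
    (by omega)).mono ?_
  rintro τ₉ t₉ ⟨k1, k2, s₉, u₉, φ₉, r9, i9, k3, k4⟩
  replace k2 := j2.trans k2
  refine (settleAt_spec (b := b₂) hk i9 r9 (by rw [k2.int 13 (by norm_num), d13']) (k3 (j3 d8))
    (by omega)).mono ?_
  rintro τ₀ t₀ ⟨l1, l2, s₀, u₀, φ₀, r0, i0, l3, l4⟩
  replace l2 := k2.trans l2
  -- Once the three cells that may be overfull have been settled, none is left, even if some of them
  -- coincide.
  have hD : ((({z', b₁, b₂} : Finset ℕ).erase z').erase b₁).erase b₂ = ∅ := by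
    ext x
    simp only [Finset.mem_erase, Finset.mem_insert, Finset.mem_singleton, Finset.notMem_empty]
    tauto
  rw [hD] at i0
  refine ⟨Keeps.trans (Keeps.trans ⟨fun x hx => ?_, fun x _ => ?_⟩ d1) (l2.mono (by norm_num)), s₀, u₀,
    φ₀, r0, i0, ?_⟩
  · rw [c3 x (by omega) (by omega), b3 x (by omega) (by omega), a3 x (by omega) (by omega)]
  · rw [c2, b2, a2]
  · have hB : s₀.B.card ≤ s₄.B.card + 3 := by omega
    have hB' := Nat.mul_le_mul_left (L + 1) hB
    rw [mul_add (L + 1)] at hB'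
    simp only [IntExpr.cost] at *
    omega

/-- Process the horizontal segment whose left end is the item in register `9`. -/
def horizontal : Program :=
  .seq (.set 30 (.read 3 (reg 9))) <|
  .seq (insertElem 16) <|
  .branch (.intLt (.read 15 (.add (reg 1) (.read 3 (reg 9)))) (.const 1))
    (.seq (prevBoundary (.read 3 (reg 9)) 22) <|
     .seq (.setInt 17 (reg 22) (.add (.read 17 (reg 22)) (.const 1))) settle)
    .skip

theorem horizontal_spec (hk : 0 < k) {P cr u φ Xp} (hinv : S.Inv k s P ∅ cr u φ Xp)
    (h : Rep S k L σ s) {i : Fin n} (hi : i ∉ P) (hiX : S.xl i = s.X) (hh : S.xl i < S.xr i)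
    (hlo : σ.int 3 (σ.int 9 0) = S.lo i) :
    Wp horizontal σ fun τ t => Keeps 11 σ τ ∧ ∃ s' u' φ', Rep S k L τ s' ∧
      S.Inv k s' (insert i P) ∅ (cr + 1) u' φ' Xp ∧
      t + 1000 * ((L + 1) * s'.B.card) ≤ 1000 * ((L + 1) * s.B.card) + 8000 * (L + 1) := by
  have hlt := S.lo_lt i
  have hpos := S.lo_pos i
  apply Wp.seq; apply Wp.setInt; apply Wp.seq
  refine (insertElem_spec (a := 16) (L := L) (B := s.H) (p := S.lo i) (by norm_num)
    (by simpa using h.size) (by simpa using h.H) (by simp [IntExpr.eval, hlo])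
    (hlt.trans h.top_lt)).mono ?_
  rintro τ₁ t₁ ⟨a1, a2, a3, a4⟩
  replace a2 : τ₁.real = σ.real := a2
  replace a3 : ∀ x < 30, x ≠ 16 → τ₁.int x = σ.int x := fun x hx hx' => by
    rw [a3 x (by omega) hx']; simp [show x ≠ 30 by omega]
  have r1 : Rep S k L τ₁ { s with H := insert (S.lo i) s.H } := by
    obtain ⟨h1, h2, h3, h4, h5, h6, h7, h8, h9, h10, h11, h12, h13, h14⟩ := h
    exact ⟨by simpa [a3], by simpa [a3], by simpa [a3] using h3, a4, by simpa [a3], by simpa [a3],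
      by simpa [a3], by simpa [a3], by simpa [a3], by simpa [a2], by simpa [a2], by simpa [a2],
      by simpa [a2], h14⟩
  -- A leaf of the tree of sums is the indicator of membership, so it takes one look to see whether
  -- the segment starts on a boundary.
  have hleaf : τ₁.int 15 (τ₁.int 1 0 + τ₁.int 3 (τ₁.int 9 0)) = if S.lo i ∈ s.B then 1 else 0 := by
    rw [a3 3 (by norm_num) (by norm_num), a3 9 (by norm_num) (by norm_num), hlo, r1.size]
    exact r1.B.leaf _ (hlt.trans h.top_lt)
  apply Wp.branch
  · intro h0
    simp only [Test.Holds, IntExpr.eval, hleaf] at h0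
    have hB : S.lo i ∉ s.B := fun hB => by rw [if_pos hB] at h0; omega
    obtain ⟨b, hb, hblt, hbmax⟩ := exists_last hinv.zero_mem hpos
    obtain ⟨c, hbc⟩ := exists_adj hb hinv.top_mem (by omega)
    have hc : S.lo i < c := by
      by_contra hn
      have : c ≠ S.lo i := fun he => hB (he ▸ hbc.2.1)
      have h1 := hbmax c hbc.2.1 (by omega)
      have h2 := hbc.2.2.1
      omega
    apply Wp.seq
    refine (prevBoundary_spec r1 hinv.le_top (b := b) (p := S.lo i)
      (by simp [IntExpr.eval, a3, hlo]) hlt.le hb hblt hbmax).mono ?_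
    rintro τ₂ t₂ ⟨b1, b2, b3, b4⟩
    have r2 := r1.congr (fun x hx _ => b3 x (by omega) (by omega)) b2
    obtain ⟨φ', hinv'⟩ := hinv.insert_interior hi hiX hh hbc hblt hc
    apply Wp.seq; apply Wp.setInt
    refine (settle_spec (L := L) (b := b) hk hinv' ?_ ?_ hb (by omega)).mono ?_
    · obtain ⟨h1, h2, h3, h4, h5, h6, h7, h8, h9, h10, h11, h12, h13, h14⟩ := r2
      refine ⟨by simpa, by simpa, by simpa using h3, by simpa using h4, ?_, by simpa, by simpa,
        by simpa, by simpa, h10, h11, h12, h13, h14⟩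
      simp [IntExpr.eval, b4, h5]
    · simpa using b4
    rintro τ₃ t₃ ⟨c1, c2, s', u', φ'', r', i', c3, c4⟩
    rw [Finset.erase_singleton] at i'
    refine ⟨Keeps.trans ⟨fun x hx => ?_, fun x _ => ?_⟩ (c2.mono (by norm_num)), s', u', φ'', r', i',
      ?_⟩
    · simp [show x ≠ 17 by omega, b3 x (by omega) (by omega), a3 x (by omega) (by omega)]
    · simp [b2, a2]
    · simp only at c4
      have hB' := Nat.mul_le_mul_left (L + 1) c4
      rw [mul_add (L + 1)] at hB'
      simp only [Test.cost, IntExpr.cost] at *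
      omega
  · intro h0
    simp only [Test.Holds, IntExpr.eval, hleaf] at h0
    have hB : S.lo i ∈ s.B := by
      by_contra hB
      rw [if_neg hB] at h0
      omega
    apply Wp.skip
    refine ⟨⟨fun x hx => a3 x (by omega) (by omega), fun x _ => by rw [a2]⟩, _, u, φ, r1,
      hinv.insert_boundary hiX hh hB, ?_⟩
    simp only [Test.cost, IntExpr.cost]
    omega

end RealRAM

/-! ### Endpoints as events; segments that end -/

namespace RealRAM

/-- The endpoints of the segments are numbered by the numbers below `2 * n`. The segment `i` has the
left or lower end `act i` and the right or upper end `oth i`; `X` and `Y` are the coordinates of the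
endpoints and `pos` are the positions of their heights. -/
structure Items {n : ℕ} (S : Scene n) (X Y : ℕ → ℝ) (pos : ℕ → ℕ) (act oth : Fin n → ℕ) : Prop where
  cases : ∀ i, (act i = i ∧ oth i = n + i) ∨ (act i = n + i ∧ oth i = i)
  X_act : ∀ i, X (act i) = S.xl i
  X_oth : ∀ i, X (oth i) = S.xr i
  Y_act : ∀ i, Y (act i) = S.yl i
  Y_oth : ∀ i, Y (oth i) = S.yr i
  pos_act : ∀ i, pos (act i) = S.lo i
  pos_oth : ∀ i, pos (oth i) = S.hi i

namespace Items

variable {n : ℕ} {S : Scene n} {X Y : ℕ → ℝ} {pos : ℕ → ℕ} {act oth : Fin n → ℕ}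

theorem act_lt (h : Items S X Y pos act oth) (i : Fin n) : act i < 2 * n := by
  have := h.cases i
  have := i.isLt
  omega

theorem oth_lt (h : Items S X Y pos act oth) (i : Fin n) : oth i < 2 * n := by
  have := h.cases i
  have := i.isLt
  omega

theorem act_inj (h : Items S X Y pos act oth) {i j : Fin n} (hij : act i = act j) : i = j := by
  have h1 := h.cases i
  have h2 := h.cases j
  have h3 := i.isLt
  have h4 := j.isLt
  ext
  omega

theorem oth_inj (h : Items S X Y pos act oth) {i j : Fin n} (hij : oth i = oth j) : i = j := by
  have h1 := h.cases i
  have h2 := h.cases j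
  have h3 := i.isLt
  have h4 := j.isLt
  ext
  omega

theorem exists_eq (h : Items S X Y pos act oth) {t : ℕ} (ht : t < 2 * n) :
    ∃ i, t = act i ∨ t = oth i := by
  by_cases htn : t < n
  · refine ⟨⟨t, htn⟩, ?_⟩
    have := h.cases ⟨t, htn⟩
    simp only at this
    omega
  · refine ⟨⟨t - n, by omega⟩, ?_⟩
    have := h.cases ⟨t - n, by omega⟩
    simp only at this
    omega

end Items

/-- The part of the storage that does not change during the sweep. -/
structure Env (n : ℕ) (X Y : ℕ → ℝ) (pos f : ℕ → ℕ) (l : ℕ) (σ : State) : Prop where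
  segments : σ.int 0 0 = n
  items : σ.int 2 0 = 2 * n
  pos : σ.int 3 = pos
  order : σ.int 4 = f
  top : σ.int 6 0 = l
  X : σ.real 4 = X
  Y : σ.real 5 = Y

variable {n : ℕ} {S : Scene n} {k L : ℕ} {s : Sweep} {σ τ υ : State} {b c d l : ℕ}
  {X Y : ℕ → ℝ} {pos f : ℕ → ℕ} {act oth : Fin n → ℕ}

theorem Env.congr (h : Env n X Y pos f l σ) (hi : ∀ x < 7, τ.int x = σ.int x)
    (h4 : τ.real 4 = σ.real 4) (h5 : τ.real 5 = σ.real 5) : Env n X Y pos f l τ :=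
  ⟨by rw [hi 0 (by norm_num), h.segments], by rw [hi 2 (by norm_num), h.items],
    by rw [hi 3 (by norm_num), h.pos], by rw [hi 4 (by norm_num), h.order],
    by rw [hi 6 (by norm_num), h.top], h4.trans h.X,
    h5.trans h.Y⟩

/-- Register `r'` receives the other end of the segment that has the end in register `r`. -/
def partner (r r' : ℕ) : Program :=
  .branch (.intLt (reg r) (reg 0)) (.set r' (.add (reg r) (reg 0))) (.set r' (.sub (reg r) (reg 0)))

theorem partner_spec (hI : Items S X Y pos act oth) (hn : σ.int 0 0 = n) {r r' : ℕ} {i : Fin n}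
    {t t' : ℕ} (ht : σ.int r 0 = t) (h : (t = act i ∧ t' = oth i) ∨ (t = oth i ∧ t' = act i)) :
    Wp (partner r r') σ fun τ T => T ≤ 20 ∧ τ.real = σ.real ∧
      (∀ x, x ≠ r' → τ.int x = σ.int x) ∧ τ.int r' 0 = t' := by
  have hc := hI.cases i
  have hi := i.isLt
  apply Wp.branch
  · intro h0
    simp only [Test.Holds, IntExpr.eval, ht, hn] at h0
    apply Wp.setInt
    refine ⟨by simp [Test.cost, IntExpr.cost], rfl, fun x hx => by simp [hx], ?_⟩
    simp only [IntExpr.eval, State.setInt_int, if_true, Function.update_self, ht, hn]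
    omega
  · intro h0
    simp only [Test.Holds, IntExpr.eval, ht, hn] at h0
    apply Wp.setInt
    refine ⟨by simp [Test.cost, IntExpr.cost], rfl, fun x hx => by simp [hx], ?_⟩
    simp only [IntExpr.eval, State.setInt_int, if_true, Function.update_self, ht, hn]
    omega

/-- The next endpoint is left behind. -/
def depart : Program :=
  .seq (.set 22 (.read 4 (reg 8))) <|
  .seq (.set 8 (.add (reg 8) (.const 1))) <|
  .seq (partner 22 23) <|
  .branch (.realLt (.read 4 (reg 23)) (.read 4 (reg 22)))
    (.seq (.set 30 (.read 3 (reg 22))) (eraseElem 16)) .skip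

/-- The positions of the horizontal segments in `P` whose right ends are not among the first `d`
endpoints. -/
def IsPending (S : Scene n) (P : Set (Fin n)) (f : ℕ → ℕ) (oth : Fin n → ℕ) (d : ℕ)
    (H : Finset ℕ) : Prop :=
  ∀ p, p ∈ H ↔ ∃ i ∈ P, S.xl i < S.xr i ∧ S.lo i = p ∧ ∀ j < d, f j ≠ oth i

theorem depart_spec (hI : Items S X Y pos act oth) (hE : Env n X Y pos f l σ) {P : Set (Fin n)}
    {H : Finset ℕ} {x : ℝ} (hf : IsSorting X (2 * n) f) (hN : σ.int 1 0 = 2 ^ L)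
    (htop : S.top < 2 ^ L) (hH : StoresSet L (σ.int 16) H)
    (h8 : σ.int 8 0 = d) (hd : d < 2 * n) (hpend : IsPending S P f oth d H)
    (hPx : ∀ i ∈ P, S.xl i ≤ x) (hdx : x ≤ X (f d)) (hPd : ∀ i, S.xl i < X (f d) → i ∈ P) :
    Wp depart σ fun τ t => t ≤ 180 * (L + 1) ∧ τ.real = σ.real ∧
      (∀ x < 22, x ≠ 8 → x ≠ 16 → τ.int x = σ.int x) ∧ τ.int 8 0 = d + 1 ∧
      ∃ H', StoresSet L (τ.int 16) H' ∧ IsPending S P f oth (d + 1) H' := by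
  have hfd := hf.lt d hd
  obtain ⟨i, hi⟩ := hI.exists_eq hfd
  obtain ⟨t', ht'⟩ : ∃ t', (f d = act i ∧ t' = oth i) ∨ (f d = oth i ∧ t' = act i) := by
    rcases hi with h | h
    · exact ⟨_, .inl ⟨h, rfl⟩⟩
    · exact ⟨_, .inr ⟨h, rfl⟩⟩
  apply Wp.seq; apply Wp.setInt; apply Wp.seq; apply Wp.setInt; apply Wp.seq
  refine (partner_spec (i := i) (t := f d) (t' := t') hI ?_ ?_ ht').mono ?_
  · simp [hE.segments]
  · simp [IntExpr.eval, hE.order, h8]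
  rintro τ₁ t₁ ⟨a1, a2, a3, a4⟩
  have a22 : τ₁.int 22 0 = f d := by
    rw [a3 22 (by norm_num)]; simp [IntExpr.eval, hE.order, h8]
  have a8 : τ₁.int 8 0 = d + 1 := by
    rw [a3 8 (by norm_num)]; simp [IntExpr.eval, h8]
  replace a2 : τ₁.real = σ.real := a2
  replace a3 : ∀ x, x ≠ 8 → x ≠ 22 → x ≠ 23 → τ₁.int x = σ.int x := fun x h1 h2 h3 => by
    rw [a3 x h3]; simp [h1, h2]
  have hsplit : ∀ j, (∀ l < d + 1, f l ≠ oth j) ↔ (∀ l < d, f l ≠ oth j) ∧ f d ≠ oth j := by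
    intro j
    constructor
    · exact fun h => ⟨fun l hl => h l (by omega), h d (by omega)⟩
    · rintro ⟨h1, h2⟩ l hl
      rcases Nat.lt_succ_iff_lt_or_eq.mp hl with h | rfl
      · exact h1 l h
      · exact h2
  apply Wp.branch
  · intro h0
    simp only [Test.Holds, RealExpr.eval, IntExpr.eval, a2, hE.X, a4, a22] at h0
    obtain ⟨hfi, rfl⟩ : f d = oth i ∧ t' = act i := by
      rcases ht' with ⟨h1, h2⟩ | h
      · rw [h1, h2, hI.X_act, hI.X_oth] at h0
        exact absurd (Scene.xl_le_xr i) (not_le.mpr h0)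
      · exact h
    rw [hfi, hI.X_act, hI.X_oth] at h0
    apply Wp.seq; apply Wp.setInt
    refine (eraseElem_spec (a := 16) (L := L) (B := H) (p := S.lo i) (by norm_num)
      ?_ ?_ ?_ ((S.lo_lt i).trans htop)).mono ?_
    · simp [a3, hN]
    · simp [a3, hH]
    · simp [IntExpr.eval, a3, hE.pos, a22, hfi, hI.pos_oth, Scene.lo_eq_hi h0]
    rintro τ₂ t₂ ⟨b1, b2, b3, b4⟩
    refine ⟨by simp [Test.cost, IntExpr.cost, RealExpr.cost]; omega, ?_, fun x hx hx8 hx16 => ?_, ?_,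
      _, b4, fun p => ?_⟩
    · rw [b2]; exact a2
    · rw [b3 x (by omega) hx16]
      simp [show x ≠ 30 by omega, a3 x hx8 (by omega) (by omega)]
    · rw [b3 8 (by norm_num) (by norm_num)]
      simp [a8]
    · rw [Finset.mem_erase, hpend]
      simp only [hsplit]
      have hiP : i ∈ P := hPd i (by rw [hfi, hI.X_oth]; exact h0)
      constructor
      · rintro ⟨hp, j, hj, h1, rfl, h3⟩
        refine ⟨j, hj, h1, rfl, h3, fun hfj => hp ?_⟩
        rw [hI.oth_inj (hfj.symm.trans hfi)]
      -- Another pending segment at the erased height would contain the right end of segment `i`,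
      -- against disjointness. Erasing the height thus removes segment `i` only.
      · rintro ⟨j, hj, h1, rfl, h3, h4⟩
        refine ⟨fun hlo => ?_, j, hj, h1, rfl, h3⟩
        have hji : j ≠ i := fun hji => h4 (hji ▸ hfi)
        have hy : S.yl j = S.yl i := by rw [← S.ht_lo, ← S.ht_lo, hlo]
        obtain ⟨l, hl, hlj⟩ := hf.surj (hI.oth_lt j)
        have hdl : d ≤ l := not_lt.mp fun hld => h3 l hld hlj
        have hxr : X (f d) ≤ S.xr j := by
          rw [← hI.X_oth, ← hlj]
          exact hf.mono d l hdl hl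
        refine S.disj j i hji ((hPx j hj).trans (hdx.trans ?_)) ((hPx i hiP).trans (hdx.trans hxr)) ?_
          ?_
        · rw [hfi, hI.X_oth]
        · rw [hy]; exact Scene.yl_le_yr i
        · rw [← hy]; exact Scene.yl_le_yr j
  · intro h0
    simp only [Test.Holds, RealExpr.eval, IntExpr.eval, a2, hE.X, a4, a22] at h0
    apply Wp.skip
    refine ⟨by simp [Test.cost, IntExpr.cost, RealExpr.cost]; omega, a2,
      fun x hx hx8 hx16 => a3 x hx8 (by omega) (by omega), a8, H,
      by rwa [a3 16 (by norm_num) (by norm_num) (by norm_num)], fun p => ?_⟩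
    rw [hpend]
    simp only [hsplit]
    constructor
    · rintro ⟨j, hj, h1, h2, h3⟩
      refine ⟨j, hj, h1, h2, h3, fun hfj => h0 ?_⟩
      rcases ht' with ⟨g1, g2⟩ | ⟨g1, g2⟩
      · exfalso
        rw [hfj] at g1
        have c1 := hI.cases j
        have c2 := hI.cases i
        have e1 := hI.X_oth j
        have e2 := hI.X_act i
        have e3 := i.isLt
        have e4 := j.isLt
        have : i = j := by ext; omega
        subst this
        rw [g1] at e1
        rw [e1] at e2
        exact h1.ne e2.symm
      · have := hI.oth_inj (hfj.symm.trans g1)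
        subst this
        rwa [g1, g2, hI.X_oth, hI.X_act]
    · rintro ⟨j, hj, h1, h2, h3, -⟩
      exact ⟨j, hj, h1, h2, h3⟩

/-- The endpoints before `e` have been processed and those before `d` have been left behind. -/
structure Progress (X : ℕ → ℝ) (f : ℕ → ℕ) (act : Fin n → ℕ) (x : ℝ) (P : Set (Fin n))
    (e d : ℕ) : Prop where
  mem : ∀ i, i ∈ P ↔ ∃ j < e, f j = act i
  le : ∀ j < e, X (f j) ≤ x
  ge : ∀ j, e ≤ j → j < 2 * n → x ≤ X (f j)
  behind : ∀ j < d, X (f j) < x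
  ahead : ∀ j, d ≤ j → j < 2 * n → x ≤ X (f j)

/-- When exactly the endpoints left of `x` have been left behind, being pending means reaching `x`.
This translates between the pointer `d` and the field `live` of the invariant. -/
theorem Progress.isPending (hI : Items S X Y pos act oth) (hf : IsSorting X (2 * n) f)
    {P : Set (Fin n)} {x : ℝ} (hb : ∀ j < d, X (f j) < x)
    (ha : ∀ j, d ≤ j → j < 2 * n → x ≤ X (f j)) {H : Finset ℕ} :
    IsPending S P f oth d H ↔ ∀ p, p ∈ H ↔ ∃ i ∈ P, S.xl i < S.xr i ∧ S.lo i = p ∧ x ≤ S.xr i := by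
  have key : ∀ i, (∀ j < d, f j ≠ oth i) ↔ x ≤ S.xr i := by
    intro i
    constructor
    · intro h
      obtain ⟨l, hl, hli⟩ := hf.surj (hI.oth_lt i)
      rw [← hI.X_oth, ← hli]
      exact ha l (not_lt.mp fun hld => h l hld hli) hl
    · intro h j hj hji
      have := hb j hj
      rw [hji, hI.X_oth] at this
      exact absurd h (not_le.mpr this)
  simp only [IsPending, key]

/-- Leave the endpoints to the left of the item in register `9` behind. -/
def departures : Program :=
  .loop (.realLt (.read 4 (.read 4 (reg 8))) (.read 4 (reg 9))) depart

theorem departures_spec (hI : Items S X Y pos act oth) (hE : Env n X Y pos f l σ) {P : Set (Fin n)}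
    {H : Finset ℕ} {x : ℝ} (hf : IsSorting X (2 * n) f) (hN : σ.int 1 0 = 2 ^ L)
    (htop : S.top < 2 ^ L) (hH : StoresSet L (σ.int 16) H) {e d : ℕ} (he : e < 2 * n)
    (h9 : σ.int 9 0 = f e) (h8 : σ.int 8 0 = d) (hpr : Progress X f act x P e d)
    (hpend : IsPending S P f oth d H) :
    Wp departures σ fun τ t => τ.real = σ.real ∧
      (∀ x < 22, x ≠ 8 → x ≠ 16 → τ.int x = σ.int x) ∧ ∃ d' H', τ.int 8 0 = d' ∧
      StoresSet L (τ.int 16) H' ∧ IsPending S P f oth d' H' ∧ (∀ j < d', X (f j) < X (f e)) ∧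
      (∀ j, d' ≤ j → j < 2 * n → X (f e) ≤ X (f j)) ∧
      t + 200 * ((L + 1) * (2 * n - d')) ≤ 200 * ((L + 1) * (2 * n - d)) + 20 := by
  have hxe := hpr.ge e le_rfl he
  have hmono := hf.mono
  refine Wp.loop_potential (fun υ p => υ.real = σ.real ∧
    (∀ x < 22, x ≠ 8 → x ≠ 16 → υ.int x = σ.int x) ∧ ∃ d' H', υ.int 8 0 = d' ∧ d ≤ d' ∧
      StoresSet L (υ.int 16) H' ∧ IsPending S P f oth d' H' ∧ (∀ j < d', X (f j) < X (f e)) ∧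
      p = 200 * ((L + 1) * (2 * n - d'))) ?_
    ⟨rfl, fun _ _ _ _ => rfl, d, H, h8, le_rfl, hH, hpend,
      fun j hj => (hpr.behind j hj).trans_le hxe, rfl⟩ ?_
  · rintro υ p ⟨h1, h2, d', H', h3, h4, h5, h6, h7, rfl⟩ hlt
    have hE' : Env n X Y pos f l υ :=
      hE.congr (fun x hx => h2 x (by omega) (by omega) (by omega)) (by rw [h1]) (by rw [h1])
    have k9 : υ.int 9 0 = f e := by rw [h2 9 (by norm_num) (by norm_num) (by norm_num), h9]
    simp only [Test.Holds, RealExpr.eval, IntExpr.eval, hE'.X, hE'.order, h3, k9] at hlt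
    -- All endpoints left behind are strictly to the left of `f e`, so the pointer cannot pass `e`
    -- and stays within the sorted list.
    have hde : d' < e := by
      rcases lt_trichotomy d' e with h | h | h
      · exact h
      · rw [h] at hlt; exact absurd hlt (lt_irrefl _)
      · exact absurd (h7 e h) (lt_irrefl _)
    refine (depart_spec (x := x) hI hE' hf
      (by rw [h2 1 (by norm_num) (by norm_num) (by norm_num), hN]) htop h5 h3 (by omega) h6
      (fun i hi => ?_) (hpr.ahead d' h4 (by omega)) (fun i hi => ?_)).mono ?_
    · obtain ⟨j, hj, hji⟩ := (hpr.mem i).mp hi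
      rw [← hI.X_act, ← hji]
      exact hpr.le j hj
    · obtain ⟨j, hj, hji⟩ := hf.surj (hI.act_lt i)
      refine (hpr.mem i).mpr ⟨j, not_le.mp fun hej => ?_, hji⟩
      rw [← hI.X_act, ← hji] at hi
      exact absurd (hmono e j hej hj) (not_le.mpr (hi.trans hlt))
    rintro ω t ⟨g1, g2, g3, g4, H'', g5, g6⟩
    refine ⟨_, ⟨g2.trans h1, fun x hx hx8 hx16 => (g3 x hx hx8 hx16).trans (h2 x hx hx8 hx16), d' + 1,
      H'', g4, by omega, g5, g6, fun j hj => ?_, rfl⟩, ?_⟩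
    · rcases Nat.lt_succ_iff_lt_or_eq.mp hj with h | rfl
      · exact h7 j h
      · exact hlt
    · have : 2 * n - d' = 2 * n - (d' + 1) + 1 := by omega
      rw [this, mul_add (L + 1)]
      simp only [Test.cost, RealExpr.cost, IntExpr.cost]
      omega
  · rintro υ t p ⟨h1, h2, d', H', h3, h4, h5, h6, h7, rfl⟩ hlt ht
    have hE' : Env n X Y pos f l υ :=
      hE.congr (fun x hx => h2 x (by omega) (by omega) (by omega)) (by rw [h1]) (by rw [h1])
    have k9 : υ.int 9 0 = f e := by rw [h2 9 (by norm_num) (by norm_num) (by norm_num), h9]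
    simp only [Test.Holds, RealExpr.eval, IntExpr.eval, hE'.X, hE'.order, h3, k9] at hlt
    refine ⟨h1, h2, d', H', h3, h5, h6, h7, fun j hj hjn => ?_, ?_⟩
    · exact (not_lt.mp hlt).trans (hmono d' j hj hjn)
    · simp only [Test.cost, RealExpr.cost, IntExpr.cost] at ht
      omega

end RealRAM

/-! ### The sweep loop -/

namespace RealRAM

variable {n : ℕ} {S : Scene n} {k L : ℕ} {s : Sweep} {σ τ υ : State} {b c d e l : ℕ}
  {X Y : ℕ → ℝ} {pos f : ℕ → ℕ} {act oth : Fin n → ℕ}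

/-- Move the sweep line to the item in register `9`. -/
def align : Program :=
  .branch (.realLt (rreg 7) (.read 4 (reg 9)))
    (.seq departures <|
     .seq (.rset 8 (.div (.add (rreg 7) (.read 4 (reg 9))) (.const 2))) <|
     .seq (.rset 7 (.read 4 (reg 9))) <|
     .set 21 (.add (reg 21) (.const 1)))
    .skip

theorem align_spec (hI : Items S X Y pos act oth) (hE : Env n X Y pos f l σ)
    (hf : IsSorting X (2 * n) f) {P cr u φ Xp} (hinv : S.Inv k s P ∅ cr u φ Xp)
    (h : Rep S k L σ s) (he : e < 2 * n) (h9 : σ.int 9 0 = f e) (h8 : σ.int 8 0 = d)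
    (hpr : Progress X f act s.X P e d) :
    Wp align σ fun τ t => Env n X Y pos f l τ ∧ (∀ x < 15, x ≠ 8 → τ.int x = σ.int x) ∧
      ∃ s' Xp' d', Rep S k L τ s' ∧ S.Inv k s' P ∅ cr u φ Xp' ∧ s'.X = X (f e) ∧ s'.B = s.B ∧
        τ.int 8 0 = d' ∧ Progress X f act s'.X P e d' ∧
        t + 200 * ((L + 1) * (2 * n - d')) ≤ 200 * ((L + 1) * (2 * n - d)) + 100 := by
  have hxe := hpr.ge e le_rfl he
  apply Wp.branch
  · intro h0
    simp only [Test.Holds, RealExpr.eval, IntExpr.eval, h.X, hE.X, h9] at h0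
    apply Wp.seq
    refine (departures_spec hI hE hf h.size h.top_lt h.H he h9 h8 hpr
      ((Progress.isPending hI hf hpr.behind hpr.ahead).mpr hinv.live)).mono ?_
    rintro τ₁ t₁ ⟨a1, a2, d', H', a3, a4, a5, a6, a7, a8⟩
    have a9 : τ₁.int 9 0 = f e := by rw [a2 9 (by norm_num) (by norm_num) (by norm_num), h9]
    have aX : τ₁.real 7 0 = s.X := by rw [a1, h.X]
    apply Wp.seq; apply Wp.setReal; apply Wp.seq; apply Wp.setReal; apply Wp.setInt
    have hlt : ∀ j < 2 * n, X (f j) < X (f e) → j < e := fun j hj hje =>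
      not_le.mp fun hej => absurd (hf.mono e j hej hj) (not_le.mpr hje)
    have hgap : ∀ j < 2 * n, X (f j) ≤ s.X ∨ X (f e) ≤ X (f j) := fun j hj => by
      rcases lt_or_ge j e with hje | hje
      · exact .inl (hpr.le j hje)
      · exact .inr (hf.mono e j hje hj)
    -- The abscissa for new modems is the midpoint of the old and the new line; endpoints are
    -- visited in sorted order, so none lies strictly between the two lines.
    have hinv' := hinv.advance (X' := X (f e)) (m' := (s.X + X (f e)) / 2) (H' := H') (by linarith)
      (by linarith) (fun i hi => ?_) (fun i => ?_) (fun i => ?_)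
      ((Progress.isPending hI hf a6 a7).mp a5)
    · refine ⟨hE.congr (fun x hx => ?_) ?_ ?_, fun x hx hx8 => ?_, _, s.X, d', ?_, hinv', rfl, rfl, ?_,
        ⟨hpr.mem, fun j hj => hf.mono j e hj.le he, fun j hj hjn => hf.mono e j hj hjn, a6, a7⟩, ?_⟩
      · simp [show x ≠ 21 by omega, a2 x (by omega) (by omega) (by omega)]
      · simp [a1]
      · simp [a1]
      · simp [show x ≠ 21 by omega, a2 x (by omega) hx8 (by omega)]
      · obtain ⟨h1, h2, h3, h4, h5, h6, h7, h8, h9, h10, h11, h12, h13, h14⟩ := h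
        refine ⟨by simpa [a2], by simpa [a2], by simpa [a2] using h3, by simpa using a4,
          by simpa [a2], by simpa [a2], by simpa [a2], by simpa [a2], ?_, by simpa [a1],
          by simpa [a1], ?_, ?_, h14⟩
        · simp [IntExpr.eval, a2, h9]
        · simp [IntExpr.eval, RealExpr.eval, a9, a1, hE.X]
        · simp [IntExpr.eval, RealExpr.eval, a9, a1, hE.X, h12]
      · simpa using a3
      · simp only [Test.cost, RealExpr.cost, IntExpr.cost]
        omega
    · by_contra hn
      obtain ⟨j, hj, hji⟩ := hf.surj (hI.act_lt i)
      refine hi ((hpr.mem i).mpr ⟨j, hlt j hj ?_, hji⟩)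
      rw [hji, hI.X_act]
      exact not_le.mp hn
    · obtain ⟨j, hj, hji⟩ := hf.surj (hI.act_lt i)
      have := hgap j hj
      rwa [hji, hI.X_act] at this
    · obtain ⟨j, hj, hji⟩ := hf.surj (hI.oth_lt i)
      have := hgap j hj
      rwa [hji, hI.X_oth] at this
  · intro h0
    simp only [Test.Holds, RealExpr.eval, IntExpr.eval, h.X, hE.X, h9] at h0
    apply Wp.skip
    refine ⟨hE, fun _ _ _ => rfl, s, Xp, d, h, hinv, le_antisymm hxe (not_lt.mp h0), rfl, h8, hpr, ?_⟩
    simp only [Test.cost, RealExpr.cost, IntExpr.cost]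
    omega

/-- Process the endpoint whose rank is held in register `7`. -/
def sweepStep : Program :=
  .seq (.set 9 (.read 4 (reg 7))) <|
  .seq align <|
  .seq (partner 9 10) <|
  .seq (.set 7 (.add (reg 7) (.const 1))) <|
  .branch (.realLt (.read 4 (reg 9)) (.read 4 (reg 10))) horizontal <|
  .branch (.and (.not (.realLt (.read 4 (reg 10)) (.read 4 (reg 9))))
    (.realLt (.read 5 (reg 9)) (.read 5 (reg 10)))) vertical .skip

theorem Keeps.env {m : ℕ} (h : Keeps m σ τ) (hm : 7 ≤ m) (hE : Env n X Y pos f l σ) :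
    Env n X Y pos f l τ :=
  hE.congr (fun x hx => h.int x (by omega)) (h.real 4 (by norm_num)) (h.real 5 (by norm_num))

theorem Progress.succ_of_eq (hI : Items S X Y pos act oth) {x : ℝ} {P : Set (Fin n)}
    (h : Progress X f act x P e d) {i : Fin n} (hi : f e = act i) (hx : X (f e) = x) :
    Progress X f act x (insert i P) (e + 1) d where
  mem j := by
    rw [Set.mem_insert_iff, h.mem]
    constructor
    · rintro (rfl | ⟨l, hl, hlj⟩)
      · exact ⟨e, by omega, hi⟩
      · exact ⟨l, by omega, hlj⟩
    · rintro ⟨l, hl, hlj⟩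
      rcases Nat.lt_succ_iff_lt_or_eq.mp hl with hl | rfl
      · exact .inr ⟨l, hl, hlj⟩
      · exact .inl (hI.act_inj (hlj.symm.trans hi))
  le j hj := by
    rcases Nat.lt_succ_iff_lt_or_eq.mp hj with hj | rfl
    · exact h.le j hj
    · exact hx.le
  ge j hj := h.ge j (by omega)
  behind := h.behind
  ahead := h.ahead

theorem Progress.succ_of_ne {x : ℝ} {P : Set (Fin n)}
    (h : Progress X f act x P e d) (hi : ∀ i, f e ≠ act i) (hx : X (f e) = x) :
    Progress X f act x P (e + 1) d where
  mem j := by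
    rw [h.mem]
    constructor
    · rintro ⟨l, hl, hlj⟩
      exact ⟨l, by omega, hlj⟩
    · rintro ⟨l, hl, hlj⟩
      rcases Nat.lt_succ_iff_lt_or_eq.mp hl with hl | rfl
      · exact ⟨l, hl, hlj⟩
      · exact absurd hlj (hi j)
  le j hj := by
    rcases Nat.lt_succ_iff_lt_or_eq.mp hj with hj | rfl
    · exact h.le j hj
    · exact hx.le
  ge j hj := h.ge j (by omega)
  behind := h.behind
  ahead := h.ahead

/-- A segment is processed at its left or lower end, which the two tests recognise; the other end
passes neither test. The number of paid segments is therefore the cardinality of `P`. -/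
theorem sweepStep_spec (hk : 0 < k) (hI : Items S X Y pos act oth) (hE : Env n X Y pos f l σ)
    (hf : IsSorting X (2 * n) f) {P u φ Xp} (hinv : S.Inv k s P ∅ P.ncard u φ Xp)
    (h : Rep S k L σ s) (he : e < 2 * n) (h7 : σ.int 7 0 = e) (h8 : σ.int 8 0 = d)
    (hpr : Progress X f act s.X P e d) :
    Wp sweepStep σ fun τ t => Env n X Y pos f l τ ∧ τ.int 7 0 = e + 1 ∧
      ∃ s' P' u' φ' Xp' d', Rep S k L τ s' ∧ S.Inv k s' P' ∅ P'.ncard u' φ' Xp' ∧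
        τ.int 8 0 = d' ∧ Progress X f act s'.X P' (e + 1) d' ∧
        t + 200 * ((L + 1) * (2 * n - d')) + 1000 * ((L + 1) * s'.B.card) ≤
          200 * ((L + 1) * (2 * n - d)) + 1000 * ((L + 1) * s.B.card) + 8500 * (L + 1) := by
  obtain ⟨i, hi⟩ := hI.exists_eq (hf.lt e he)
  obtain ⟨t', ht'⟩ : ∃ t', (f e = act i ∧ t' = oth i) ∨ (f e = oth i ∧ t' = act i) := by
    rcases hi with h | h
    · exact ⟨_, .inl ⟨h, rfl⟩⟩
    · exact ⟨_, .inr ⟨h, rfl⟩⟩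
  apply Wp.seq; apply Wp.setInt; apply Wp.seq
  refine (align_spec (L := L) (d := d) (e := e) hI (hE.congr (fun x hx => ?_) ?_ ?_) hf hinv ?_ he ?_
    ?_ hpr).mono ?_
  · simp [show x ≠ 9 by omega]
  · rfl
  · rfl
  · refine h.congr (fun x _ hx => ?_) rfl
    simp [show x ≠ 9 by omega]
  · simp [IntExpr.eval, hE.order, h7]
  · simpa using h8
  rintro τ₁ t₁ ⟨hE₁, a2, s₁, X₁, d', r₁, hinv₁, hX₁, hB₁, a8, hpr₁, a3⟩
  have a7 : τ₁.int 7 0 = e := by rw [a2 7 (by norm_num) (by norm_num)]; simpa using h7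
  have a9 : τ₁.int 9 0 = f e := by
    rw [a2 9 (by norm_num) (by norm_num)]; simp [IntExpr.eval, hE.order, h7]
  apply Wp.seq
  refine (partner_spec (t := f e) (t' := t') hI hE₁.segments a9 ht').mono ?_
  rintro τ₂ t₂ ⟨b1, b2, b3, b4⟩
  apply Wp.seq; apply Wp.setInt
  set τ₃ := τ₂.setInt 7 ((IntExpr.const 0).eval τ₂) (((reg 7).add (.const 1)).eval τ₂) with hτ₃
  have c0 : ∀ x, x ≠ 7 → x ≠ 10 → τ₃.int x = τ₁.int x := fun x hx hx' => by
    simp [hτ₃, hx, b3 x hx']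
  have c1 : τ₃.real = τ₁.real := b2
  have hE₃ : Env n X Y pos f l τ₃ :=
    hE₁.congr (fun x hx => c0 x (by omega) (by omega)) (by rw [c1]) (by rw [c1])
  have r₃ : Rep S k L τ₃ s₁ := r₁.congr (fun x _ hx => c0 x (by omega) (by omega)) c1
  have c7 : τ₃.int 7 0 = e + 1 := by simp [hτ₃, IntExpr.eval, b3, a7]
  have c8 : τ₃.int 8 0 = d' := by rw [c0 8 (by norm_num) (by norm_num), a8]
  have c9 : τ₃.int 9 0 = f e := by rw [c0 9 (by norm_num) (by norm_num), a9]
  have c10 : τ₃.int 10 0 = t' := by simp [hτ₃, b4]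
  have hnotMem : f e = act i → i ∉ P := by
    intro hfi hi
    obtain ⟨j, hj, hji⟩ := (hpr.mem i).mp hi
    have := hf.inj j (by omega) e he (hji.trans hfi.symm)
    omega
  have hncard : f e = act i → (insert i P).ncard = P.ncard + 1 := fun hfi =>
    Set.ncard_insert_of_notMem (hnotMem hfi) (Set.toFinite _)
  rw [← hB₁]
  apply Wp.branch
  · intro h0
    simp only [Test.Holds, RealExpr.eval, IntExpr.eval, hE₃.X, c9, c10] at h0
    obtain ⟨hfi, rfl⟩ : f e = act i ∧ t' = oth i := by
      refine ht'.resolve_right fun ⟨g1, g2⟩ => ?_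
      rw [g1, g2, hI.X_act, hI.X_oth] at h0
      exact absurd (Scene.xl_le_xr i) (not_le.mpr h0)
    have hiX : S.xl i = s₁.X := by rw [hX₁, hfi, hI.X_act]
    rw [hfi, hI.X_act, hI.X_oth] at h0
    refine (horizontal_spec (i := i) hk hinv₁ r₃ (hnotMem hfi) hiX h0
      (by rw [c9, hE₃.pos, hfi, hI.pos_act])).mono ?_
    rintro τ₄ t₄ ⟨d1, s', u', φ', r', hinv', d2⟩
    have hX' : s'.X = s₁.X := by rw [← r'.X, d1.real 7 (by norm_num), r₃.X]
    refine ⟨d1.env (by norm_num) hE₃, by rw [d1.int 7 (by norm_num), c7], s', insert i P, u', φ', X₁,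
      d', r', by rw [hncard hfi]; exact hinv', by rw [d1.int 8 (by norm_num), c8], ?_, ?_⟩
    · rw [hX']
      exact hpr₁.succ_of_eq hI hfi hX₁.symm
    · simp only [Test.cost, RealExpr.cost, IntExpr.cost]
      omega
  intro h0
  simp only [Test.Holds, RealExpr.eval, IntExpr.eval, hE₃.X, c9, c10] at h0
  apply Wp.branch
  · intro h1
    simp only [Test.Holds, RealExpr.eval, IntExpr.eval, hE₃.X, hE₃.Y, c9, c10] at h1
    obtain ⟨hfi, rfl⟩ : f e = act i ∧ t' = oth i := by
      refine ht'.resolve_right fun ⟨g1, g2⟩ => ?_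
      rw [g1, g2, hI.Y_act, hI.Y_oth] at h1
      exact absurd (Scene.yl_le_yr i) (not_le.mpr h1.2)
    have hiX : S.xl i = s₁.X := by rw [hX₁, hfi, hI.X_act]
    rw [hfi, hI.X_act, hI.X_oth] at h0
    refine (vertical_spec (V := i) hk hinv₁ r₃ (le_antisymm (Scene.xl_le_xr i) (not_lt.mp h0)) hiX
      (by rw [c9, hE₃.pos, hfi, hI.pos_act]) (by rw [c10, hE₃.pos, hI.pos_oth])).mono ?_
    rintro τ₄ t₄ ⟨d1, s', u', φ', r', hinv', d2⟩
    have hX' : s'.X = s₁.X := by rw [← r'.X, d1.real 7 (by norm_num), r₃.X]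
    refine ⟨d1.env (by norm_num) hE₃, by rw [d1.int 7 (by norm_num), c7], s', insert i P, u', φ', X₁,
      d', r', by rw [hncard hfi]; exact hinv', by rw [d1.int 8 (by norm_num), c8], ?_, ?_⟩
    · rw [hX']
      exact hpr₁.succ_of_eq hI hfi hX₁.symm
    · simp only [Test.cost, RealExpr.cost, IntExpr.cost]
      omega
  · intro h1
    simp only [Test.Holds, RealExpr.eval, IntExpr.eval, hE₃.X, hE₃.Y, c9, c10] at h1
    apply Wp.skip
    refine ⟨hE₃, c7, s₁, P, u, φ, X₁, d', r₃, hinv₁, c8,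
      hpr₁.succ_of_ne (fun j hj => ?_) hX₁.symm, ?_⟩
    · rcases ht' with ⟨g1, g2⟩ | ⟨g1, g2⟩
      · rw [g1, g2, hI.X_act, hI.X_oth] at h0 h1
        rw [hI.Y_act, hI.Y_oth] at h1
        rcases S.shape i with hs | hs
        · exact h0 hs.1
        · exact h1 ⟨by rw [hs.1]; exact lt_irrefl _, hs.2⟩
      · have e1 := hI.cases i
        have e2 := hI.cases j
        have e3 := i.isLt
        have e4 := j.isLt
        have : i = j := by ext; omega
        subst this
        omega
    · simp only [Test.cost, RealExpr.cost, IntExpr.cost]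
      omega

/-- Process all endpoints. -/
def sweep : Program := .loop (.intLt (reg 7) (reg 2)) sweepStep

theorem sweep_spec (hk : 0 < k) (hI : Items S X Y pos act oth) (hE : Env n X Y pos f l σ)
    (hf : IsSorting X (2 * n) f) {u φ Xp} (hinv : S.Inv k s ∅ ∅ 0 u φ Xp)
    (h : Rep S k L σ s) (h7 : σ.int 7 0 = 0) (h8 : σ.int 8 0 = 0) (hB : s.B.card ≤ 2)
    (hX : ∀ j < 2 * n, s.X ≤ X (f j)) :
    Wp sweep σ fun τ t => t ≤ 20000 * ((L + 1) * (n + 1)) ∧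
      Env n X Y pos f l τ ∧ ∃ s' u' φ' Xp', Rep S k L τ s' ∧ S.Inv k s' Set.univ ∅ n u' φ' Xp' := by
  -- The three terms of the potential pay for endpoints still to be left behind, for boundaries that
  -- may be merged away, and for endpoints still to be processed.
  refine Wp.loop_potential (fun υ p => Env n X Y pos f l υ ∧ ∃ s' P' u' φ' Xp' e d, υ.int 7 0 = e ∧
    υ.int 8 0 = d ∧ e ≤ 2 * n ∧ Rep S k L υ s' ∧ S.Inv k s' P' ∅ P'.ncard u' φ' Xp' ∧
    Progress X f act s'.X P' e d ∧ p = 200 * ((L + 1) * (2 * n - d)) +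
      1000 * ((L + 1) * s'.B.card) + 8510 * ((L + 1) * (2 * n - e))) ?_
    ⟨hE, s, ∅, u, φ, Xp, 0, 0, h7, h8, by omega, h, by simpa using hinv,
      ⟨by simp, by simp, fun j _ => hX j, by simp, fun j _ => hX j⟩, rfl⟩ ?_
  · rintro υ p ⟨hE', s', P', u', φ', Xp', e, d, g7, g8, he, r', hinv', hpr, rfl⟩ hlt
    simp only [Test.Holds, IntExpr.eval, g7, hE'.items] at hlt
    refine (sweepStep_spec hk hI hE' hf hinv' r' hlt g7 g8 hpr).mono ?_
    rintro ω t ⟨hE'', i7, s'', P'', u'', φ'', Xp'', d'', r'', hinv'', i8, hpr'', ht⟩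
    refine ⟨_, ⟨hE'', s'', P'', u'', φ'', Xp'', e + 1, d'', i7, i8, by omega, r'', hinv'', hpr'', rfl⟩,
      ?_⟩
    have : 2 * n - e = 2 * n - (e + 1) + 1 := by omega
    rw [this, mul_add (L + 1) _ 1]
    simp only [Test.cost, IntExpr.cost]
    omega
  · rintro υ t p ⟨hE', s', P', u', φ', Xp', e, d, g7, g8, he, r', hinv', hpr, rfl⟩ hlt ht
    simp only [Test.Holds, IntExpr.eval, g7, hE'.items] at hlt
    obtain rfl : e = 2 * n := by omega
    have hP : P' = Set.univ := by
      ext i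
      simp only [Set.mem_univ, iff_true]
      exact (hpr.mem i).mpr (hf.surj (hI.act_lt i))
    subst hP
    rw [Set.ncard_univ, Nat.card_fin] at hinv'
    refine ⟨?_, hE', s', u', φ', Xp', r', hinv'⟩
    have h1 := Nat.mul_le_mul_left (L + 1) hB
    simp only [Test.cost, IntExpr.cost] at ht
    rw [mul_add (L + 1) n 1]
    have h2 : (L + 1) * (2 * n - 0) = 2 * ((L + 1) * n) := by rw [Nat.sub_zero]; ring
    omega

end RealRAM

/-! ### Remaining modems and the final count -/

namespace RealRAM

variable {n : ℕ} {S : Scene n} {k L : ℕ} {s : Sweep} {σ τ υ : State} {b c d e : ℕ}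

/-- Locate the modems that are still due after the sweep, and return the number of modems. -/
def finish : Program :=
  .seq (.rset 8 (.add (rreg 7) (.const 1))) <|
  .seq (.set 9 (.const 0)) <|
  .seq (.loop (.intLt (reg 9) (reg 6))
    (.seq (nextBoundary (reg 9) 10) <| .seq (discharge 9 10) <| .set 9 (reg 10))) <|
  .set 0 (reg 20)

/-- Each cell that still owes a modem holds `8k` and pays `6k`; no other credit is negative. The
cell of boundary `0` keeps at least `2k` in either phase, which turns the initial `8k` into `6k`,
that is, one extra modem. -/
theorem count_final {P D cr u φ Xp} (hinv : S.Inv k s P D cr u φ Xp) :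
    6 * k * (s.M + (s.B.filter fun b => b < S.top ∧ s.ph b = 0).card) ≤ 6 * k + 36 * cr := by
  have h1 : ∀ b ∈ s.B, 0 ≤ φ b - 6 * (k : ℤ) * (if b < S.top ∧ s.ph b = 0 then 1 else 0) ∧
      (b < S.top → 2 * (k : ℤ) ≤ φ b - 6 * k * (if b < S.top ∧ s.ph b = 0 then 1 else 0)) := by
    intro b hb
    rcases (hinv.le_top b hb).lt_or_eq with hlt | rfl
    · obtain ⟨c, hbc⟩ := exists_adj hb hinv.top_mem hlt
      have hc := (hinv.cell b c hbc).credit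
      have h4 := hc.four_mul_le
      by_cases h0 : s.ph b = 0
      · rw [h0] at hc
        have h8 := CreditOK.eight_mul_le_of_zero hc
        rw [if_pos ⟨hlt, h0⟩]
        constructor
        · linarith
        · intro _; linarith
      · rw [if_neg (fun h => h0 h.2)]
        constructor
        · linarith
        · intro _; linarith
    · rw [if_neg (fun h => lt_irrefl _ h.1)]
      have := hinv.top_credit
      exact ⟨by linarith, fun h => absurd h (lt_irrefl _)⟩
  have h2 := (h1 0 hinv.zero_mem).2 S.top_pos
  have h3 := Finset.single_le_sum (f := fun b => φ b - 6 * (k : ℤ) *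
    (if b < S.top ∧ s.ph b = 0 then 1 else 0)) (fun b hb => (h1 b hb).1) hinv.zero_mem
  rw [Finset.sum_sub_distrib, ← Finset.mul_sum, Finset.sum_boole] at h3
  have h4 := hinv.total
  generalize (s.B.filter fun b => b < S.top ∧ s.ph b = 0).card = q at h3 ⊢
  zify
  linarith

theorem finish_spec {u φ Xp} (hinv : S.Inv k s Set.univ ∅ n u φ Xp) (h : Rep S k L σ s)
    (h6 : σ.int 6 0 = S.top) :
    Wp finish σ fun τ t => t ≤ 400 * ((L + 1) * (S.top + 1)) ∧
      6 * k * τ.int 0 0 ≤ 6 * k + 36 * n ∧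
      ∀ p, ∃ j < τ.int 0 0, S.Sees k (τ.real 0 j, τ.real 1 j) p := by
  apply Wp.seq; apply Wp.setReal; apply Wp.seq; apply Wp.setInt; apply Wp.seq
  -- The modems due are now placed to the right of the line, at `s.X + 1`, which the invariant of
  -- the sweep forbids. So only the facts needed about `s'` are carried along, while `hinv` keeps
  -- speaking of `s`.
  refine Wp.loop_potential (fun υ p => ∃ s' c, Rep S k L υ s' ∧ υ.int 9 0 = c ∧ υ.int 6 0 = S.top ∧
    c ∈ s.B ∧ s'.B = s.B ∧ s'.ph = s.ph ∧ s'.m = s.X + 1 ∧ s.M ≤ s'.M ∧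
    (∀ j < s.M, s'.loc j = s.loc j) ∧
    (∀ b d, Adj s.B b d → b < c → s.ph b = 0 →
      ∃ j < s'.M, s'.loc j = (s.X + 1, (S.ht b + S.ht d) / 2)) ∧
    s'.M ≤ s.M + (s.B.filter fun b => b < c ∧ s.ph b = 0).card ∧
    p = 300 * ((L + 1) * (S.top - c))) ?_
    ⟨{ s with m := s.X + 1 }, 0, ?_, ?_, ?_, hinv.zero_mem, rfl, rfl, rfl, le_rfl, fun _ _ => rfl,
      fun b d _ hb => absurd hb (Nat.not_lt_zero _), Nat.le_add_right _ _, rfl⟩ ?_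
  · rintro υ p ⟨s', c, r', i1, i2, i3, i4, i5, i6, i7, i8, i9, i10, rfl⟩ hlt
    simp only [Test.Holds, IntExpr.eval, i1, i2] at hlt
    obtain ⟨d, hcd⟩ := exists_adj i3 hinv.top_mem hlt
    have hcd' : Adj s'.B c d := by rwa [i4]
    have hdt := hinv.le_top d hcd.2.1
    have hcdlt := hcd.2.2.1
    apply Wp.seq
    refine (nextBoundary_spec r' (by rw [i4]; exact hinv.le_top) (by simpa [IntExpr.eval])
      hcd').mono ?_
    rintro τ₁ t₁ ⟨a1, a2, a3, a4⟩
    have r₁ : Rep S k L τ₁ s' := r'.congr (fun x hx hx' => a3 x (by omega) (by omega)) a2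
    apply Wp.seq
    refine (discharge_spec r₁ (b := c) (c := d) (by rw [a3 9 (by norm_num) (by norm_num), i1]) a4
      hlt.le hdt).mono ?_
    rintro τ₂ t₂ ⟨b1, b2, b3, r₂⟩
    apply Wp.setInt
    refine ⟨_, ⟨S.discharge s' c d, d, r₂.congr (fun x _ hx => ?_) rfl, ?_, ?_, hcd.2.1, by simpa,
      by simpa, by simpa, i7.trans (Scene.le_discharge_M _ _ _), fun j hj => ?_,
      fun b e hbe hbd h0 => ?_, ?_, rfl⟩, ?_⟩
    · simp [show x ≠ 9 by omega]
    · simp [IntExpr.eval, b2, a4]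
    · simp [b2, a3, i2]
    · rw [Scene.discharge_loc _ _ _ (hj.trans_le i7), i8 j hj]
    · rcases lt_or_ge b c with hbc | hbc
      · obtain ⟨j, hj, hloc⟩ := i9 b e hbe hbc h0
        exact ⟨j, hj.trans_le (Scene.le_discharge_M _ _ _), by
          rw [Scene.discharge_loc _ _ _ hj, hloc]⟩
      · obtain rfl : b = c := by
          have := hcd.2.2.2 b hbe.1
          omega
        obtain rfl : e = d := hbe.right_unique hcd
        obtain ⟨g1, g2⟩ := Scene.discharge_new (S := S) s' b e (by rw [i5, h0])
        exact ⟨_, g1, by rw [g2, i6]⟩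
    · rw [Scene.discharge_M, i5]
      have hsub : (s.B.filter fun b => b < c ∧ s.ph b = 0) ⊆
          s.B.filter fun b => b < d ∧ s.ph b = 0 := fun x hx => by
        simp only [Finset.mem_filter] at hx ⊢
        exact ⟨hx.1, by omega, hx.2.2⟩
      split_ifs with h0
      · have : (s.B.filter fun b => b < c ∧ s.ph b = 0).card + 1 ≤
            (s.B.filter fun b => b < d ∧ s.ph b = 0).card := by
          refine Finset.card_lt_card (Finset.ssubset_iff_subset_ne.mpr ⟨hsub, fun he => ?_⟩)
          have hc : c ∈ s.B.filter fun b => b < d ∧ s.ph b = 0 := by simp [i3, hcdlt, h0]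
          rw [← he] at hc
          simp at hc
        omega
      · have := Finset.card_le_card hsub
        omega
    · have h1 : S.top - c = (S.top - d) + (d - c) := by omega
      have h2 := Nat.mul_le_mul_left (L + 1) (show 1 ≤ d - c by omega)
      rw [h1, mul_add (L + 1)]
      simp only [Test.cost, IntExpr.cost] at *
      omega
  · obtain ⟨h1, h2, h3, h4, h5, h6, h7, h8, h9, h10, h11, h12, h13, h14⟩ := h
    refine ⟨by simpa, by simpa, by simpa using h3, by simpa using h4, by simpa, by simpa, by simpa,
      by simpa, by simpa, by simpa using h10, by simpa using h11, by simpa, ?_, h14⟩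
    simp [IntExpr.eval, RealExpr.eval, h12]
  · simp [IntExpr.eval]
  · simpa using h6
  · rintro υ t p ⟨s', c, r', i1, i2, i3, i4, i5, i6, i7, i8, i9, i10, rfl⟩ hlt ht
    simp only [Test.Holds, IntExpr.eval, i1, i2] at hlt
    have hct := hinv.le_top c i3
    obtain rfl : c = S.top := by omega
    apply Wp.setInt
    have hM : (υ.setInt 0 ((IntExpr.const 0).eval υ) ((reg 20).eval υ)).int 0 0 = s'.M := by
      simp [IntExpr.eval, r'.M]
    refine ⟨?_, ?_, fun p => ?_⟩
    · have h2 := Nat.mul_le_mul_left (L + 1) (show 1 ≤ S.top + 1 by omega)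
      have h1 : S.top - 0 + 1 = S.top + 1 := by omega
      have h3 := mul_add (L + 1) S.top 1
      simp only [Test.cost, IntExpr.cost, RealExpr.cost, Nat.sub_zero] at *
      omega
    · rw [hM]
      exact (Nat.mul_le_mul_left _ i10).trans (count_final hinv)
    · rw [hM]
      have key : ∃ j < s'.M, S.Sees k (s'.loc j) p := by
        rcases hinv.cover p with ⟨j, hj, hs⟩ | ⟨b, d, hbd, g1, g2, g3⟩
        · exact ⟨j, hj.trans_le i7, by rwa [i8 j hj]⟩
        · have hfin := hinv.sees_final hbd g1 g2 g3
          rcases hinv.ph_le hbd with h0 | h0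
          · have hlt := hinv.bd_lt_bd hbd
            obtain ⟨j, hj, hloc⟩ := i9 b d hbd (by omega) h0
            exact ⟨j, hj, by rw [hloc]; exact hfin.2⟩
          · obtain ⟨j, hj, hs⟩ := hfin.1 h0
            exact ⟨j, hj.trans_le i7, by rwa [i8 j hj]⟩
      obtain ⟨j, hj, hs⟩ := key
      refine ⟨j, hj, ?_⟩
      have := r'.loc j hj
      rw [← this] at hs
      exact hs

end RealRAM

/-! ### Preparation: tree size, copying and numbering the heights -/

namespace RealRAM

variable {n k L : ℕ} {σ τ υ : State}

/-- Register `1` receives a power of two that is at least the number in register `2` plus two. -/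
def double : Program :=
  .seq (.set 1 (.const 1)) <|
  .loop (.intLt (reg 1) (.add (reg 2) (.const 2))) (.set 1 (.add (reg 1) (reg 1)))

/-- Positions run from `0` to at most `m + 1`, so `m + 2` leaves suffice; the upper bound on the
power of two makes its exponent logarithmic. -/
theorem double_spec {m : ℕ} (h2 : σ.int 2 0 = m) :
    Wp double σ fun τ t => t ≤ 40 * (m + 2) ∧ τ.real = σ.real ∧
      (∀ x, x ≠ 1 → τ.int x = σ.int x) ∧
      ∃ L, τ.int 1 0 = 2 ^ L ∧ m + 2 ≤ 2 ^ L ∧ 2 ^ L ≤ 2 * (m + 2) := by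
  apply Wp.seq; apply Wp.setInt
  refine Wp.loop_potential (fun υ p => υ.real = σ.real ∧ (∀ x, x ≠ 1 → υ.int x = σ.int x) ∧
    ∃ L, υ.int 1 0 = 2 ^ L ∧ 2 ^ L ≤ 2 * (m + 2) ∧ p = 20 * (m + 2 - 2 ^ L)) ?_
    ⟨by rfl, fun x hx => by simp [hx], 0, by simp [IntExpr.eval], by omega, rfl⟩ ?_
  · rintro υ p ⟨h3, h4, L, h5, h6, rfl⟩ hlt
    simp only [Test.Holds, IntExpr.eval, h5, h4 2 (by norm_num), h2] at hlt
    have hpos : 0 < 2 ^ L := by positivity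
    have hpow := pow_succ 2 L
    apply Wp.setInt
    refine ⟨_, ⟨h3, fun x hx => by simp [hx, h4 x hx], L + 1, ?_, by omega, rfl⟩, ?_⟩
    · simp [IntExpr.eval, h5]; omega
    · simp only [Test.cost, IntExpr.cost]
      omega
  · rintro υ t p ⟨h3, h4, L, h5, h6, rfl⟩ hlt ht
    simp only [Test.Holds, IntExpr.eval, h5, h4 2 (by norm_num), h2] at hlt
    refine ⟨?_, h3, h4, L, h5, by omega, h6⟩
    simp only [Test.cost, IntExpr.cost] at *
    omega

/-- Copy the coordinates of the endpoints to the real arrays `4` and `5`. -/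
def copyItems : Program :=
  .seq (.set 22 (.const 0)) <|
  .loop (.intLt (reg 22) (reg 0)) <|
    .seq (.setReal 4 (reg 22) (.read 0 (reg 22))) <|
    .seq (.setReal 4 (.add (reg 0) (reg 22)) (.read 2 (reg 22))) <|
    .seq (.setReal 5 (reg 22) (.read 1 (reg 22))) <|
    .seq (.setReal 5 (.add (reg 0) (reg 22)) (.read 3 (reg 22))) <|
    .set 22 (.add (reg 22) (.const 1))

/-- The coordinates are moved to the arrays `4` and `5` because the modem locations later overwrite
the input in the arrays `0` and `1`. -/
theorem copyItems_spec (h0 : σ.int 0 0 = n) :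
    Wp copyItems σ fun τ t => t ≤ 100 * (n + 1) ∧ (∀ x, x ≠ 22 → τ.int x = σ.int x) ∧
      ∀ i < n, τ.real 4 i = σ.real 0 i ∧ τ.real 4 (n + i) = σ.real 2 i ∧
        τ.real 5 i = σ.real 1 i ∧ τ.real 5 (n + i) = σ.real 3 i := by
  apply Wp.seq; apply Wp.setInt
  refine Wp.loop_potential (fun υ p => (∀ x < 4, υ.real x = σ.real x) ∧
    (∀ x, x ≠ 22 → υ.int x = σ.int x) ∧
    ∃ j, υ.int 22 0 = j ∧ j ≤ n ∧ p = 80 * (n - j) ∧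
      ∀ i < j, υ.real 4 i = σ.real 0 i ∧ υ.real 4 (n + i) = σ.real 2 i ∧
        υ.real 5 i = σ.real 1 i ∧ υ.real 5 (n + i) = σ.real 3 i) ?_
    ⟨fun _ _ => by rfl, fun x hx => by simp [hx], 0, by simp [IntExpr.eval], by omega, rfl,
      fun i hi => absurd hi (Nat.not_lt_zero i)⟩ ?_
  · rintro υ p ⟨h1, h2, j, h3, h4, rfl, h5⟩ hlt
    have hn : υ.int 0 0 = n := by rw [h2 0 (by norm_num), h0]
    simp only [Test.Holds, IntExpr.eval, h3, hn] at hlt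
    apply Wp.seq; apply Wp.setReal; apply Wp.seq; apply Wp.setReal; apply Wp.seq; apply Wp.setReal
    apply Wp.seq; apply Wp.setReal; apply Wp.setInt
    refine ⟨_, ⟨fun x hx => ?_, fun x hx => by simp [hx, h2 x hx], j + 1, by simp [IntExpr.eval, h3],
      hlt, rfl, fun i hi => ?_⟩, ?_⟩
    · simp [show x ≠ 4 by omega, show x ≠ 5 by omega, h1 x hx]
    · simp only [State.setInt_real, State.setReal_real, State.setReal_int, IntExpr.eval,
        RealExpr.eval, hn, h3]
      rcases Nat.lt_succ_iff_lt_or_eq.mp hi with hi | rfl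
      · have g1 : i ≠ n + j := by omega
        have g2 : n + i ≠ j := by omega
        simpa [hi.ne, g1, g2] using h5 i hi
      · have g1 : i ≠ n + i := by omega
        simp [h1, Function.update_of_ne g1]
    · simp only [Test.cost, IntExpr.cost, RealExpr.cost]
      omega
  · rintro υ t p ⟨h1, h2, j, h3, h4, rfl, h5⟩ hlt ht
    have hn : υ.int 0 0 = n := by rw [h2 0 (by norm_num), h0]
    simp only [Test.Holds, IntExpr.eval, h3, hn] at hlt
    obtain rfl : j = n := by omega
    refine ⟨?_, h2, h5⟩
    simp only [Test.cost, IntExpr.cost] at *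
    omega

/-- The numbers `0, …, top` stand for heights, and `pos t` stands for the height of the endpoint
`t`. -/
structure IsScale (Y : ℕ → ℝ) (m : ℕ) (pos : ℕ → ℕ) (ht : ℕ → ℝ) (top : ℕ) : Prop where
  top_le : top ≤ m + 1
  top_pos : 0 < top
  lt : ∀ a b, a < b → b ≤ top → ht a < ht b
  ht_pos : ∀ t < m, ht (pos t) = Y t
  pos_pos : ∀ t < m, 0 < pos t
  pos_lt : ∀ t < m, pos t < top

/-- Compute the scale of heights from the sorted endpoints. -/
def scale : Program :=
  .seq (.rset 6 (.sub (.read 5 (reg 5)) (.const 1))) <|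
  .seq (.set 22 (.const 0)) <|
  .seq (.set 23 (.const 0)) <|
  .seq (.loop (.intLt (reg 22) (reg 2)) <|
    .seq (.set 24 (.read 5 (reg 22))) <|
    .seq (.set 22 (.add (reg 22) (.const 1))) <|
    .branch (.realLt (.read 6 (reg 23)) (.read 5 (reg 24)))
      (.seq (.set 23 (.add (reg 23) (.const 1))) <|
       .seq (.setReal 6 (reg 23) (.read 5 (reg 24))) <|
       .setInt 3 (reg 24) (reg 23))
      (.setInt 3 (reg 24) (reg 23))) <|
  .seq (.set 6 (.add (reg 23) (.const 1))) <|
  .setReal 6 (reg 6) (.add (.read 6 (reg 23)) (.const 1))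

theorem scale_spec {Y : ℕ → ℝ} {m : ℕ} {f : ℕ → ℕ} (h2 : σ.int 2 0 = m) (h5 : σ.int 5 = f)
    (hY : σ.real 5 = Y) (hf : IsSorting Y m f) :
    Wp scale σ fun τ t => t ≤ 100 * (m + 1) ∧ (∀ x, x ≠ 6 → τ.real x = σ.real x) ∧
      (∀ x, x ≠ 3 → x ≠ 6 → x ≠ 22 → x ≠ 23 → x ≠ 24 → τ.int x = σ.int x) ∧
      IsScale Y m (τ.int 3) (τ.real 6) (τ.int 6 0) := by
  apply Wp.seq; apply Wp.setReal; apply Wp.seq; apply Wp.setInt; apply Wp.seq; apply Wp.setInt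
  apply Wp.seq
  refine Wp.loop_potential (fun υ p => (∀ x, x ≠ 6 → υ.real x = σ.real x) ∧
    (∀ x, x ≠ 3 → x ≠ 6 → x ≠ 22 → x ≠ 23 → x ≠ 24 → υ.int x = σ.int x) ∧
    ∃ j l, υ.int 22 0 = j ∧ υ.int 23 0 = l ∧ j ≤ m ∧ l ≤ j ∧
      (∀ a b, a < b → b ≤ l → υ.real 6 a < υ.real 6 b) ∧
      (∀ i < j, υ.real 6 (υ.int 3 (f i)) = Y (f i) ∧ 0 < υ.int 3 (f i) ∧ υ.int 3 (f i) ≤ l) ∧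
      (∀ i, j ≤ i → i < m → υ.real 6 l ≤ Y (f i)) ∧
      -- Position `0` is one unit below the lowest endpoint, so the first endpoint necessarily opens
      -- position `1` and all endpoints get positive positions.
      (l = 0 → ∀ i < m, υ.real 6 0 < Y (f i)) ∧ p = 70 * (m - j)) ?_
    ⟨fun x hx => by simp [hx], fun x h3 h6 h22 h23 h24 => by simp [h22, h23], 0, 0,
      by simp [IntExpr.eval], by simp [IntExpr.eval], by omega, le_rfl, fun a b h1 h2 => by omega,
      fun i hi => by omega, ?_, ?_, rfl⟩ ?_
  · rintro υ p ⟨g1, g2, j, l, g3, g4, g5, g6, g7, g8, g9, g10, rfl⟩ hlt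
    simp only [Test.Holds, IntExpr.eval, g3, g2 2 (by norm_num) (by norm_num) (by norm_num) (by norm_num)
      (by norm_num), h2] at hlt
    have hYυ : υ.real 5 = Y := by rw [g1 5 (by norm_num), hY]
    have hfυ : υ.int 5 = f := by
      rw [g2 5 (by norm_num) (by norm_num) (by norm_num) (by norm_num) (by norm_num), h5]
    have hfne : ∀ i < j, f i ≠ f j := fun i hi he => by
      have := hf.inj i (by omega) j hlt he
      omega
    apply Wp.seq; apply Wp.setInt; apply Wp.seq; apply Wp.setInt
    apply Wp.branch
    · intro h0
      simp [Test.Holds, IntExpr.eval, RealExpr.eval, g3, g4, hYυ, hfυ] at h0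
      apply Wp.seq; apply Wp.setInt; apply Wp.seq; apply Wp.setReal; apply Wp.setInt
      refine ⟨_, ⟨fun x hx => by simp [hx, g1 x hx], fun x k3 k6 k22 k23 k24 => ?_, j + 1, l + 1,
        ?_, ?_, hlt, by omega, ?_, ?_, ?_, fun h => by omega, rfl⟩, ?_⟩
      · simp [k3, k22, k23, k24, g2 x k3 k6 k22 k23 k24]
      · simp [IntExpr.eval, g3]
      · simp [IntExpr.eval, g4]
      · intro a b hab hb
        simp only [State.setInt_real, State.setReal_real, if_true, IntExpr.eval, RealExpr.eval,
          State.setInt_int, g4, g3, hYυ, hfυ, Function.update_self, Nat.reduceEqDiff, if_false]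
        rcases hb.lt_or_eq with hb | rfl
        · rw [Function.update_of_ne (by omega), Function.update_of_ne (by omega)]
          exact g7 a b hab (by omega)
        · rw [Function.update_of_ne (by omega), Function.update_self]
          refine lt_of_le_of_lt ?_ h0
          rcases (show a ≤ l by omega).lt_or_eq with h | rfl
          · exact (g7 a l h le_rfl).le
          · exact le_rfl
      · intro i hi
        simp only [State.setInt_real, State.setReal_real, State.setReal_int, if_true, IntExpr.eval,
          RealExpr.eval, State.setInt_int, g4, g3, hYυ, hfυ, Function.update_self,
          Nat.reduceEqDiff, if_false]
        rcases Nat.lt_succ_iff_lt_or_eq.mp hi with hi | rfl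
        · obtain ⟨k1, k2, k3⟩ := g8 i hi
          rw [Function.update_of_ne (hfne i hi), Function.update_of_ne (by omega)]
          exact ⟨k1, k2, by omega⟩
        · simp
      · intro i hi him
        simp only [State.setInt_real, State.setReal_real, if_true, IntExpr.eval, RealExpr.eval,
          State.setInt_int, g4, g3, hYυ, hfυ, Function.update_self, Nat.reduceEqDiff, if_false]
        exact hf.mono j i (by omega) him
      · simp only [Test.cost, IntExpr.cost, RealExpr.cost]
        omega
    · intro h0
      simp [Test.Holds, IntExpr.eval, RealExpr.eval, g3, g4, hYυ, hfυ] at h0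
      -- The order gives one inequality and the failed test the other: the endpoint is as high as
      -- the last position and shares it.
      have heq : υ.real 6 l = Y (f j) := le_antisymm (g9 j le_rfl hlt) h0
      have hl : 0 < l := by
        rcases Nat.eq_zero_or_pos l with rfl | hl
        · exact absurd heq (g10 rfl j hlt).ne
        · exact hl
      apply Wp.setInt
      refine ⟨_, ⟨fun x hx => by simp [g1 x hx], fun x k3 k6 k22 k23 k24 => ?_, j + 1, l,
        ?_, ?_, hlt, by omega, g7, ?_, fun i hi => g9 i (by omega), g10, rfl⟩, ?_⟩
      · simp [k3, k22, k24, g2 x k3 k6 k22 k23 k24]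
      · simp [IntExpr.eval, g3]
      · simp [g4]
      · intro i hi
        simp only [State.setInt_real, if_true, IntExpr.eval,
          State.setInt_int, g4, g3, hfυ, Function.update_self, Nat.reduceEqDiff, if_false]
        rcases Nat.lt_succ_iff_lt_or_eq.mp hi with hi | rfl
        · rw [Function.update_of_ne (hfne i hi)]
          exact g8 i hi
        · simp [heq, hl]
      · simp only [Test.cost, IntExpr.cost, RealExpr.cost]
        omega
  · intro i _ him
    have := hf.mono 0 i (Nat.zero_le i) him
    simp only [State.setInt_real, State.setReal_real, if_true, IntExpr.eval, RealExpr.eval, h5, hY,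
      Function.update_self]
    push_cast
    linarith
  · intro _ i him
    have := hf.mono 0 i (Nat.zero_le i) him
    simp only [State.setInt_real, State.setReal_real, if_true, IntExpr.eval, RealExpr.eval, h5, hY,
      Function.update_self]
    push_cast
    linarith
  · rintro υ t p ⟨g1, g2, j, l, g3, g4, g5, g6, g7, g8, g9, g10, rfl⟩ hlt ht
    simp only [Test.Holds, IntExpr.eval, g3, g2 2 (by norm_num) (by norm_num) (by norm_num) (by norm_num)
      (by norm_num), h2] at hlt
    obtain rfl : j = m := by omega
    apply Wp.seq; apply Wp.setInt; apply Wp.setReal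
    have e6 : (υ.setInt 6 ((IntExpr.const 0).eval υ) (((reg 23).add (.const 1)).eval υ)).int 6 0 =
        l + 1 := by simp [IntExpr.eval, g4]
    have hval : ∀ t < j, ∃ i < j, f i = t := fun t ht => hf.surj ht
    refine ⟨?_, fun x hx => by simp [hx, g1 x hx], fun x k3 k6 k22 k23 k24 => ?_, ?_⟩
    · simp only [Test.cost, IntExpr.cost, RealExpr.cost] at *
      omega
    · simp [k6, g2 x k3 k6 k22 k23 k24]
    · have hr : ∀ a ≤ l, Function.update (υ.real 6) (l + 1) (υ.real 6 l + 1) a = υ.real 6 a :=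
        fun a ha => Function.update_of_ne (by omega) _ _
      simp only [State.setInt_real, State.setReal_real, State.setReal_int, if_true, IntExpr.eval,
        RealExpr.eval, State.setInt_int, g4, Function.update_self, Nat.reduceEqDiff, if_false, Rat.cast_one]
      refine ⟨by omega, by omega, fun a b hab hb => ?_, fun t ht => ?_, fun t ht => ?_,
        fun t ht => ?_⟩
      · rw [hr a (by omega)]
        rcases hb.lt_or_eq with hb | rfl
        · rw [hr b (by omega)]
          exact g7 a b hab (by omega)
        · rw [Function.update_self]
          rcases (show a ≤ l by omega).lt_or_eq with h | rfl
          · have := g7 a l h le_rfl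
            linarith
          · linarith
      · obtain ⟨i, hi, rfl⟩ := hval t ht
        rw [hr _ (g8 i hi).2.2]
        exact (g8 i hi).1
      · obtain ⟨i, hi, rfl⟩ := hval t ht
        exact (g8 i hi).2.1
      · obtain ⟨i, hi, rfl⟩ := hval t ht
        exact Nat.lt_succ_of_le (g8 i hi).2.2

end RealRAM

namespace RealRAM

variable {n k L : ℕ} {σ τ υ : State}

/-- Copy and sort the endpoints and store the initial state of the sweep. -/
def prepare : Program :=
  .seq (.set 2 (.add (reg 0) (reg 0))) <|
  .seq double <|
  .seq copyItems <|
  .seq (sort 4 40 4) <|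
  .seq (sort 5 41 5) <|
  .seq scale <|
  .seq (.set 30 (.const 0)) <|
  .seq (insertElem 15) <|
  .seq (.set 30 (reg 6)) <|
  .seq (insertElem 15) <|
  .seq (.set 21 (.const 1)) <|
  .seq (.rset 7 (.sub (.read 4 (reg 4)) (.const 1))) <|
  .rset 8 (.sub (rreg 7) (.const 1))

/-- The storage is ready for the sweep. -/
structure Prepared (n k L : ℕ) (X Y : ℕ → ℝ) (σ : State) : Prop where
  env : Env n X Y (σ.int 3) (σ.int 4) (σ.int 6 0) σ
  sorting : IsSorting X (2 * n) (σ.int 4)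
  scale : IsScale Y (2 * n) (σ.int 3) (σ.real 6) (σ.int 6 0)
  size : σ.int 1 0 = 2 ^ L
  quota : σ.int 0 1 = k
  boundaries : StoresSet L (σ.int 15) {0, σ.int 6 0}
  zero : ∀ x, 7 ≤ x → x < 21 → x ≠ 15 → ∀ q, σ.int x q = 0
  line : σ.int 21 0 = 1
  abscissa : σ.real 7 0 = X (σ.int 4 0) - 1
  before : σ.real 8 0 = X (σ.int 4 0) - 2

/-- The two sorts use separate tournament arrays, `40` and `41`, because `sort_spec` asks for an
array that is zero throughout. -/
theorem prepare_spec (h0 : σ.int 0 0 = n) (h1 : σ.int 0 1 = k) (hz : ∀ x, 0 < x → ∀ q, σ.int x q = 0) :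
    Wp prepare σ fun τ t => ∃ L X Y, Prepared n k L X Y τ ∧ 2 * n + 2 ≤ 2 ^ L ∧
      2 ^ L ≤ 2 * (2 * n + 2) ∧ t ≤ 2000 * ((L + 1) * (n + 1)) ∧
      ∀ i < n, X i = σ.real 0 i ∧ X (n + i) = σ.real 2 i ∧ Y i = σ.real 1 i ∧
        Y (n + i) = σ.real 3 i := by
  apply Wp.seq; apply Wp.setInt; apply Wp.seq
  refine (double_spec (m := 2 * n) ?_).mono ?_
  · simp [IntExpr.eval, h0]; omega
  rintro τ₁ t₁ ⟨a1, a2, a3, L, a4, a5, a6⟩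
  replace a2 : τ₁.real = σ.real := a2
  have b2 : τ₁.int 2 0 = 2 * n := by
    rw [a3 2 (by norm_num)]; simp [IntExpr.eval, h0]; omega
  replace a3 : ∀ x, x ≠ 1 → x ≠ 2 → τ₁.int x = σ.int x := fun x k1 k2 => by
    rw [a3 x k1]; simp [k2]
  apply Wp.seq
  refine (copyItems_spec (n := n) (by rw [a3 0 (by norm_num) (by norm_num), h0])).mono ?_
  rintro τ₂ t₂ ⟨c1, c2, c3⟩
  simp only [a2] at c3
  have d1 : τ₂.int 1 0 = 2 ^ L := by rw [c2 1 (by norm_num), a4]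
  have d2 : τ₂.int 2 0 = 2 * n := by rw [c2 2 (by norm_num), b2]
  replace c2 : ∀ x, x ≠ 1 → x ≠ 2 → x ≠ 22 → τ₂.int x = σ.int x := fun x k1 k2 k3 => by
    rw [c2 x k3, a3 x k1 k2]
  apply Wp.seq
  refine (sort_spec (ka := 4) (wa := 40) (oa := 4) (L := L) (m := 2 * n) (by norm_num) (by norm_num)
    (by norm_num) d1 d2 (by omega) (fun q => ?_)).mono ?_
  · rw [c2 40 (by norm_num) (by norm_num) (by norm_num), hz 40 (by norm_num)]
  rintro τ₃ t₃ ⟨e1, e2, e3, e4⟩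
  have f1 : τ₃.int 1 0 = 2 ^ L := by
    rw [e3 1 (by norm_num) (by norm_num) (by norm_num) (by norm_num), d1]
  have f2 : τ₃.int 2 0 = 2 * n := by
    rw [e3 2 (by norm_num) (by norm_num) (by norm_num) (by norm_num), d2]
  apply Wp.seq
  refine (sort_spec (ka := 5) (wa := 41) (oa := 5) (L := L) (m := 2 * n) (by norm_num) (by norm_num)
    (by norm_num) f1 f2 (by omega) (fun q => ?_)).mono ?_
  · rw [e3 41 (by norm_num) (by norm_num) (by norm_num) (by norm_num),
      c2 41 (by norm_num) (by norm_num) (by norm_num), hz 41 (by norm_num)]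
  rintro τ₄ t₄ ⟨g1, g2, g3, g4⟩
  rw [e2] at g2 g4
  have h41 : τ₄.int 4 = τ₃.int 4 := g3 4 (by norm_num) (by norm_num) (by norm_num) (by norm_num)
  rw [← h41] at e4
  have i1 : τ₄.int 1 0 = 2 ^ L := by
    rw [g3 1 (by norm_num) (by norm_num) (by norm_num) (by norm_num), f1]
  have i2 : τ₄.int 2 0 = 2 * n := by
    rw [g3 2 (by norm_num) (by norm_num) (by norm_num) (by norm_num), f2]
  replace g3 : ∀ x < 30, x ≠ 1 → x ≠ 2 → x ≠ 4 → x ≠ 5 → x ≠ 22 → τ₄.int x = σ.int x :=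
    fun x k0 k1 k2 k3 k4 k5 => by
      rw [g3 x (by omega) (by omega) (by omega) k4, e3 x (by omega) (by omega) (by omega) k3,
        c2 x k1 k2 k5]
  apply Wp.seq
  refine (scale_spec i2 rfl (by rw [g2]) g4).mono ?_
  rintro τ₅ t₅ ⟨j1, j2, j3, j4⟩
  have l1 : τ₅.int 1 0 = 2 ^ L := by
    rw [j3 1 (by norm_num) (by norm_num) (by norm_num) (by norm_num) (by norm_num), i1]
  have l2 : τ₅.int 2 0 = 2 * n := by
    rw [j3 2 (by norm_num) (by norm_num) (by norm_num) (by norm_num) (by norm_num), i2]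
  have l4 : τ₅.int 4 = τ₄.int 4 :=
    j3 4 (by norm_num) (by norm_num) (by norm_num) (by norm_num) (by norm_num)
  rw [← l4] at e4
  have l5 : ∀ x, x ≠ 6 → τ₅.real x = τ₂.real x := fun x hx => by rw [j2 x hx, g2]
  replace j3 : ∀ x < 22, x = 0 ∨ 6 < x → τ₅.int x = σ.int x := fun x hx hx' => by
    rw [j3 x (by omega) (by omega) (by omega) (by omega) (by omega),
      g3 x (by omega) (by omega) (by omega) (by omega) (by omega) (by omega)]
  have htop := j4.top_le
  apply Wp.seq; apply Wp.setInt; apply Wp.seq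
  refine (insertElem_spec (a := 15) (L := L) (B := ∅) (p := 0) (by norm_num) ?_ ?_ ?_
    (by positivity)).mono ?_
  · simpa using l1
  · refine storesSet_zero L fun q => ?_
    simp [j3, hz]
  · simp [IntExpr.eval]
  rintro τ₆ t₆ ⟨m1, m2, m3, m4⟩
  replace m2 : τ₆.real = τ₅.real := m2
  replace m3 : ∀ x < 30, x ≠ 15 → τ₆.int x = τ₅.int x := fun x hx hx' => by
    rw [m3 x (by omega) hx']; simp [show x ≠ 30 by omega]
  apply Wp.seq; apply Wp.setInt; apply Wp.seq
  refine (insertElem_spec (a := 15) (L := L) (B := insert 0 ∅) (p := τ₅.int 6 0) (by norm_num) ?_ ?_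
    ?_ (by omega)).mono ?_
  · simp [m3, l1]
  · simpa using m4
  · simp [IntExpr.eval, m3]
  rintro τ₇ t₇ ⟨o1, o2, o3, o4⟩
  replace o2 : τ₇.real = τ₅.real := o2.trans m2
  replace o3 : ∀ x < 30, x ≠ 15 → τ₇.int x = τ₅.int x := fun x hx hx' => by
    rw [o3 x (by omega) hx']; simp [show x ≠ 30 by omega, m3 x hx hx']
  apply Wp.seq; apply Wp.setInt; apply Wp.seq; apply Wp.setReal; apply Wp.setReal
  refine ⟨L, τ₂.real 4, τ₂.real 5, ⟨⟨?_, ?_, ?_, ?_, ?_, ?_, ?_⟩, ?_, ?_, ?_, ?_, ?_, ?_, ?_, ?_, ?_⟩, a5, a6,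
    ?_, c3⟩
  · simp [o3, j3, h0]
  · simp [o3, l2]
  · simp
  · simp
  · simp
  · simp [o2, l5]
  · simp [o2, l5]
  · simpa [o3] using e4
  · simpa [o3, o2] using j4
  · simp [o3, l1]
  · simp [o3, j3, h1]
  · have : insert (τ₅.int 6 0) (insert 0 (∅ : Finset ℕ)) = {0, τ₅.int 6 0} := by
      ext x; simp [or_comm]
    rw [this] at o4
    simpa [o3] using o4
  · intro x hx hx' h15 q
    simp [show x ≠ 21 by omega, o3 x (by omega) h15, j3 x (by omega) (by omega), hz x (by omega)]
  · simp [IntExpr.eval]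
  · simp [IntExpr.eval, RealExpr.eval, o3, o2, l5]
  · simp [IntExpr.eval, RealExpr.eval, o3, o2, l5]
    ring
  · have w1 : (L + 1) * (2 * n + 1) = 2 * ((L + 1) * n) + (L + 1) := by ring
    have w2 : (L + 1) * (n + 1) = (L + 1) * n + (L + 1) := by ring
    have w3 := Nat.mul_le_mul_right n (show 1 ≤ L + 1 by omega)
    rw [w1] at e1 g1
    rw [w2]
    simp only [IntExpr.cost, RealExpr.cost]
    omega

end RealRAM

/-! ### From the input to a scene, and the complete program -/

namespace AxisSegment

theorem segment_eq_box {x x' y y' : ℝ} (hx : x ≤ x') (hy : y ≤ y') (h : x = x' ∨ y = y') :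
    segment ℝ ((x, y) : Plane) (x', y') =
      {z | x ≤ z.1 ∧ z.1 ≤ x' ∧ y ≤ z.2 ∧ z.2 ≤ y'} := by
  rcases h with rfl | rfl
  · rw [← Prod.image_mk_segment_right, segment_eq_Icc hy]
    ext ⟨a, b⟩
    simp only [Set.mem_image, Set.mem_Icc, Prod.mk.injEq, Set.mem_ofPred_eq]
    constructor
    · rintro ⟨c, ⟨h1, h2⟩, rfl, rfl⟩
      exact ⟨le_rfl, le_rfl, h1, h2⟩
    · rintro ⟨h1, h2, h3, h4⟩
      exact ⟨b, ⟨h3, h4⟩, le_antisymm h1 h2, rfl⟩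
  · rw [← Prod.image_mk_segment_left, segment_eq_Icc hx]
    ext ⟨a, b⟩
    simp only [Set.mem_image, Set.mem_Icc, Prod.mk.injEq, Set.mem_ofPred_eq]
    constructor
    · rintro ⟨c, ⟨h1, h2⟩, rfl, rfl⟩
      exact ⟨h1, h2, le_rfl, le_rfl⟩
    · rintro ⟨h1, h2, h3, h4⟩
      exact ⟨a, ⟨h1, h2⟩, rfl, le_antisymm h3 h4⟩

end AxisSegment

namespace RealRAM

variable {n k l : ℕ} {σ τ : State} {X Y : ℕ → ℝ} {pos : ℕ → ℕ} {ht : ℕ → ℝ}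

/-- Disjoint segments, given by the coordinates of their endpoints, form a scene. -/
theorem exists_scene {top : ℕ} {T : Fin n → AxisSegment}
    (hdisj : ∀ i j : Fin n, i ≠ j → Disjoint (T i).points (T j).points)
    (hT : ∀ i : Fin n, X i = (T i).fst.1 ∧ X (n + i) = (T i).snd.1 ∧ Y i = (T i).fst.2 ∧
      Y (n + i) = (T i).snd.2)
    (hs : IsScale Y (2 * n) pos ht top) :
    ∃ (S : Scene n) (act oth : Fin n → ℕ), Items S X Y pos act oth ∧ S.top = top ∧ S.ht = ht ∧
      ∀ i, S.box i = (T i).points := by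
  have hends : ∀ i : Fin n, ∃ a b : ℕ, ((a = i ∧ b = n + i) ∨ (a = n + i ∧ b = i)) ∧
      ((X a < X b ∧ Y a = Y b) ∨ (X a = X b ∧ Y a < Y b)) := by
    intro i
    obtain ⟨h1, h2, h3, h4⟩ := hT i
    have hne := (T i).ne
    rw [Ne, Prod.ext_iff, ← h1, ← h2, ← h3, ← h4] at hne
    rcases (T i).axisParallel with h | h
    · rw [← h1, ← h2] at h
      rcases lt_trichotomy (Y i) (Y (n + i)) with hlt | heq | hlt
      · exact ⟨i, n + i, .inl ⟨rfl, rfl⟩, .inr ⟨h, hlt⟩⟩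
      · exact absurd ⟨h, heq⟩ hne
      · exact ⟨n + i, i, .inr ⟨rfl, rfl⟩, .inr ⟨h.symm, hlt⟩⟩
    · rw [← h3, ← h4] at h
      rcases lt_trichotomy (X i) (X (n + i)) with hlt | heq | hlt
      · exact ⟨i, n + i, .inl ⟨rfl, rfl⟩, .inl ⟨hlt, h⟩⟩
      · exact absurd ⟨heq, h⟩ hne
      · exact ⟨n + i, i, .inr ⟨rfl, rfl⟩, .inl ⟨hlt, h.symm⟩⟩
  choose act oth hcases hshape using hends
  have hact : ∀ i, act i < 2 * n := fun i => by
    have := hcases i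
    have := i.isLt
    omega
  have hoth : ∀ i, oth i < 2 * n := fun i => by
    have := hcases i
    have := i.isLt
    omega
  have hpoints : ∀ i, (T i).points = {z | X (act i) ≤ z.1 ∧ z.1 ≤ X (oth i) ∧ Y (act i) ≤ z.2 ∧
      z.2 ≤ Y (oth i)} := by
    intro i
    have h5 : segment ℝ ((X (act i), Y (act i)) : Plane) (X (oth i), Y (oth i)) = (T i).points := by
      obtain ⟨h1, h2, h3, h4⟩ := hT i
      rcases hcases i with ⟨ha, ho⟩ | ⟨ha, ho⟩
      · rw [ha, ho, h1, h2, h3, h4]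
        rfl
      · rw [ha, ho, h1, h2, h3, h4, segment_symm]
        rfl
    rw [← h5]
    rcases hshape i with h | h
    · exact AxisSegment.segment_eq_box h.1.le h.2.le (.inr h.2)
    · exact AxisSegment.segment_eq_box h.1.le h.2.le (.inl h.1)
  have hXle : ∀ i, X (act i) ≤ X (oth i) := fun i =>
    (hshape i).elim (fun h => h.1.le) fun h => h.1.le
  have hYle : ∀ i, Y (act i) ≤ Y (oth i) := fun i =>
    (hshape i).elim (fun h => h.2.le) fun h => h.2.le
  refine ⟨{
    xl := fun i => X (act i)
    xr := fun i => X (oth i)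
    yl := fun i => Y (act i)
    yr := fun i => Y (oth i)
    lo := fun i => pos (act i)
    hi := fun i => pos (oth i)
    top := top
    ht := ht
    shape := hshape
    disj := fun i j hij h1 h2 h3 h4 => ?_
    ht_lt := hs.lt
    ht_lo := fun i => hs.ht_pos _ (hact i)
    ht_hi := fun i => hs.ht_pos _ (hoth i)
    lo_pos := fun i => hs.pos_pos _ (hact i)
    hi_pos := fun i => hs.pos_pos _ (hoth i)
    lo_lt := fun i => hs.pos_lt _ (hact i)
    hi_lt := fun i => hs.pos_lt _ (hoth i)
    top_pos := hs.top_pos }, act, oth, ⟨hcases, fun _ => rfl, fun _ => rfl, fun _ => rfl,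
    fun _ => rfl, fun _ => rfl, fun _ => rfl⟩, rfl, rfl, fun i => (hpoints i).symm⟩
  -- Two boxes whose projections overlap share the point whose coordinates are the larger of the two
  -- lower bounds.
  have hi : (max (X (act i)) (X (act j)), max (Y (act i)) (Y (act j))) ∈ (T i).points := by
    rw [hpoints]
    exact ⟨le_max_left _ _, max_le (hXle i) h2, le_max_left _ _, max_le (hYle i) h4⟩
  refine Set.disjoint_left.mp (hdisj i j hij) hi ?_
  rw [hpoints]
  exact ⟨le_max_right _ _, max_le h1 (hXle j), le_max_right _ _, max_le h3 (hYle j)⟩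

/-- Locate modems that illuminate the plane. -/
def locateModems : Program := .seq prepare <| .seq sweep finish

/-- The count is stated without division, and the time in terms of the height `L` of the trees, so
that no real logarithm occurs in the analysis of the program. -/
theorem locateModems_spec (hk : 0 < k) (T : Fin n → AxisSegment)
    (hdisj : ∀ i j : Fin n, i ≠ j → Disjoint (T i).points (T j).points) :
    Wp locateModems (modemInput k T) fun τ t =>
      (∃ L, 2 ^ L ≤ 2 * (2 * n + 2) ∧ t ≤ 30000 * ((L + 1) * (n + 1))) ∧
      k * modemCount τ ≤ k + 6 * n ∧ IlluminatePlane k T (modemLocations τ) := by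
  apply Wp.seq
  refine (prepare_spec (n := n) (k := k) rfl rfl (fun x hx q => ?_)).mono ?_
  · match x, hx with
    | x + 1, _ => rfl
  rintro τ₁ t₁ ⟨L, X, Y, hp, hL, hL', ht₁, hcoord⟩
  obtain ⟨S, act, oth, hI, htop, hht, hbox⟩ := exists_scene (T := T) (X := X) (Y := Y) hdisj
    (fun i => by simpa [modemInput, i.isLt] using hcoord i i.isLt) hp.scale
  have hle := hp.scale.top_le
  -- The line starts one unit left of the first endpoint, so the invariant holds before anything has
  -- been processed.
  set s : Sweep := ⟨{0, S.top}, ∅, fun _ => 0, fun _ => 0, fun _ => 0, 0, fun _ => 0, 1,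
    X (τ₁.int 4 0) - 2, X (τ₁.int 4 0) - 1⟩ with hs
  have hX : ∀ j < 2 * n, s.X ≤ X (τ₁.int 4 j) := fun j hj => by
    have := hp.sorting.mono 0 j (Nat.zero_le j) hj
    simp only [hs]
    linarith
  obtain ⟨u, φ, hinv⟩ := Scene.inv_init (S := S) (k := k) (s := s) (Xp := X (τ₁.int 4 0) - 3) rfl rfl
    rfl rfl (fun _ => rfl) rfl Nat.one_pos (by simp only [hs]; linarith) (by simp only [hs]; linarith)
    (fun i => by
      obtain ⟨j, hj, hji⟩ := hp.sorting.surj (hI.act_lt i)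
      rw [← hI.X_act, ← hji]
      exact hX j hj)
  have hz : ∀ x, 7 ≤ x → x < 21 → x ≠ 15 → τ₁.int x = fun _ => 0 := fun x h1 h2 h3 =>
    funext (hp.zero x h1 h2 h3)
  have hrep : Rep S k L τ₁ s := by
    refine ⟨hp.size, hp.quota, ?_, storesSet_zero L fun q => by rw [hz] <;> norm_num, ?_, ?_, ?_, ?_,
      hp.line, fun j hj => absurd hj (Nat.not_lt_zero j), fun p _ => by rw [hht], hp.abscissa,
      hp.before, ?_⟩
    · simpa [hs, htop] using hp.boundaries
    · rw [hz] <;> norm_num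
    · rw [hz] <;> norm_num
    · rw [hz] <;> norm_num
    · rw [hz] <;> norm_num
    · omega
  apply Wp.seq
  refine (sweep_spec hk hI hp.env hp.sorting hinv hrep (by rw [hz] <;> norm_num)
    (by rw [hz] <;> norm_num) Finset.card_le_two hX).mono ?_
  rintro τ₂ t₂ ⟨ht₂, hE, s', u', φ', Xp', r', hinv'⟩
  refine (finish_spec hinv' r' (by rw [hE.top, htop])).mono ?_
  rintro τ₃ t₃ ⟨ht₃, hcount, hsees⟩
  refine ⟨⟨L, hL', ?_⟩, ?_, fun p => ?_⟩
  · have h1 := Nat.mul_le_mul_left (L + 1) (show S.top + 1 ≤ 2 * (n + 1) by omega)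
    rw [Nat.mul_left_comm] at h1
    omega
  · have h1 : 6 * k * τ₃.int 0 0 = 6 * (k * τ₃.int 0 0) := by ring
    rw [modemCount]
    omega
  · obtain ⟨j, hj, hsee⟩ := hsees p
    refine ⟨_, ⟨j, hj, rfl⟩, ?_⟩
    unfold Scene.Sees at hsee
    simp only [hbox] at hsee
    exact hsee

theorem mul_le_mul_log {L n : ℕ} (hL : 2 ^ L ≤ 2 * (2 * n + 2)) :
    (((L + 1) * (n + 1) : ℕ) : ℝ) ≤ 40 * ((n : ℝ) * Real.log n + 1) := by
  -- For `n < 2` the product `n log n` vanishes and the summand `1` has to carry the estimate.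
  rcases Nat.lt_or_ge n 2 with hn | hn
  · have hL3 : L ≤ 3 := by
      by_contra h
      have := Nat.pow_le_pow_right (n := 2) (by norm_num) (show 4 ≤ L by omega)
      omega
    have h1 : (L + 1) * (n + 1) ≤ 4 * 2 := Nat.mul_le_mul (by omega) (by omega)
    have h2 : (((L + 1) * (n + 1) : ℕ) : ℝ) ≤ 8 := by exact_mod_cast h1
    have h3 : (0 : ℝ) ≤ n * Real.log n := mul_nonneg (Nat.cast_nonneg n) (Real.log_natCast_nonneg n)
    linarith
  · have hn' : (2 : ℝ) ≤ n := by exact_mod_cast hn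
    have hlog2 := Real.log_two_gt_d9
    have hlogn : 0.69 ≤ Real.log n :=
      (by linarith : (0.69 : ℝ) ≤ Real.log 2).trans (Real.log_le_log (by norm_num) hn')
    have h1 : ((2 : ℝ) ^ L) ≤ 2 ^ 3 * n := by
      have : ((2 ^ L : ℕ) : ℝ) ≤ ((2 * (2 * n + 2) : ℕ) : ℝ) := by exact_mod_cast hL
      push_cast at this
      linarith
    have h2 := Real.log_le_log (by positivity) h1
    rw [Real.log_mul (by norm_num) (by positivity), Real.log_pow, Real.log_pow] at h2
    push_cast at h2
    -- From `h2`, `L log 2 ≤ 3 log 2 + log n ≤ 4 log n`, and `4 / 0.69 < 6`.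
    have h3 : (L : ℝ) ≤ 6 * Real.log n := by
      have hlog2' := Real.log_two_lt_d9
      have hle : Real.log 2 ≤ Real.log n := Real.log_le_log (by norm_num) hn'
      have : (L : ℝ) * 0.69 ≤ L * Real.log 2 :=
        mul_le_mul_of_nonneg_left (by linarith) (Nat.cast_nonneg L)
      linarith
    have h4 : (L : ℝ) + 1 ≤ 8 * Real.log n := by linarith
    have h5 : (n : ℝ) + 1 ≤ 2 * n := by linarith
    have h6 := mul_le_mul h4 h5 (by positivity) (by positivity)
    have h7 : (0 : ℝ) ≤ n * Real.log n := by positivity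
    push_cast
    linarith

end RealRAM

/-! ### The theorem -/

theorem mainTheorem3 :
    (∀ (n k : ℕ), 0 < k → ∀ L : Fin n → AxisSegment,
      (∀ i j : Fin n, i ≠ j → Disjoint (L i).points (L j).points) →
        ∃ M : Finset Plane, (M.card : ℝ) ≤ 6 * (n : ℝ) / (k : ℝ) + 1 ∧
          IlluminatePlane k L (M : Set Plane)) ∧
    ∃ (A : RealRAM.Program) (C : ℝ),
      ∀ (n k : ℕ), 0 < k → ∀ L : Fin n → AxisSegment,
        (∀ i j : Fin n, i ≠ j → Disjoint (L i).points (L j).points) →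
          ∃ (σ : RealRAM.State) (t : ℕ),
            RealRAM.Runs A (modemInput k L) σ t ∧
            (t : ℝ) ≤ C * ((n : ℝ) * Real.log (n : ℝ) + 1) ∧
            (modemCount σ : ℝ) ≤ 6 * (n : ℝ) / (k : ℝ) + 1 ∧
            IlluminatePlane k L (modemLocations σ) := by
  have hcount : ∀ {n k c : ℕ}, 0 < k → k * c ≤ k + 6 * n → (c : ℝ) ≤ 6 * (n : ℝ) / (k : ℝ) + 1 := by
    intro n k c hk h
    have hk' : (0 : ℝ) < k := by exact_mod_cast hk
    have h' : (k : ℝ) * c ≤ k + 6 * n := by exact_mod_cast h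
    rw [div_add_one hk'.ne', le_div_iff₀ hk']
    linarith
  constructor
  · classical
    intro n k hk L hL
    obtain ⟨σ, t, -, -, h1, h2⟩ := RealRAM.locateModems_spec hk L hL
    -- The existence part is read off from the output of the program; coinciding locations only make
    -- the set smaller.
    refine ⟨(Finset.range (modemCount σ)).image (modemLocation σ), ?_, fun p => ?_⟩
    · refine le_trans ?_ (hcount hk h1)
      exact_mod_cast Finset.card_image_le.trans (Finset.card_range _).le
    · obtain ⟨_, ⟨j, hj, rfl⟩, h3⟩ := h2 p
      exact ⟨_, Finset.mem_coe.mpr (Finset.mem_image_of_mem _ (Finset.mem_range.mpr hj)), h3⟩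
  · refine ⟨RealRAM.locateModems, 30000 * 40, fun n k hk L hL => ?_⟩
    obtain ⟨σ, t, hrun, ⟨l, hl, ht⟩, h1, h2⟩ := RealRAM.locateModems_spec hk L hL
    refine ⟨σ, t, hrun, ?_, hcount hk h1, h2⟩
    have h3 := RealRAM.mul_le_mul_log hl
    have h4 : (t : ℝ) ≤ 30000 * (((l + 1) * (n + 1) : ℕ) : ℝ) := by exact_mod_cast ht
    linarith
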